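/- **Strings and factorizations.** Let $X=X[0..n)$ be a string over $\{0,\dots,\sigma-1\}$, $n,\sigma\ge 2$, $\sigma\le n^{k}$. An LZ77-type factorization of $X$ is a division of $X$ into phrases, each either a literal (one symbol) or a repeat phrase $(p,\ell)$, $\ell\ge1$, which at position $q$ satisfies $p<q$ and $X[p..p+\ell)=X[q..q+\ell)$, such that the number $z_{\rm rep}$ of repeat phrases is at most $K\,n/\log_\sigma n$. **Machine.** We use the external memory model: a RAM of $M$ words, a disk of blocks of $B$ words, free internal computation, and cost one per block moved between RAM and disk. A word has $\kappa\lceil\log_2 n\rceil$ bits and holds an integer or a packed string; $d=\max(1,\lfloor\log_\sigma n\rfloor)$ symbols are packed into one word. We assume $B\ge1$ and $M\ge 64B$. In the input, a repeat phrase takes two words, and each maximal run of $r$ literals takes $\lceil r/d\rceil$ words. The output is $X$ packed with $d$ symbols per word. Both are stored in consecutive blocks of $B$ words. **Algorithm.** Cut $X$ into segments $X_0,X_1,\dots$ of $b=dm$ symbols (the last may be shorter), where $B\mid m$ and $m\ge M/2$. Choose a fan-out $f\ge4$ such that $fB\ge M/16$ or $\lceil n/b\rceil\le f$. A level-$l$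 supersegment consists of $f^{l}$ consecutive segments, and $L$ is the least integer with $\lceil n/b\rceil\le f^{L}$. The RAM holds a segment array of $m$ words, $f+5$ buffers of $B$ words and $15$ registers, and $m+(f+5)B+15\le M$ is required; call such $(m,f)$ admissible. 1. *Splitting.* Scan the input and cut phrases so that each part, and its source, lies inside one segment. Write the literals (as position plus packed run) to a sequence $L_{\rm lit}$; the repeat parts $(p,q,\ell)$ (source position, phrase position, length) with $q-p\le b$ to $R_{\rm prev}$ or $R_{\rm same}$, according to whether the source is in the preceding or in the same segment; and the far parts ($q-p>b$) to one sequence. 2. *Distribution.* In $L$ rounds, distribute the far parts by source position, from each supersegment to its $f$ parts of the next lower level, into unsorted sequences $R_0,R_1,\dots$, one per segment. 3. *Recovery.* For $j=0,1,\dots$: for each supersegment (from the highest level to the lowest) that begins with $X_j$, distribute its queue to the queues of its parts. Then recover $X_j$ in the array, which initially holds $X_{j-1}$, in this order: the parts in $R_{\rm prev}$, the literals, the far parts from the queue $Q_j$ (triples $(q,\ell,s)$ with literal string $s$, in arbitrary order), the parts in $R_{\rm same}$ from left to right. Write $X_j$ to the output. Finally read $R_j$, once for each level $l=1,\dots,L$,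 and append each of its parts, as a triple $(q,\ell,s)$, to a queue: if the lowest supersegment containing both $X_j$ and the segment of $q$ has level $l$, it goes to the queue of the level-$(l-1)$ supersegment containing $q$ (level $0$ being the segment itself). **Claim.** For every $k$ there is $\kappa$, and for every $K$ there is then a constant $C$, such that for all $n,\sigma,M,B$ as above, admissible $(m,f)$ exist, and for every admissible $(m,f)$, every string $X$ of length $n$ over $\{0,\dots,\sigma-1\}$ and every LZ77-type factorization of $X$, the algorithm never exceeds the RAM of $M$ words or the word size, halts with $X$ as its output, and performs at most $$C\cdot\max\Bigl(1,\frac{n}{B\log_\sigma n}\Bigr)\cdot\max\Bigl(1,\log_{M/B}\frac{n}{B\log_\sigma n}\Bigr)$$ I/Os. In particular it performs $O\bigl(\frac{n}{B\log_\sigma n}\log_{M/B}\frac{n}{B\log_\sigma n}\bigr)$ I/Os whenever $\frac{n}{B\log_\sigma n}\ge \frac MB$. -/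

import Mathlib

/-! Decoding of Lempel-Ziv type factorizations in external memory: strings and factorizations,
the external memory machine, and the decoding algorithm that uses distribution only. -/

namespace EMLZ

/-! ### Strings and LZ77-type factorizations

A string over the alphabet `{0, …, σ - 1}` is a list of natural numbers below `σ`;
positions are counted from `0`. -/

/-- A phrase: a literal symbol, or a repeat phrase with source position `p` and length `l`. -/
inductive Phrase where
  | lit (c : ℕ)
  | rep (p l : ℕ)

/-- `FactorsFrom X i zs`: the phrases `zs` factorize the suffix of `X` that starts at `i`.
A repeat phrase is nonempty and has an earlier source, which may overlap the phrase. -/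
def FactorsFrom (X : List ℕ) : ℕ → List Phrase → Prop
  | i, [] => i = X.length
  | i, Phrase.lit c :: zs => X[i]? = some c ∧ FactorsFrom X (i + 1) zs
  | i, Phrase.rep p l :: zs =>
      0 < l ∧ p < i ∧ i + l ≤ X.length ∧ (∀ t < l, X[p + t]? = X[i + t]?) ∧
        FactorsFrom X (i + l) zs

/-- `zs` is a factorization of `X` into literal and repeat phrases. -/
def Factorizes (X : List ℕ) (zs : List Phrase) : Prop := FactorsFrom X 0 zs

/-- The number of repeat phrases. -/
def repCount : List Phrase → ℕ
  | [] => 0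
  | Phrase.lit _ :: zs => repCount zs
  | Phrase.rep _ _ :: zs => repCount zs + 1

/-! ### Machine words, disk and RAM -/

/-- A machine word holds an integer or a short packed string. -/
inductive Cell where
  | int (v : ℕ)
  | str (s : List ℕ)

/-- Number of bits of a word: one bit for the kind, then the integer, or the length of the
string followed by its symbols. -/
def Cell.bits (σ : ℕ) : Cell → ℕ
  | Cell.int v => 1 + Nat.size v
  | Cell.str s => 1 + Nat.size s.length + s.length * Nat.clog 2 σ

/-- The word fits into `w` bits over the alphabet `{0, …, σ - 1}`. -/
def Cell.Fits (σ w : ℕ) : Cell → Prop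
  | Cell.int v => (Cell.int v).bits σ ≤ w
  | Cell.str s => (∀ x ∈ s, x < σ) ∧ (Cell.str s).bits σ ≤ w

def Cell.val : Cell → ℕ
  | Cell.int v => v
  | Cell.str _ => 0

def Cell.syms : Cell → List ℕ
  | Cell.int _ => []
  | Cell.str s => s

def Cell.isStr : Cell → Bool
  | Cell.int _ => false
  | Cell.str _ => true

/-- The string `X`, packed with `d` symbols per word (the last word may hold fewer). -/
def pack (d : ℕ) (X : List ℕ) : List Cell :=
  (List.range ((X.length + d - 1) / d)).map fun t => Cell.str ((X.drop (t * d)).take d)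

/-- The encoding of a factorization: two integers for a repeat phrase, and packed words with at
most `d` literals each for the runs of literal phrases. A run of `r` literals takes
`⌈r / d⌉` words. -/
def encode (d : ℕ) : List Phrase → List Cell
  | [] => []
  | Phrase.rep p l :: zs => Cell.int p :: Cell.int l :: encode d zs
  | Phrase.lit c :: zs =>
      match encode d zs with
      | Cell.str s :: ws =>
          if s.length < d then Cell.str (c :: s) :: ws else Cell.str [c] :: Cell.str s :: ws
      | ws => Cell.str [c] :: ws

/-- The `k`-th block of a sequence of words that is cut into blocks of `B` words. -/
def blockOf (B : ℕ) (ws : List Cell) (k : ℕ) : List Cell := (ws.drop (k * B)).take B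

/-- Names of the sequences on disk. `R l i` and `Q l i` belong to the `i`-th supersegment of
level `l`, which consists of `f ^ l` consecutive segments; level `0` is the segments. -/
inductive File where
  | input
  | output
  | lits
  | prev
  | same
  | R (l i : ℕ)
  | Q (l i : ℕ)
  deriving DecidableEq

/-- Disk addresses: every sequence has numbered blocks and one block for its length. -/
inductive Addr where
  | head (F : File)
  | block (F : File) (k : ℕ)
  deriving DecidableEq

/-- The contents of the disk; each address holds one block. -/
abbrev Disk := Addr → List Cell

/-- The disk that holds the words `ws` as input in blocks of `B` words, and nothing else. -/
def initDisk (B : ℕ) (ws : List Cell) : Disk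
  | Addr.block File.input k => blockOf B ws k
  | _ => []

/-- The input buffers. -/
inductive Slot where
  | scan
  | lits
  | prev
  | same
  deriving DecidableEq

/-- The RAM: a buffer `io` for the block being transferred, input buffers `inp` with the number
`pos` of the next block to be read, output buffers `out`, the segment array `Y`, one register `w`
for a packed string and nine integer registers. -/
structure Ram where
  io : List Cell
  inp : Slot → List Cell
  pos : Slot → ℕ
  out : ℕ → List Cell
  Y : List ℕ
  w : List ℕ
  p : ℕ
  q : ℕ
  l : ℕ
  t : ℕ
  j : ℕ
  lev : ℕ
  i : ℕ
  c : ℕ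
  cnt : ℕ

def initRam : Ram where
  io := []
  inp := fun _ => []
  pos := fun _ => 0
  out := fun _ => []
  Y := []
  w := []
  p := 0
  q := 0
  l := 0
  t := 0
  j := 0
  lev := 0
  i := 0
  c := 0
  cnt := 0

/-! ### External memory programs

Internal computation is free, a transfer of one block costs one I/O. The whole memory of a
program is the RAM; control is a fixed program text. -/

inductive Prog where
  | skip
  | assign (g : Ram → Ram)
  | read (a : Ram → Addr)
  | write (a : Ram → Addr)
  | seq (P Q : Prog)
  | cond (b : Ram → Bool) (P Q : Prog)
  | loop (b : Ram → Bool) (P : Prog)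

infixr:60 " ;; " => Prog.seq

/-- `Exec ok P r D k r' D'`: the program `P`, started with RAM `r` and disk `D`, halts with RAM
`r'` and disk `D'` after exactly `k` I/Os, and every RAM state it produces satisfies `ok`. -/
inductive Exec (ok : Ram → Prop) : Prog → Ram → Disk → ℕ → Ram → Disk → Prop
  | skip (r D) : Exec ok Prog.skip r D 0 r D
  | assign (g r D) (h : ok (g r)) : Exec ok (Prog.assign g) r D 0 (g r) D
  | read (a r D) (h : ok { r with io := D (a r) }) :
      Exec ok (Prog.read a) r D 1 { r with io := D (a r) } D
  | write (a r D) : Exec ok (Prog.write a) r D 1 r (Function.update D (a r) r.io)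
  | seq {P Q r D k r' D' k' r'' D''} (h : Exec ok P r D k r' D') (h' : Exec ok Q r' D' k' r'' D'') :
      Exec ok (P ;; Q) r D (k + k') r'' D''
  | cond_true {b P Q r D k r' D'} (hb : b r = true) (h : Exec ok P r D k r' D') :
      Exec ok (Prog.cond b P Q) r D k r' D'
  | cond_false {b P Q r D k r' D'} (hb : b r = false) (h : Exec ok Q r D k r' D') :
      Exec ok (Prog.cond b P Q) r D k r' D'
  | loop_false {b P r D} (hb : b r = false) : Exec ok (Prog.loop b P) r D 0 r D
  | loop_true {b P r D k r' D' k' r'' D''} (hb : b r = true) (h : Exec ok P r D k r' D')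
      (h' : Exec ok (Prog.loop b P) r' D' k' r'' D'') :
      Exec ok (Prog.loop b P) r D (k + k') r'' D''

/-! ### Parameters of a run -/

/-- String length `n`, alphabet size `σ`, RAM size `M` and block size `B` in words, size `m` of
the segment array in words, and number `f` of segments (or supersegments of one level) that are
grouped into a supersegment of the next level. -/
structure Params where
  n : ℕ
  σ : ℕ
  M : ℕ
  B : ℕ
  m : ℕ
  f : ℕ

namespace Params

/-- Number of symbols per word, `max (1, ⌊log_σ n⌋)`. -/
def d (P : Params) : ℕ := max 1 (Nat.log P.σ P.n)

/-- Segment size in symbols. -/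
def b (P : Params) : ℕ := P.d * P.m

/-- Number of segments, `⌈n / b⌉`. -/
def segs (P : Params) : ℕ := (P.n + P.b - 1) / P.b

/-- Number of rounds of distribution: the least `L` with `segs ≤ f ^ L`. -/
def L (P : Params) : ℕ := Nat.clog P.f P.segs

/-- RAM used in words: `f` output buffers, four input buffers and the transfer buffer with `B`
words each, the segment array, and 15 registers (nine integers, four block numbers, one packed
string, the program counter). -/
def ramWords (P : Params) : ℕ := (P.f + 5) * P.B + P.m + 15

/-- An admissible division of the RAM: the segment array takes at least half of the RAM and a
whole number of blocks, and there are `Ω(M / B)` output buffers unless fewer already suffice for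
one round of distribution. -/
structure Admissible (P : Params) : Prop where
  dvd : P.B ∣ P.m
  half : P.M ≤ 2 * P.m
  four_le : 4 ≤ P.f
  fanout : P.M ≤ 16 * (P.f * P.B) ∨ P.segs ≤ P.f
  fits : P.ramWords ≤ P.M

/-- The RAM state fits into RAM with words of `w` bits. -/
structure RamFits (P : Params) (w : ℕ) (r : Ram) : Prop where
  words : P.ramWords ≤ P.M
  io_len : r.io.length ≤ P.B
  inp_len : ∀ s, (r.inp s).length ≤ P.B
  out_len : ∀ c, (r.out c).length ≤ P.B
  out_nil : ∀ c, P.f ≤ c → r.out c = []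
  Y_len : (pack P.d r.Y).length ≤ P.m
  io_fits : ∀ x ∈ r.io, x.Fits P.σ w
  inp_fits : ∀ s, ∀ x ∈ r.inp s, x.Fits P.σ w
  out_fits : ∀ c, ∀ x ∈ r.out c, x.Fits P.σ w
  Y_fits : ∀ x ∈ pack P.d r.Y, x.Fits P.σ w
  w_fits : (Cell.str r.w).Fits P.σ w
  pos_fits : ∀ s, (Cell.int (r.pos s)).Fits P.σ w
  reg_fits : ∀ v ∈ [r.p, r.q, r.l, r.t, r.j, r.lev, r.i, r.c, r.cnt], (Cell.int v).Fits P.σ w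

end Params

/-! ### Sequential access to the sequences on disk -/

/-- Start reading a sequence from its first block. -/
def rewind (s : Slot) : Prog :=
  Prog.assign fun r =>
    { r with inp := Function.update r.inp s [], pos := Function.update r.pos s 0 }

/-- If the input buffer is empty, read the next block of `F` into it. It stays empty exactly at
the end of the sequence. -/
def fill (s : Slot) (F : Ram → File) : Prog :=
  Prog.cond (fun r => (r.inp s).isEmpty)
    (Prog.read (fun r => Addr.block (F r) (r.pos s)) ;;
      Prog.assign fun r =>
        { r with
          inp := Function.update r.inp s r.io
          pos := Function.update r.pos s (r.pos s + 1)
          io := [] })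
    Prog.skip

/-- Extract the next word of `F` and process it by `g`. -/
def next (s : Slot) (F : Ram → File) (g : Cell → Ram → Ram) : Prog :=
  fill s F ;;
  Prog.assign fun r =>
    match r.inp s with
    | [] => r
    | x :: xs => g x { r with inp := Function.update r.inp s xs }

/-- Extract the next triple `(p, q, l)` of `F` into the registers. -/
def nextTriple (s : Slot) (F : Ram → File) : Prog :=
  next s F (fun x r => { r with p := x.val }) ;;
  next s F (fun x r => { r with q := x.val }) ;;
  next s F (fun x r => { r with l := x.val })

/-- Repeat `body` until the end of `F`. -/
def whileMore (s : Slot) (F : Ram → File) (body : Prog) : Prog :=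
  fill s F ;; Prog.loop (fun r => !(r.inp s).isEmpty) (body ;; fill s F)

/-- Repeat `body` as long as the next word of `F` is an integer below `bound`. -/
def whileBelow (s : Slot) (F : Ram → File) (bound : Ram → ℕ) (body : Prog) : Prog :=
  fill s F ;;
  Prog.loop
    (fun r =>
      match r.inp s with
      | Cell.int v :: _ => decide (v < bound r)
      | _ => false)
    (body ;; fill s F)

/-- Append output buffer `c` to `F` as a new block; the number of blocks of `F` is kept in the
block `Addr.head F` (an empty block stands for zero). -/
def flush (c : Ram → ℕ) (F : Ram → File) : Prog :=
  Prog.read (fun r => Addr.head (F r)) ;;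
  Prog.assign (fun r =>
    { r with
      cnt := (r.io.headD (Cell.int 0)).val
      io := r.out (c r)
      out := Function.update r.out (c r) [] }) ;;
  Prog.write (fun r => Addr.block (F r) r.cnt) ;;
  Prog.assign (fun r => { r with io := [Cell.int (r.cnt + 1)] }) ;;
  Prog.write (fun r => Addr.head (F r)) ;;
  Prog.assign (fun r => { r with io := [] })

namespace Params

variable (P : Params)

/-- Append the word `x` to `F` through output buffer `r.c`. -/
def put (F : Ram → File) (x : Ram → Cell) : Prog :=
  Prog.assign (fun r =>
    { r with out := Function.update r.out r.c (r.out r.c ++ [x r]) }) ;;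
  Prog.cond (fun r => decide (P.B ≤ (r.out r.c).length)) (flush (fun r => r.c) F) Prog.skip

/-- Append the triple `(p, q, l)`. -/
def putTriple (F : Ram → File) (l : Ram → ℕ) : Prog :=
  P.put F (fun r => Cell.int r.p) ;; P.put F (fun r => Cell.int r.q) ;;
  P.put F (fun r => Cell.int (l r))

/-- Flush all nonempty output buffers; `F` tells the sequence that belongs to buffer `r.c`. -/
def flushAll (F : Ram → File) : Prog :=
  Prog.loop (fun r => (List.range P.f).any fun c => !(r.out c).isEmpty)
    (Prog.assign (fun r =>
      { r with c := ((List.range P.f).find? fun c => !(r.out c).isEmpty).getD 0 }) ;;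
      flush (fun r => r.c) F)

/-! ### Splitting of the phrases -/

/-- The sequences that are written while the input is split: far repeat phrases, literals, near
repeat phrases with the source in the preceding segment or in the same segment. -/
def splitFile (r : Ram) : File :=
  if r.c = 0 then File.R P.L 0
  else if r.c = 1 then File.lits
  else if r.c = 2 then File.prev
  else File.same

/-- The symbols in `w` are literals that start at position `q`; they are cut at the segment
boundaries, and each part is stored with its position. -/
def splitLits : Prog :=
  next Slot.scan (fun _ => File.input) (fun x r => { r with w := x.syms, c := 1 }) ;;
  Prog.loop (fun r => !r.w.isEmpty)
    (Prog.assign (fun r => { r with t := min r.w.length (P.b - r.q % P.b) }) ;;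
      P.put P.splitFile (fun r => Cell.int r.q) ;;
      P.put P.splitFile (fun r => Cell.str (r.w.take r.t)) ;;
      Prog.assign (fun r => { r with q := r.q + r.t, w := r.w.drop r.t }))

/-- A repeat phrase at position `q` is cut such that every part and its source lie inside one
segment each; a part is far if its source is more than `b` positions before it. -/
def splitRep : Prog :=
  next Slot.scan (fun _ => File.input) (fun x r => { r with p := x.val }) ;;
  next Slot.scan (fun _ => File.input) (fun x r => { r with l := x.val }) ;;
  Prog.loop (fun r => decide (0 < r.l))
    (Prog.assign (fun r =>
      { r with
        t := min r.l (min (P.b - r.q % P.b) (P.b - r.p % P.b))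
        c := if r.p + P.b < r.q then 0 else if r.p / P.b = r.q / P.b then 3 else 2 }) ;;
      P.putTriple P.splitFile (fun r => r.t) ;;
      Prog.assign (fun r => { r with p := r.p + r.t, q := r.q + r.t, l := r.l - r.t }))

def split : Prog :=
  rewind Slot.scan ;;
  whileMore Slot.scan (fun _ => File.input)
    (Prog.cond (fun r => ((r.inp Slot.scan).headD (Cell.int 0)).isStr) P.splitLits P.splitRep) ;;
  P.flushAll P.splitFile

/-! ### Multi-round distribution -/

/-- Distribute the far phrases of supersegment `i` of level `lev` by their sources to its parts
of level `lev - 1`. -/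
def distributeR : Prog :=
  rewind Slot.scan ;;
  whileMore Slot.scan (fun r => File.R r.lev r.i)
    (nextTriple Slot.scan (fun r => File.R r.lev r.i) ;;
      Prog.assign (fun r => { r with c := r.p / P.b / P.f ^ (r.lev - 1) % P.f }) ;;
      P.putTriple (fun r => File.R (r.lev - 1) (r.i * P.f + r.c)) (fun r => r.l)) ;;
  P.flushAll (fun r => File.R (r.lev - 1) (r.i * P.f + r.c))

/-- Distribute all far phrases into the sequences `R 0 0, R 0 1, …` of the segments. -/
def distributeAllR : Prog :=
  Prog.assign (fun r => { r with lev := P.L }) ;;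
  Prog.loop (fun r => decide (0 < r.lev))
    (Prog.assign (fun r => { r with i := 0 }) ;;
      Prog.loop (fun r => decide (r.i * P.f ^ r.lev < P.segs))
        (P.distributeR ;; Prog.assign (fun r => { r with i := r.i + 1 })) ;;
      Prog.assign (fun r => { r with lev := r.lev - 1 }))

/-- Distribute the recovered phrases `(q, l, s)` in the queue of supersegment `i` of level `lev`
by their positions to the queues of its parts of level `lev - 1`; the string `s` is a sequence of
packed words. -/
def distributeQ : Prog :=
  rewind Slot.scan ;;
  whileMore Slot.scan (fun r => File.Q r.lev r.i)
    (next Slot.scan (fun r => File.Q r.lev r.i) (fun x r => { r with q := x.val }) ;;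
      next Slot.scan (fun r => File.Q r.lev r.i) (fun x r => { r with l := x.val }) ;;
      Prog.assign (fun r => { r with c := r.q / P.b / P.f ^ (r.lev - 1) % P.f }) ;;
      P.put (fun r => File.Q (r.lev - 1) (r.i * P.f + r.c)) (fun r => Cell.int r.q) ;;
      P.put (fun r => File.Q (r.lev - 1) (r.i * P.f + r.c)) (fun r => Cell.int r.l) ;;
      Prog.loop (fun r => decide (0 < r.l))
        (next Slot.scan (fun r => File.Q r.lev r.i) (fun x r => { r with w := x.syms }) ;;
          P.put (fun r => File.Q (r.lev - 1) (r.i * P.f + r.c)) (fun r => Cell.str r.w) ;;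
          Prog.assign (fun r => { r with l := r.l - P.d }))) ;;
  P.flushAll (fun r => File.Q (r.lev - 1) (r.i * P.f + r.c))

/-- Before segment `j`: distribute the queue of every supersegment that starts with segment `j`,
from the highest level to the lowest. -/
def openQueues : Prog :=
  Prog.assign (fun r => { r with lev := P.L }) ;;
  Prog.loop (fun r => decide (0 < r.lev))
    (Prog.cond (fun r => decide (r.j % P.f ^ r.lev = 0))
        (Prog.assign (fun r => { r with i := r.j / P.f ^ r.lev }) ;; P.distributeQ)
        Prog.skip ;;
      Prog.assign (fun r => { r with lev := r.lev - 1 }))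

/-! ### Recovery of a segment -/

/-- Overwrite the array from index `q` on by the string `s`. -/
def _root_.EMLZ.overwrite (Y : List ℕ) (q : ℕ) (s : List ℕ) : List ℕ :=
  Y.take q ++ s ++ Y.drop (q + s.length)

/-- Copy `l` symbols inside the array from index `p` to index `q`, one by one from left to
right. -/
def _root_.EMLZ.copyWithin (Y : List ℕ) (p q l : ℕ) : List ℕ :=
  (List.range l).foldl (fun Y t => Y.set (q + t) (Y.getD (p + t) 0)) Y

def copyPhrase : Prog :=
  Prog.assign (fun r => { r with Y := copyWithin r.Y (r.p % P.b) (r.q % P.b) r.l })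

/-- Step 1: phrases of segment `j` with a near source in segment `j - 1`. -/
def recoverPrev : Prog :=
  whileBelow Slot.prev (fun _ => File.prev) (fun r => r.j * P.b)
    (nextTriple Slot.prev (fun _ => File.prev) ;; P.copyPhrase)

/-- Step 2: literals. -/
def recoverLits : Prog :=
  whileBelow Slot.lits (fun _ => File.lits) (fun r => (r.j + 1) * P.b)
    (next Slot.lits (fun _ => File.lits) (fun x r => { r with q := x.val }) ;;
      next Slot.lits (fun _ => File.lits)
        (fun x r => { r with Y := overwrite r.Y (r.q % P.b) x.syms }))

/-- Step 3: far phrases, from the queue of segment `j`. -/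
def recoverFar : Prog :=
  rewind Slot.scan ;;
  whileMore Slot.scan (fun r => File.Q 0 r.j)
    (next Slot.scan (fun r => File.Q 0 r.j) (fun x r => { r with q := x.val }) ;;
      next Slot.scan (fun r => File.Q 0 r.j) (fun x r => { r with l := x.val }) ;;
      Prog.loop (fun r => decide (0 < r.l))
        (next Slot.scan (fun r => File.Q 0 r.j) (fun x r =>
          { r with
            Y := overwrite r.Y (r.q % P.b) x.syms
            q := r.q + P.d
            l := r.l - P.d })))

/-- Step 4: phrases with the source in the same segment. -/
def recoverSame : Prog :=
  whileBelow Slot.same (fun _ => File.same) (fun r => (r.j + 1) * P.b)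
    (nextTriple Slot.same (fun _ => File.same) ;; P.copyPhrase)

/-- Write the recovered segment to the output. -/
def writeSegment : Prog :=
  Prog.assign (fun r => { r with t := 0 }) ;;
  Prog.loop (fun r => decide (r.t < P.m / P.B ∧ r.j * P.b + r.t * (P.B * P.d) < P.n))
    (Prog.assign (fun r =>
        { r with io := blockOf P.B (pack P.d (r.Y.take (P.n - r.j * P.b))) r.t }) ;;
      Prog.write (fun r => Addr.block File.output (r.j * (P.m / P.B) + r.t)) ;;
      Prog.assign (fun r => { r with io := [], t := r.t + 1 }))

/-- The lowest supersegment that contains segments `j` and `k` has level `lev`, for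
`lev ≥ 1`. -/
def meetAt (lev j k : ℕ) : Bool :=
  decide (j / P.f ^ lev = k / P.f ^ lev ∧ j / P.f ^ (lev - 1) ≠ k / P.f ^ (lev - 1))

/-- After the recovery of segment `j`: insert the phrases in its sequence `R 0 j` into the queues,
with their literal representation. A phrase whose segment meets segment `j` at level `lev` goes
to the queue of its supersegment of level `lev - 1`; there is one pass for each level. -/
def emit : Prog :=
  Prog.assign (fun r => { r with lev := 1 }) ;;
  Prog.loop (fun r => decide (r.lev ≤ P.L))
    (Prog.assign (fun r => { r with i := r.j / P.f ^ r.lev }) ;;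
      rewind Slot.scan ;;
      whileMore Slot.scan (fun r => File.R 0 r.j)
        (nextTriple Slot.scan (fun r => File.R 0 r.j) ;;
          Prog.cond (fun r => P.meetAt r.lev r.j (r.q / P.b))
            (Prog.assign (fun r =>
                { r with c := r.q / P.b / P.f ^ (r.lev - 1) % P.f, t := 0 }) ;;
              P.put (fun r => File.Q (r.lev - 1) (r.i * P.f + r.c)) (fun r => Cell.int r.q) ;;
              P.put (fun r => File.Q (r.lev - 1) (r.i * P.f + r.c)) (fun r => Cell.int r.l) ;;
              Prog.loop (fun r => decide (r.t < r.l))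
                (P.put (fun r => File.Q (r.lev - 1) (r.i * P.f + r.c))
                    (fun r => Cell.str ((r.Y.drop (r.p % P.b + r.t)).take (min P.d (r.l - r.t)))) ;;
                  Prog.assign (fun r => { r with t := r.t + P.d })))
            Prog.skip) ;;
      P.flushAll (fun r => File.Q (r.lev - 1) (r.i * P.f + r.c)) ;;
      Prog.assign (fun r => { r with lev := r.lev + 1 }))

/-- The decoding algorithm without sorting and without a priority queue. -/
def decoder : Prog :=
  Prog.assign (fun r => { r with Y := List.replicate P.b 0 }) ;;
  P.split ;;
  P.distributeAllR ;;
  Prog.assign (fun r => { r with j := 0 }) ;;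
  Prog.loop (fun r => decide (r.j < P.segs))
    (P.openQueues ;;
      P.recoverPrev ;;
      P.recoverLits ;;
      P.recoverFar ;;
      P.recoverSame ;;
      P.writeSegment ;;
      P.emit ;;
      Prog.assign (fun r => { r with j := r.j + 1 }))

end Params

end EMLZ

namespace EMLZ

open Function

/-! The array is correct. A part whose source lies in the preceding segment satisfies `q ≤ p + b`,
so inside the array it is copied to the left or in place. Taken from left to right, such parts only
read symbols of the preceding segment that are not yet overwritten (`wp_recoverPrev`). Literals and
far parts carry their own symbols, so the order of the far parts is immaterial (`wp_recoverLits`,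
`wp_recoverFar`). When a part with its source in the same segment is reached, everything to its left
in the segment is known, and a copy from left to right is then correct even if source and target
overlap (`wp_recoverSame`). The pieces of all kinds cover the string and never cross a segment
boundary, hence they fill the segment (`wp_recoverSegment`).

Far parts arrive in time. The supersegments form an `f`-ary tree over the segments. A part with
source in segment `j` and target in a later segment is handed over where the two paths from the root
separate: it goes to the queue of the child that contains the target, a child that has not begun
although its parent has. The invariant `Queues` says that, before segment `j`, such a queue holds
exactly the parts with targets in it and sources before `j`, and that queues below a parent that is
not yet opened are empty. Opening a supersegment distributes its queue to its children
(`wp_openQueues`), and emission adds the sources in segment `j` (`meeting_filter`,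
`meeting_filter_eq_nil`, `wp_emit`). When segment `j` is recovered, its own queue therefore holds
all its far parts (`Queues.at_zero`). Order is not preserved, so contents are compared by
`List.Perm`.

The cost is amortized. Reading a sequence is paid for by the number of its blocks still unread, and
an appended word pays `3 / B` of an I/O towards the flush of its buffer (`wp_put`). What remains are
partial blocks, final flushes and reads past the end. These amount to `O(f)` blocks for each segment
and level, and a segment has more than `f * B` words (`Ctx.segs_B_le`). Cutting at segment
boundaries yields `O(n / b + z)` parts of repeat phrases (`wp_splitRep`), where `z` counts the
repeat phrases, and the input has `O(n / d + z + 1)` words (`runs_items`). So `L + 1` times `O(n /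
(d * B) + z / B + 1)` I/Os suffice (`cost_arith`, `wp_decoder`). Finally `log_σ n ≤ 2 * d`
(`Ctx.logb_le`), and the required fan-out bounds `L` by a multiple of the logarithm to base `M / B`
(`Ctx.L_le_logb`).

The programs are verified in a logic of weakest preconditions with an I/O counter, `WP`. Its
assertions see the disk only as lists of nonempty blocks, and one invariant `RamOK` is kept by every
state. The word size enters only at the end, through `RamOK.fits` and `Exec.mono`. -/

/-- A bound for all integers that the decoder stores in a word. -/
def Params.N (P : Params) : ℕ := 8 * P.n + 8

/-! ### Invariants of words, buffers and RAM, and the block view of the disk. -/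

def CellOK (P : Params) : Cell → Prop
  | Cell.int v => v ≤ P.N
  | Cell.str s => s.length ≤ P.d ∧ ∀ x ∈ s, x < P.σ

structure BufOK (P : Params) (l : List Cell) : Prop where
  len : l.length ≤ P.B
  cells : ∀ x ∈ l, CellOK P x

/-- Free of bit lengths, so that the verification of the programs never counts bits; `RamOK.fits`
translates it into `RamFits` once. -/
structure RamOK (P : Params) (r : Ram) : Prop where
  io : BufOK P r.io
  inp : ∀ s, BufOK P (r.inp s)
  out : ∀ c, BufOK P (r.out c)
  out_nil : ∀ c, P.f ≤ c → r.out c = []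
  Y_len : r.Y.length ≤ P.b
  Y_lt : ∀ x ∈ r.Y, x < P.σ
  w_len : r.w.length ≤ P.d
  w_lt : ∀ x ∈ r.w, x < P.σ
  pos : ∀ s, r.pos s ≤ P.N
  p : r.p ≤ P.N
  q : r.q ≤ P.N
  l : r.l ≤ P.N
  t : r.t ≤ P.N
  j : r.j ≤ P.N
  lev : r.lev ≤ P.N
  i : r.i ≤ P.N
  c : r.c ≤ P.N
  cnt : r.cnt ≤ P.N

/-- The blocks of all sequences. -/
abbrev Store := File → List (List Cell)

/-- Blocks must be nonempty because reading an empty block is the only sign by which the decoder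
recognizes the end of a sequence. -/
def StoreOK (P : Params) (β : Store) : Prop := ∀ F, ∀ x ∈ β F, x ≠ [] ∧ BufOK P x

/-- The disk holds the sequences `β`; the block counts are kept for all sequences except input
and output. -/
structure Holds (D : Disk) (β : Store) : Prop where
  block : ∀ F k, D (Addr.block F k) = (β F).getD k []
  head : ∀ F, F ≠ File.input → F ≠ File.output →
    D (Addr.head F) = [] ∧ β F = [] ∨ D (Addr.head F) = [Cell.int (β F).length]

/-- Started with RAM `r`, sequences `β` and `e` I/Os performed so far, the program halts in a state
that satisfies `Q`. -/
def WP (P : Params) (S : Prog) (r : Ram) (β : Store) (e : ℕ) (Q : Ram → Store → ℕ → Prop) : Prop :=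
  RamOK P r → StoreOK P β → ∀ D, Holds D β → ∃ k r' D' β',
    Exec (RamOK P) S r D k r' D' ∧ RamOK P r' ∧ StoreOK P β' ∧ Holds D' β' ∧ Q r' β' (e + k)

/-! ### Proof rules of the program logic with I/O counter. -/

section rules

variable {P : Params} {S T : Prog} {r : Ram} {β : Store} {e : ℕ} {Q Q' : Ram → Store → ℕ → Prop}

theorem WP.intro (h : RamOK P r → StoreOK P β → WP P S r β e Q) : WP P S r β e Q :=
  fun hr hβ => h hr hβ hr hβ

theorem WP.mono (h : WP P S r β e Q)
    (hQ : ∀ r β e, RamOK P r → StoreOK P β → Q r β e → Q' r β e) : WP P S r β e Q' := by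
  intro hr hβ D hD
  obtain ⟨k, r', D', β', h1, h2, h3, h4, h5⟩ := h hr hβ D hD
  exact ⟨k, r', D', β', h1, h2, h3, h4, hQ _ _ _ h2 h3 h5⟩

theorem wp_skip (h : RamOK P r → StoreOK P β → Q r β e) : WP P Prog.skip r β e Q :=
  fun hr hβ D hD => ⟨0, r, D, β, Exec.skip r D, hr, hβ, hD, h hr hβ⟩

theorem wp_assign {g : Ram → Ram}
    (h : RamOK P r → StoreOK P β → RamOK P (g r) ∧ Q (g r) β e) :
    WP P (Prog.assign g) r β e Q :=
  fun hr hβ D hD => ⟨0, g r, D, β, Exec.assign g r D (h hr hβ).1, (h hr hβ).1, hβ, hD, (h hr hβ).2⟩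

theorem wp_seq (h : WP P S r β e (fun r β e => WP P T r β e Q)) : WP P (S ;; T) r β e Q := by
  intro hr hβ D hD
  obtain ⟨k, r', D', β', h1, h2, h3, h4, h5⟩ := h hr hβ D hD
  obtain ⟨k', r'', D'', β'', g1, g2, g3, g4, g5⟩ := h5 h2 h3 D' h4
  exact ⟨k + k', r'', D'', β'', Exec.seq h1 g1, g2, g3, g4, by rwa [← Nat.add_assoc]⟩

theorem wp_cond {b : Ram → Bool} (h1 : b r = true → WP P S r β e Q)
    (h2 : b r = false → WP P T r β e Q) : WP P (Prog.cond b S T) r β e Q := by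
  intro hr hβ D hD
  cases hb : b r with
  | true =>
    obtain ⟨k, r', D', β', h1, h⟩ := h1 hb hr hβ D hD
    exact ⟨k, r', D', β', Exec.cond_true hb h1, h⟩
  | false =>
    obtain ⟨k, r', D', β', h1, h⟩ := h2 hb hr hβ D hD
    exact ⟨k, r', D', β', Exec.cond_false hb h1, h⟩

/-- The ghost value `a` carries what the registers do not show, for instance the list of records
still to be processed. The measure of the ghost value falls in every iteration, so one strong
induction gives both the invariant and termination. -/
theorem wp_loop {α : Type*} {b : Ram → Bool} (I : α → Ram → Store → ℕ → Prop) (μ : α → ℕ) (a : α)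
    (hI : I a r β e)
    (step : ∀ a r β e, RamOK P r → StoreOK P β → I a r β e → b r = true →
      WP P S r β e (fun r' β' e' => ∃ a', μ a' < μ a ∧ I a' r' β' e'))
    (done : ∀ a r β e, RamOK P r → StoreOK P β → I a r β e → b r = false → Q r β e) :
    WP P (Prog.loop b S) r β e Q := by
  induction hn : μ a using Nat.strong_induction_on generalizing a r β e with
  | _ n ih =>
    intro hr hβ D hD
    cases hb : b r with
    | false => exact ⟨0, r, D, β, Exec.loop_false hb, hr, hβ, hD, done a r β e hr hβ hI hb⟩
    | true =>
      obtain ⟨k, r', D', β', h1, h2, h3, h4, a', ha, h5⟩ := step a r β e hr hβ hI hb hr hβ D hD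
      obtain ⟨k', r'', D'', β'', g1, g2, g3, g4, g5⟩ :=
        ih (μ a') (hn ▸ ha) a' h5 rfl h2 h3 D' h4
      exact ⟨k + k', r'', D'', β'', Exec.loop_true hb h1 g1, g2, g3, g4, by rwa [← Nat.add_assoc]⟩

/-- Past the end of a sequence the disk and `getD` both yield `[]`, so `k` needs no bound. -/
theorem wp_read {a : Ram → Addr} {F : File} {k : ℕ} (ha : a r = Addr.block F k)
    (h : RamOK P { r with io := (β F).getD k [] } → Q { r with io := (β F).getD k [] } β (e + 1)) :
    WP P (Prog.read a) r β e Q := by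
  intro hr hβ D hD
  have hk : D (a r) = (β F).getD k [] := by rw [ha, hD.block]
  have hbuf : BufOK P ((β F).getD k []) := by
    rcases lt_or_ge k (β F).length with hlt | hge
    · rw [List.getD_eq_getElem _ _ hlt]
      exact (hβ F _ (List.getElem_mem hlt)).2
    · rw [List.getD_eq_default _ _ hge]
      exact ⟨Nat.zero_le _, by simp⟩
  have hr' : RamOK P { r with io := (β F).getD k [] } := { hr with io := hbuf }
  have hE := Exec.read (ok := RamOK P) a r D (by rw [hk]; exact hr')
  rw [hk] at hE
  exact ⟨1, _, D, β, hE, hr', hβ, hD, h hr'⟩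

/-- Only the decoded count is exposed to the continuation. The default `Cell.int 0` makes a head
block that was never written count as zero, so a fresh sequence is no special case. -/
theorem wp_readHead {a : Ram → Addr} {F : File} (ha : a r = Addr.head F)
    (hi : F ≠ File.input) (ho : F ≠ File.output) (hB : 1 ≤ P.B) (hn : (β F).length ≤ P.N)
    (h : ∀ x, (x.headD (Cell.int 0)).val = (β F).length → RamOK P { r with io := x } →
      Q { r with io := x } β (e + 1)) :
    WP P (Prog.read a) r β e Q := by
  intro hr hβ D hD
  have hx : ((D (Addr.head F)).headD (Cell.int 0)).val = (β F).length ∧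
      BufOK P (D (Addr.head F)) := by
    rcases hD.head F hi ho with ⟨h1, h2⟩ | h1
    · rw [h1, h2]; exact ⟨rfl, Nat.zero_le _, by simp⟩
    · rw [h1]
      refine ⟨rfl, by simpa using hB, fun x hx => ?_⟩
      rw [List.mem_singleton] at hx
      subst hx
      exact hn
  have hr' : RamOK P { r with io := D (a r) } := { hr with io := by rw [ha]; exact hx.2 }
  exact ⟨1, _, D, β, Exec.read a r D hr', hr', hβ, hD, h _ (by rw [ha]; exact hx.1) hr'⟩

/-- Writing a block and then the block count. -/
theorem wp_append {a a' : Ram → Addr} {g : Ram → Ram} {F : File}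
    (ha : a r = Addr.block F (β F).length) (ha' : a' (g r) = Addr.head F)
    (hne : r.io ≠ []) (hg : (g r).io = [Cell.int ((β F).length + 1)])
    (hi : F ≠ File.input) (ho : F ≠ File.output)
    (h : RamOK P r → RamOK P (g r) ∧ WP P S (g r) (update β F (β F ++ [r.io])) (e + 2) Q) :
    WP P (Prog.write a ;; Prog.assign g ;; Prog.write a' ;; S) r β e Q := by
  intro hr hβ D hD
  -- Between the two writes the stored count is stale and `Holds` may fail. The pair is therefore
  -- treated as one step, and only the disk after both writes is related to the longer sequence.
  suffices hs : StoreOK P (update β F (β F ++ [r.io])) ∧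
      Holds (update (update D (a r) r.io) (a' (g r)) (g r).io) (update β F (β F ++ [r.io])) by
    obtain ⟨k, r', D', β', h1, h2, h3, h4, h5⟩ := (h hr).2 (h hr).1 hs.1 _ hs.2
    exact ⟨1 + (0 + (1 + k)), r', D', β', Exec.seq (Exec.write a r D)
      (Exec.seq (Exec.assign g r _ (h hr).1) (Exec.seq (Exec.write a' _ _) h1)), h2, h3, h4,
      by rwa [show e + (1 + (0 + (1 + k))) = e + 2 + k by omega]⟩
  refine ⟨?_, ?_, ?_⟩
  · intro F' x hx
    by_cases hF : F' = F
    · subst hF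
      rw [update_self, List.mem_append, List.mem_singleton] at hx
      rcases hx with hx | rfl
      · exact hβ _ _ hx
      · exact ⟨hne, hr.io⟩
    · rw [update_of_ne hF] at hx
      exact hβ _ _ hx
  · intro F' k
    rw [ha, ha', update_of_ne (by simp)]
    by_cases hF : F' = F
    · subst hF
      rw [update_self]
      by_cases hk : k = (β F').length
      · subst hk; simp
      · rw [update_of_ne (by simpa using hk), hD.block]
        rcases lt_or_gt_of_ne hk with hlt | hgt
        · rw [List.getD_append _ _ _ _ hlt]
        · rw [List.getD_eq_default _ _ hgt.le, List.getD_eq_default]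
          simpa using hgt
    · rw [update_of_ne hF, update_of_ne (by simp [hF]), hD.block]
  · intro F' h1 h2
    rw [ha, ha']
    by_cases hF : F' = F
    · subst hF
      right
      simp [hg]
    · rw [update_of_ne hF, update_of_ne (by simp [hF]), update_of_ne (by simp)]
      exact hD.head F' h1 h2

/-- A single write is sound here, since `Holds` asks for no block count of the output. -/
theorem wp_writeOutput {a : Ram → Addr} (ha : a r = Addr.block File.output (β File.output).length)
    (hne : r.io ≠ [])
    (h : RamOK P r → Q r (update β File.output (β File.output ++ [r.io])) (e + 1)) :
    WP P (Prog.write a) r β e Q := by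
  intro hr hβ D hD
  refine ⟨1, r, _, update β File.output (β File.output ++ [r.io]), Exec.write a r D, hr,
    ?_, ⟨?_, ?_⟩, h hr⟩
  · intro F' x hx
    by_cases hF : F' = File.output
    · subst hF
      rw [update_self, List.mem_append, List.mem_singleton] at hx
      rcases hx with hx | rfl
      · exact hβ _ _ hx
      · exact ⟨hne, hr.io⟩
    · rw [update_of_ne hF] at hx
      exact hβ _ _ hx
  · intro F' k
    rw [ha]
    by_cases hF : F' = File.output
    · subst hF
      rw [update_self]
      by_cases hk : k = (β File.output).length
      · subst hk; simp
      · rw [update_of_ne (by simpa using hk), hD.block]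
        rcases lt_or_gt_of_ne hk with hlt | hgt
        · rw [List.getD_append _ _ _ _ hlt]
        · rw [List.getD_eq_default _ _ hgt.le, List.getD_eq_default]
          simpa using hgt
    · rw [update_of_ne hF, update_of_ne (by simp [hF]), hD.block]
  · intro F' h1 h2
    rw [ha, update_of_ne h2, update_of_ne (by simp)]
    exact hD.head F' h1 h2

end rules

/-! Sequential reading. -/

/-- The words `ws` of a sequence with blocks `bl` are still to be read through slot `s`; at most `a`
reads went past the end. -/
def Rd (bl : List (List Cell)) (s : Slot) (a : ℕ) (r : Ram) (ws : List Cell) : Prop :=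
  r.inp s ++ (bl.drop (r.pos s)).flatten = ws ∧ r.pos s ≤ bl.length + a

/-- Number of blocks still to be read. -/
def rem (bl : List (List Cell)) (s : Slot) (r : Ram) : ℕ := bl.length - r.pos s

/-- File names that depend only on the loop registers. -/
def Stable (F : Ram → File) : Prop :=
  ∀ r r' : Ram, r.lev = r'.lev → r.i = r'.i → r.j = r'.j → r.c = r'.c → F r = F r'

theorem Rd.congr {bl s a r r' ws} (h : Rd bl s a r ws) (h1 : r'.inp s = r.inp s)
    (h2 : r'.pos s = r.pos s) : Rd bl s a r' ws := by
  unfold Rd at *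
  rw [h1, h2]; exact h

theorem rem_congr {bl s} {r r' : Ram} (h2 : r'.pos s = r.pos s) : rem bl s r' = rem bl s r := by
  unfold rem; rw [h2]

theorem rd_start {bl : List (List Cell)} {s : Slot} {r : Ram} (h1 : r.inp s = [])
    (h2 : r.pos s = 0) : Rd bl s 0 r bl.flatten := by
  unfold Rd; rw [h1, h2]; simp

/-- Bounds block numbers by word counts; this is how they are kept below `Params.N`. -/
theorem length_le_flatten {bl : List (List Cell)} (h : ∀ x ∈ bl, x ≠ []) :
    bl.length ≤ bl.flatten.length := by
  induction bl with
  | nil => simp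
  | cons x xs ih =>
    have h1 := ih fun y hy => h y (List.mem_cons_of_mem _ hy)
    have h2 := List.length_pos_iff.2 (h x List.mem_cons_self)
    simp only [List.length_cons, List.flatten_cons, List.length_append]
    omega

section rules

variable {P : Params} {r : Ram} {β : Store} {e : ℕ} {Q : Ram → Store → ℕ → Prop}
  {s : Slot} {F : Ram → File} {bl : List (List Cell)} {ws : List Cell} {a : ℕ}

/-- A read adds one to the counter and takes one from `rem`, so `e + rem` is conserved: sequential
reading is prepaid by the number of blocks. -/
theorem wp_fill_cons (hF : β (F r) = bl) (hR : Rd bl s a r ws) (hws : ws ≠ [])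
    (hN : bl.length ≤ P.N)
    (hQ : ∀ x k io e' r', r' = { r with inp := update r.inp s x, pos := update r.pos s k, io := io } →
      RamOK P r' → Rd bl s a r' ws → x ≠ [] → e' + rem bl s r' = e + rem bl s r → Q r' β e') :
    WP P (fill s F) r β e Q := by
  refine wp_cond (fun hb => ?_) (fun hb => ?_)
  · have hb : r.inp s = [] := by simpa using hb
    have hpos : r.pos s < bl.length := by
      by_contra hge
      have := hR.1
      rw [hb, List.drop_of_length_le (by omega)] at this
      exact hws (by simpa using this.symm)
    refine wp_seq (wp_read rfl fun hr1 => wp_assign fun _ hβ => ?_)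
    have hx : (β (F r)).getD (r.pos s) [] = bl[r.pos s] := by
      rw [hF, List.getD_eq_getElem _ _ hpos]
    have hr' : RamOK P { r with
        inp := update r.inp s bl[r.pos s], pos := update r.pos s (r.pos s + 1), io := [] } := by
      refine { hr1 with io := ⟨by simp, by simp⟩, inp := fun s' => ?_, pos := fun s' => ?_ }
      · by_cases hs : s' = s
        · subst hs
          simp only [update_self]
          rw [← hx]; exact hr1.io
        · simp only [update_of_ne hs]; exact hr1.inp s'
      · by_cases hs : s' = s
        · subst hs
          simp only [update_self]; omega
        · simp only [update_of_ne hs]; exact hr1.pos s'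
    rw [hx]
    refine ⟨hr', hQ _ _ _ _ _ rfl hr' ⟨?_, ?_⟩ ?_ ?_⟩
    · simp only [update_self]
      have := hR.1
      rw [hb, List.nil_append, List.drop_eq_getElem_cons hpos, List.flatten_cons] at this
      exact this
    · simp only [update_self]; omega
    · refine (hβ (F r) _ ?_).1
      rw [hF]; exact List.getElem_mem hpos
    · simp only [rem, update_self]; omega
  · have hb : r.inp s ≠ [] := by simpa using hb
    refine wp_skip fun hr _ => ?_
    have h : r = { r with
        inp := update r.inp s (r.inp s), pos := update r.pos s (r.pos s), io := r.io } := by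
      simp
    exact hQ _ _ _ _ r h hr hR hb rfl

/-- The one kind of read that `rem` does not pay for: it fetches an empty block past the end. The
truncated difference `rem` is already zero, so one I/O is lost, and `pos` overshoots by one more,
which `a + 1` records. -/
theorem wp_fill_nil (hF : β (F r) = bl) (hR : Rd bl s a r []) (hN : bl.length + a + 1 ≤ P.N)
    (hQ : ∀ k io e' r', r' = { r with inp := update r.inp s [], pos := update r.pos s k, io := io } →
      RamOK P r' → Rd bl s (a + 1) r' [] → e' + rem bl s r' ≤ e + rem bl s r + 1 → Q r' β e') :
    WP P (fill s F) r β e Q := by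
  have hb : r.inp s = [] := (List.append_eq_nil_iff.1 hR.1).1
  refine wp_cond (fun _ => ?_) (fun h => by simp [hb] at h)
  refine wp_seq (wp_read rfl fun hr1 => wp_assign fun _ hβ => ?_)
  have hge : bl.length ≤ r.pos s := by
    by_contra! h
    have h' := (List.append_eq_nil_iff.1 hR.1).2
    rw [List.drop_eq_getElem_cons h, List.flatten_cons] at h'
    refine (hβ (F r) bl[r.pos s] ?_).1 (List.append_eq_nil_iff.1 h').1
    rw [hF]; exact List.getElem_mem h
  have hx : (β (F r)).getD (r.pos s) [] = [] := by
    rw [hF, List.getD_eq_default _ _ hge]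
  have h2 := hR.2
  have hr' : RamOK P { r with
      inp := update r.inp s [], pos := update r.pos s (r.pos s + 1), io := [] } := by
    refine { hr1 with io := ⟨by simp, by simp⟩, inp := fun s' => ?_, pos := fun s' => ?_ }
    · by_cases hs : s' = s
      · subst hs
        simp only [update_self]
        exact ⟨by simp, by simp⟩
      · simp only [update_of_ne hs]; exact hr1.inp s'
    · by_cases hs : s' = s
      · subst hs
        simp only [update_self]; omega
      · simp only [update_of_ne hs]; exact hr1.pos s'
  rw [hx]
  refine ⟨hr', hQ _ _ _ _ rfl hr' ⟨?_, ?_⟩ ?_⟩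
  · simp only [update_self]
    rw [List.drop_of_length_le (by omega)]; rfl
  · simp only [update_self]; omega
  · simp only [rem, update_self]; omega

theorem wp_next {x : Cell} {g : Cell → Ram → Ram} (hF : β (F r) = bl) (hR : Rd bl s a r (x :: ws))
    (hN : bl.length ≤ P.N)
    (hQ : ∀ y k io e' r', r' = { r with inp := update r.inp s y, pos := update r.pos s k, io := io } →
      RamOK P r' → CellOK P x → Rd bl s a r' ws → e' + rem bl s r' = e + rem bl s r →
      RamOK P (g x r') ∧ Q (g x r') β e') :
    WP P (next s F g) r β e Q := by
  refine wp_seq (wp_fill_cons hF hR (by simp) hN ?_)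
  rintro y k io e' r' hr' hok hR' hy he
  obtain ⟨z, y, rfl⟩ := List.exists_cons_of_ne_nil hy
  have hin : r'.inp s = z :: y := by rw [hr']; simp
  have hpo : r'.pos s = k := by rw [hr']; simp
  have hz : z = x ∧ y ++ (bl.drop k).flatten = ws := by
    have := hR'.1
    rw [hin, hpo] at this
    simpa using this
  obtain ⟨rfl, hws⟩ := hz
  have hbuf := hok.inp s
  rw [hin] at hbuf
  have h2 := hR'.2
  rw [hpo] at h2
  have hr2 : ({ r' with inp := update r'.inp s y } : Ram) =
      { r with inp := update r.inp s y, pos := update r.pos s k, io := io } := by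
    rw [hr']; simp
  have hok2 : RamOK P { r' with inp := update r'.inp s y } := by
    refine { hok with inp := fun s' => ?_ }
    by_cases hs : s' = s
    · subst hs
      simp only [update_self]
      exact ⟨(Nat.le_succ _).trans hbuf.len, fun w hw => hbuf.cells w (List.mem_cons_of_mem _ hw)⟩
    · simp only [update_of_ne hs]; exact hok.inp s'
  refine wp_assign fun _ _ => ?_
  simp only [hin]
  refine hQ y k io e' _ hr2 hok2 (hbuf.cells _ List.mem_cons_self) ⟨?_, ?_⟩ ?_
  · simpa [hpo] using hws
  · simpa [hpo] using h2
  · rw [← he]; rfl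

theorem wp_nextTriple {p q l : ℕ} (hS : Stable F) (hF : β (F r) = bl)
    (hR : Rd bl s a r (Cell.int p :: Cell.int q :: Cell.int l :: ws)) (hN : bl.length ≤ P.N)
    (hQ : ∀ y k io e' r', r' = { r with
        inp := update r.inp s y, pos := update r.pos s k, io := io, p := p, q := q, l := l } →
      Rd bl s a r' ws → e' + rem bl s r' = e + rem bl s r → RamOK P r' → Q r' β e') :
    WP P (nextTriple s F) r β e Q := by
  refine wp_seq (wp_next hF hR hN ?_)
  rintro y1 k1 io1 e1 r1 hr1 ok1 hc1 R1 he1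
  refine ⟨{ ok1 with p := hc1 }, ?_⟩
  have f1 : F { r1 with p := p } = F r := by apply hS <;> rw [hr1]
  refine wp_seq (wp_next (bl := bl) (a := a) (ws := Cell.int l :: ws) (x := Cell.int q)
    (by rw [← hF]; exact congrArg β f1) (R1.congr rfl rfl) hN ?_)
  rintro y2 k2 io2 e2 r2 hr2 ok2 hc2 R2 he2
  refine ⟨{ ok2 with q := hc2 }, ?_⟩
  have f2 : F { r2 with q := q } = F r := by apply hS <;> rw [hr2, hr1]
  refine wp_next (bl := bl) (a := a) (ws := ws) (x := Cell.int l)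
    (by rw [← hF]; exact congrArg β f2) (R2.congr rfl rfl) hN ?_
  rintro y3 k3 io3 e3 r3 hr3 ok3 hc3 R3 he3
  have ok4 : RamOK P { r3 with l := l } := { ok3 with l := hc3 }
  refine ⟨ok4, hQ y3 k3 io3 e3 _ ?_ (R3.congr rfl rfl) ?_ ok4⟩
  · rw [hr3, hr2, hr1]; simp [Cell.val]
  · have g1 : rem bl s { r1 with p := p } = rem bl s r1 := rfl
    have g2 : rem bl s { r2 with q := q } = rem bl s r2 := rfl
    have g3 : rem bl s { r3 with l := l } = rem bl s r3 := rfl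
    simp only [Cell.val] at he2 he3 ⊢
    omega

/-- Turns a loop over words into a loop over records. `J` depends on the records already processed
and on the prepaid cost `v = e + rem`; it must ignore the slot's buffer, its block number and `io`,
because `fill` changes them. The last `fill` runs into the end, hence `e ≤ v + 1`. -/
theorem wp_whileMore {α : Type*} {S : Prog} (enc : α → List Cell) (T : List α)
    (J : List α → Ram → Store → ℕ → Prop) (henc : ∀ x ∈ T, enc x ≠ [])
    (hJF : ∀ pre r β v, J pre r β v → β (F r) = bl)
    (hJ : ∀ pre r β v y k io, J pre r β v →
      J pre { r with inp := update r.inp s y, pos := update r.pos s k, io := io } β v)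
    (hR : Rd bl s a r (T.flatMap enc)) (h0 : J [] r β (e + rem bl s r))
    (hN : bl.length + a + 1 ≤ P.N)
    (body : ∀ pre x post r β e, T = pre ++ x :: post → J pre r β (e + rem bl s r) →
      Rd bl s a r (enc x ++ post.flatMap enc) → r.inp s ≠ [] → RamOK P r → StoreOK P β →
      WP P S r β e (fun r' β' e' =>
        Rd bl s a r' (post.flatMap enc) ∧ J (pre ++ [x]) r' β' (e' + rem bl s r')))
    (hQ : ∀ r β v e, RamOK P r → StoreOK P β → J T r β v → e ≤ v + 1 → Rd bl s (a + 1) r [] →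
      Q r β e) :
    WP P (whileMore s F S) r β e Q := by
  -- The two cases mirror the loop test: after a `fill` the buffer is empty exactly if no record is
  -- left.
  let I : List α → Ram → Store → ℕ → Prop := fun post r β e => ∃ pre v, T = pre ++ post ∧
    J pre r β v ∧ ((post = [] ∧ r.inp s = [] ∧ Rd bl s (a + 1) r [] ∧ e ≤ v + 1) ∨
      (post ≠ [] ∧ r.inp s ≠ [] ∧ Rd bl s a r (post.flatMap enc) ∧ v = e + rem bl s r))
  have fillI : ∀ pre post r β e, T = pre ++ post → J pre r β (e + rem bl s r) →
      Rd bl s a r (post.flatMap enc) → WP P (fill s F) r β e (I post) := by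
    intro pre post r β e hT hj hr
    rcases post with _ | ⟨x, post⟩
    · refine wp_fill_nil (hJF _ _ _ _ hj) hr hN ?_
      rintro k io e' r' rfl _ hr' he
      exact ⟨pre, _, hT, hJ _ _ _ _ _ _ _ hj, Or.inl ⟨rfl, by simp, hr', by omega⟩⟩
    · have hne : (x :: post).flatMap enc ≠ [] := by
        rw [List.flatMap_cons]
        intro h
        exact henc x (by simp [hT]) (List.append_eq_nil_iff.1 h).1
      refine wp_fill_cons (hJF _ _ _ _ hj) hr hne (by omega) ?_
      rintro y k io e' r' rfl _ hr' hy he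
      exact ⟨pre, _, hT, hJ _ _ _ _ _ _ _ hj, Or.inr ⟨by simp, by simpa using hy, hr', he.symm⟩⟩
  refine wp_seq ((fillI [] T r β e rfl h0 hR).mono fun r β e _ _ hI => ?_)
  refine wp_loop I List.length T hI ?_ ?_
  · rintro post r β e hr hβ ⟨pre, v, hT, hj, h | ⟨hne, hin, hr', hv⟩⟩ hb
    · simp [h.2.1] at hb
    · obtain ⟨x, post, rfl⟩ := List.exists_cons_of_ne_nil hne
      subst hv
      refine wp_seq ((body pre x post r β e hT hj hr' hin hr hβ).mono ?_)
      rintro r' β' e' _ _ ⟨hR', hJ'⟩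
      refine (fillI (pre ++ [x]) post r' β' e' (by simp [hT]) hJ' hR').mono ?_
      intro r β e _ _ h
      exact ⟨post, by simp, h⟩
  · rintro post r β e hr hβ ⟨pre, v, hT, hj, ⟨h1, h2, h3, h4⟩ | ⟨hne, hin, hr', hv⟩⟩ hb
    · subst h1
      rw [List.append_nil] at hT
      subst hT
      exact hQ r β v e hr hβ hj h4 h3
    · simp [hin] at hb

/-- The first word of a record serves as its key, and the records of `T₁` are those below the bound.
If `T₂` is nonempty, the loop stops at a buffered key without reading past the end; if it is empty,
one read is lost. The conclusion allows for both. -/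
theorem wp_whileBelow {α : Type*} {S : Prog} (hd : α → ℕ) (tl : α → List Cell) (T₁ T₂ : List α)
    (bound : Ram → ℕ) (bnd : ℕ) (J : List α → Ram → Store → ℕ → Prop)
    (h₁ : ∀ x ∈ T₁, hd x < bnd) (h₂ : ∀ x ∈ T₂, bnd ≤ hd x)
    (hJF : ∀ pre r β v, J pre r β v → β (F r) = bl ∧ bound r = bnd)
    (hJ : ∀ pre r β v y k io, J pre r β v →
      J pre { r with inp := update r.inp s y, pos := update r.pos s k, io := io } β v)
    (hR : Rd bl s a r ((T₁ ++ T₂).flatMap fun x => Cell.int (hd x) :: tl x))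
    (h0 : J [] r β (e + rem bl s r)) (hN : bl.length + a + 1 ≤ P.N)
    (body : ∀ pre x post ws r β e, T₁ = pre ++ x :: post → J pre r β (e + rem bl s r) →
      Rd bl s a r (Cell.int (hd x) :: tl x ++ ws) → RamOK P r → StoreOK P β →
      WP P S r β e (fun r' β' e' =>
        Rd bl s a r' ws ∧ J (pre ++ [x]) r' β' (e' + rem bl s r')))
    (hQ : ∀ r β v e, RamOK P r → StoreOK P β → J T₁ r β v → e + rem bl s r ≤ v + 1 →
      Rd bl s (a + 1) r (T₂.flatMap fun x => Cell.int (hd x) :: tl x) → Q r β e) :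
    WP P (whileBelow s F bound S) r β e Q := by
  set enc : α → List Cell := fun x => Cell.int (hd x) :: tl x with henc
  let I : List α → Ram → Store → ℕ → Prop := fun post r β e => ∃ pre v, T₁ = pre ++ post ∧
    J pre r β v ∧ ((post ++ T₂ = [] ∧ r.inp s = [] ∧ Rd bl s (a + 1) r [] ∧
        e + rem bl s r ≤ v + 1) ∨
      (post ++ T₂ ≠ [] ∧ r.inp s ≠ [] ∧ Rd bl s a r ((post ++ T₂).flatMap enc) ∧
        v = e + rem bl s r))
  have fillI : ∀ pre post r β e, T₁ = pre ++ post → J pre r β (e + rem bl s r) →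
      Rd bl s a r ((post ++ T₂).flatMap enc) → WP P (fill s F) r β e (I post) := by
    intro pre post r β e hT hj hr
    by_cases hnil : post ++ T₂ = []
    · rw [hnil] at hr
      refine wp_fill_nil (hJF _ _ _ _ hj).1 hr hN ?_
      rintro k io e' r' rfl _ hr' he
      exact ⟨pre, _, hT, hJ _ _ _ _ _ _ _ hj, Or.inl ⟨hnil, by simp, hr', he⟩⟩
    · have hne : (post ++ T₂).flatMap enc ≠ [] := by
        obtain ⟨x, l, hl⟩ := List.exists_cons_of_ne_nil hnil
        rw [hl]
        simp [henc]
      refine wp_fill_cons (hJF _ _ _ _ hj).1 hr hne (by omega) ?_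
      rintro y k io e' r' rfl _ hr' hy he
      exact ⟨pre, _, hT, hJ _ _ _ _ _ _ _ hj, Or.inr ⟨hnil, by simpa using hy, hr', he.symm⟩⟩
  have hhead : ∀ (r : Ram) x l, r.inp s ≠ [] → Rd bl s a r ((x :: l).flatMap enc) →
      ∃ u, r.inp s = Cell.int (hd x) :: u := by
    intro r x l hne hr
    obtain ⟨z, u, hu⟩ := List.exists_cons_of_ne_nil hne
    have := hr.1
    rw [hu] at this
    simp only [henc, List.flatMap_cons, List.cons_append, List.cons.injEq] at this
    exact ⟨u, by rw [hu, this.1]⟩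
  refine wp_seq ((fillI [] T₁ r β e rfl h0 hR).mono fun r β e _ _ hI => ?_)
  refine wp_loop I List.length T₁ hI ?_ ?_
  · rintro post r β e hr hβ ⟨pre, v, hT, hj, h | ⟨hne, hin, hr', hv⟩⟩ hb
    · simp [h.2.1] at hb
    · rcases post with _ | ⟨x, post⟩
      · exfalso
        rcases T₂ with _ | ⟨x, l⟩
        · simp at hne
        · obtain ⟨u, hu⟩ := hhead r x l hin hr'
          simp only [hu, (hJF _ _ _ _ hj).2, decide_eq_true_eq] at hb
          have := h₂ x List.mem_cons_self
          omega
      · subst hv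
        refine wp_seq ((body pre x post ((post ++ T₂).flatMap enc) r β e hT hj
          (by simpa [henc] using hr') hr hβ).mono ?_)
        rintro r' β' e' _ _ ⟨hR', hJ'⟩
        refine (fillI (pre ++ [x]) post r' β' e' (by simp [hT]) hJ' hR').mono ?_
        intro r β e _ _ h
        exact ⟨post, by simp, h⟩
  · rintro post r β e hr hβ ⟨pre, v, hT, hj, h⟩ hb
    have hpost : post = [] := by
      rcases h with h | ⟨hne, hin, hr', hv⟩
      · exact (List.append_eq_nil_iff.1 h.1).1
      · rcases post with _ | ⟨x, post⟩
        · rfl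
        · obtain ⟨u, hu⟩ := hhead r x (post ++ T₂) hin hr'
          simp only [hu, (hJF _ _ _ _ hj).2, decide_eq_false_iff_not] at hb
          exact absurd (h₁ x (by simp [hT])) hb
    subst hpost
    rw [List.append_nil] at hT
    subst hT
    rcases h with ⟨h1, h2, h3, h4⟩ | ⟨hne, hin, hr', hv⟩
    · rw [List.nil_append] at h1
      subst h1
      exact hQ r β v e hr hβ hj h4 h3
    · exact hQ r β v e hr hβ hj (by omega) ⟨hr'.1, hr'.2.trans (by omega)⟩

end rules

/-! Writing through output buffers. -/

/-- Total length of the first `nc` output buffers. -/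
def tot (nc : ℕ) (r : Ram) : ℕ := ∑ c ∈ Finset.range nc, (r.out c).length

/-- Append the words `ws` to the `c`-th list. -/
def addW (W : ℕ → List Cell) (c : ℕ) (ws : List Cell) : ℕ → List Cell := update W c (W c ++ ws)

theorem addW_addW (W : ℕ → List Cell) (c : ℕ) (a b : List Cell) :
    addW (addW W c a) c b = addW W c (a ++ b) := by
  simp [addW]

/-- Since the sequences were `β₀`, the words `W c` have been appended to `G c` for `c < nc`; some of
them are still in output buffer `c`. -/
structure Wr (P : Params) (nc : ℕ) (G : ℕ → File) (β₀ : Store) (W : ℕ → List Cell) (r : Ram)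
    (β : Store) : Prop where
  cont : ∀ c < nc, (β (G c)).flatten ++ r.out c = (β₀ (G c)).flatten ++ W c
  lt : ∀ c, (r.out c).length < P.B
  nil : ∀ c, nc ≤ c → r.out c = []
  frame : ∀ F, (∀ c < nc, F ≠ G c) → β F = β₀ F
  blocks : ∀ c < nc, P.B * (β (G c)).length + (r.out c).length ≤
    P.B * (β₀ (G c)).length + (W c).length

theorem Wr.congr {P nc G β₀ W r r' β} (h : Wr P nc G β₀ W r β) (hr : r'.out = r.out) :
    Wr P nc G β₀ W r' β := by
  obtain ⟨h1, h2, h3, h4, h5⟩ := h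
  constructor <;> (try rw [hr]) <;> assumption

theorem tot_congr {nc : ℕ} {r r' : Ram} (hr : r'.out = r.out) : tot nc r' = tot nc r := by
  unfold tot; rw [hr]

theorem wr_start {P : Params} {nc : ℕ} {G : ℕ → File} {r : Ram} {β : Store} (hB : 1 ≤ P.B)
    (h : r.out = fun _ => []) : Wr P nc G β (fun _ => []) r β := by
  constructor <;> simp [h]
  omega

theorem tot_start {nc : ℕ} {r : Ram} (h : r.out = fun _ => []) : tot nc r = 0 := by
  simp [tot, h]

section rules

variable {P : Params} {r : Ram} {β β₀ : Store} {e : ℕ} {Q : Ram → Store → ℕ → Prop}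
  {F : Ram → File} {nc : ℕ} {G : ℕ → File} {W : ℕ → List Cell}

/-- Three I/Os: the count is read, then block and count are written. `Stable` ensures that all three
address the same sequence although `out`, `cnt` and `io` change in between. -/
theorem wp_flush (hS : Stable F) (hi : F r ≠ File.input) (ho : F r ≠ File.output)
    (hB : 1 ≤ P.B) (hne : r.out r.c ≠ []) (hN : (β (F r)).length + 1 ≤ P.N)
    (hQ : ∀ r', r' = { r with
        out := update r.out r.c [], cnt := (β (F r)).length, io := [] } → RamOK P r' →
      Q r' (update β (F r) (β (F r) ++ [r.out r.c])) (e + 3)) :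
    WP P (flush (fun r => r.c) F) r β e Q := by
  refine wp_seq (wp_readHead rfl hi ho hB (by omega) fun x hx hr1 => ?_)
  have hout : ∀ c, BufOK P (update r.out r.c [] c) := by
    intro c
    by_cases hc : c = r.c
    · subst hc; simp only [update_self]; exact ⟨by simp, by simp⟩
    · simp only [update_of_ne hc]; exact hr1.out c
  have hnil : ∀ c, P.f ≤ c → update r.out r.c [] c = [] := by
    intro c hc
    by_cases hc' : c = r.c
    · subst hc'; simp
    · simp only [update_of_ne hc']; exact hr1.out_nil c hc
  refine wp_seq (wp_assign fun _ _ => ?_)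
  dsimp only
  rw [hx]
  refine ⟨{ hr1 with io := hr1.out r.c, out := hout, out_nil := hnil, cnt := Nat.le_of_succ_le hN }, ?_⟩
  refine wp_append (F := F r) ?_ ?_ hne rfl hi ho fun hr2 => ?_
  · exact congrArg (Addr.block · _) (hS _ _ rfl rfl rfl rfl)
  · exact congrArg Addr.head (hS _ _ rfl rfl rfl rfl)
  · refine ⟨{ hr2 with io := ⟨by simpa using hB, ?_⟩ }, ?_⟩
    · intro y hy
      rw [List.mem_singleton] at hy
      subst hy
      exact hN
    · refine wp_assign fun _ _ => ?_
      have hr' : RamOK P { r with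
        out := update r.out r.c [], cnt := (β (F r)).length, io := [] } :=
        { hr2 with io := ⟨by simp, by simp⟩ }
      exact ⟨hr', hQ _ rfl hr'⟩

theorem tot_update {nc : ℕ} (o : ℕ → List Cell) (r : Ram) {c : ℕ} (hc : c < nc)
    (h : ∀ c', c' ≠ c → o c' = r.out c') :
    tot nc { r with out := o } + (r.out c).length = tot nc r + (o c).length := by
  unfold tot
  rw [← Finset.add_sum_erase _ _ (Finset.mem_range.2 hc),
    ← Finset.add_sum_erase (a := c) (Finset.range nc) (fun c => (r.out c).length)
      (Finset.mem_range.2 hc)]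
  have : ∑ x ∈ (Finset.range nc).erase c, (o x).length =
      ∑ x ∈ (Finset.range nc).erase c, (r.out x).length :=
    Finset.sum_congr rfl fun x hx => by rw [h x (Finset.ne_of_mem_erase hx)]
  dsimp only
  rw [this]
  omega

/-- The new RAM state after `put`. -/
theorem wp_put {x : Ram → Cell} (hW : Wr P nc G β₀ W r β) (hS : Stable F) (hc : r.c < nc)
    (hnc : nc ≤ P.f) (hG : ∀ c < nc, G r.c = G c → r.c = c) (hF : F r = G r.c)
    (hi : F r ≠ File.input) (ho : F r ≠ File.output) (hx : CellOK P (x r))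
    (hN : (β₀ (G r.c)).flatten.length + (W r.c).length + 1 ≤ P.N)
    (hQ : ∀ o k io β' e' r', r' = { r with out := o, cnt := k, io := io } →
      Wr P nc G β₀ (addW W r.c [x r]) r' β' → P.B * e' + 3 * tot nc r' ≤ P.B * e + 3 * tot nc r + 3 →
      RamOK P r' → Q r' β' e') :
    WP P (P.put F x) r β e Q := by
  refine WP.intro fun hr hβ => ?_
  have hlt := hW.lt r.c
  have hlt' : ∀ c ≠ r.c, (update r.out r.c (r.out r.c ++ [x r]) c).length < P.B := by
    intro c h
    rw [update_of_ne h]; exact hW.lt c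
  have hr1 : RamOK P { r with out := update r.out r.c (r.out r.c ++ [x r]) } := by
    refine { hr with out := fun c => ?_, out_nil := fun c hc' => ?_ }
    · by_cases h : c = r.c
      · subst h
        simp only [update_self]
        refine ⟨by simpa using hlt, fun y hy => ?_⟩
        rw [List.mem_append, List.mem_singleton] at hy
        rcases hy with hy | rfl
        · exact (hr.out r.c).cells y hy
        · exact hx
      · simp only [update_of_ne h]; exact hr.out c
    · simp only [update_of_ne (show c ≠ r.c by omega)]; exact hr.out_nil c hc'
  have hcont : ∀ c < nc, (β (G c)).flatten ++ update r.out r.c (r.out r.c ++ [x r]) c =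
      (β₀ (G c)).flatten ++ addW W r.c [x r] c := by
    intro c hc'
    by_cases h : c = r.c
    · subst h
      simp only [update_self, addW]
      rw [← List.append_assoc, hW.cont _ hc', List.append_assoc]
    · simp only [update_of_ne h, addW]; exact hW.cont c hc'
  have hlenW : ∀ c, (addW W r.c [x r] c).length = (W c).length + if c = r.c then 1 else 0 := by
    intro c
    by_cases h : c = r.c
    · subst h; simp [addW]
    · simp [addW, h]
  have htot := tot_update (nc := nc) (update r.out r.c (r.out r.c ++ [x r])) r hc
    (fun c' h => update_of_ne h _ _)
  simp only [update_self, List.length_append, List.length_singleton] at htot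
  refine wp_seq (wp_assign fun _ _ => ⟨hr1, ?_⟩)
  refine wp_cond (fun hb => ?_) (fun hb => ?_)
  · simp only [update_self, List.length_append, List.length_singleton, decide_eq_true_eq] at hb
    have hlen : (r.out r.c).length + 1 = P.B := by omega
    have hF1 : F { r with out := update r.out r.c (r.out r.c ++ [x r]) } = G r.c := by
      rw [← hF]; exact hS _ _ rfl rfl rfl rfl
    -- The block number to be stored is at most the number of words, since no block is empty, and
    -- `hN` bounds the words.
    have hnb : (β (G r.c)).length ≤ (β₀ (G r.c)).flatten.length + (W r.c).length := by
      have h1 := length_le_flatten fun y hy => (hβ (G r.c) y hy).1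
      have h2 := congrArg List.length (hW.cont _ hc)
      simp only [List.length_append] at h2
      omega
    refine wp_flush hS (by rw [hF1, ← hF]; exact hi) (by rw [hF1, ← hF]; exact ho) (by omega)
      (by simp) (by rw [hF1]; omega) ?_
    rw [hF1]
    simp only [update_self, update_idem]
    rintro r' rfl hr'
    have htot2 := tot_update (nc := nc) (update r.out r.c []) r hc
      (fun c' h => update_of_ne h _ _)
    simp only [update_self, List.length_nil] at htot2
    refine hQ (update r.out r.c []) (β (G r.c)).length [] _ _ _ rfl ⟨?_, ?_, ?_, ?_, ?_⟩ ?_ hr'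
    · intro c hc'
      have := hcont c hc'
      by_cases h : c = r.c
      · subst h
        simp only [update_self, List.flatten_append, List.flatten_singleton, List.append_nil] at this ⊢
        exact this
      · simp only [update_of_ne h] at this ⊢
        rw [update_of_ne (fun h' => h (hG c hc' h'.symm).symm)]
        exact this
    · intro c
      by_cases h : c = r.c
      · subst h; simp only [update_self, List.length_nil]; omega
      · simp only [update_of_ne h]; exact hW.lt c
    · intro c hc'
      have h : c ≠ r.c := by omega
      simp only [update_of_ne h]; exact hW.nil c hc'
    · intro F' hF'
      rw [update_of_ne (hF' _ hc)]
      exact hW.frame F' hF'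
    · intro c hc'
      have := hW.blocks c hc'
      rw [hlenW]
      by_cases h : c = r.c
      · subst h
        simp only [update_self, List.length_append, List.length_singleton, List.length_nil,
          if_true, mul_add]
        omega
      · simp only [update_of_ne h, if_neg h]
        rw [update_of_ne (fun h' => h (hG c hc' h'.symm).symm)]
        omega
    -- The amortization: a flush costs three I/Os, `3 * B` in units of `1 / B`. It removes from
    -- `tot` the `B - 1` words that were buffered before this one, so potential and cost together
    -- grow by exactly the three units charged to the new word.
    · change _ + 3 * tot nc { r with out := update r.out r.c [] } ≤ _
      rw [mul_add]
      omega
  · simp only [update_self, List.length_append, List.length_singleton, decide_eq_false_iff_not] at hb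
    refine wp_skip fun hr' _ => hQ _ r.cnt r.io _ _ _ rfl ⟨hcont, ?_, ?_, hW.frame, ?_⟩ ?_ hr'
    · intro c
      by_cases h : c = r.c
      · subst h; simp; omega
      · exact hlt' c h
    · intro c hc'
      have h : c ≠ r.c := by omega
      simp only [update_of_ne h]; exact hW.nil c hc'
    · intro c hc'
      have := hW.blocks c hc'
      rw [hlenW]
      by_cases h : c = r.c
      · subst h; simp; omega
      · simp [h]; omega
    · omega

theorem wp_putTriple {lf : Ram → ℕ} (hW : Wr P nc G β₀ W r β) (hS : Stable F) (hc : r.c < nc)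
    (hnc : nc ≤ P.f) (hG : ∀ c < nc, G r.c = G c → r.c = c) (hF : F r = G r.c)
    (hi : F r ≠ File.input) (ho : F r ≠ File.output) (hl : lf r ≤ P.N)
    (hlf : ∀ r' : Ram, r'.l = r.l → r'.t = r.t → lf r' = lf r)
    (hN : (β₀ (G r.c)).flatten.length + (W r.c).length + 3 ≤ P.N)
    (hQ : ∀ o k io β' e' r', r' = { r with out := o, cnt := k, io := io } →
      Wr P nc G β₀ (addW W r.c [Cell.int r.p, Cell.int r.q, Cell.int (lf r)]) r' β' →
      P.B * e' + 3 * tot nc r' ≤ P.B * e + 3 * tot nc r + 9 → RamOK P r' → Q r' β' e') :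
    WP P (P.putTriple F lf) r β e Q := by
  refine WP.intro fun hr _ => ?_
  have hWl : ∀ (W : ℕ → List Cell) c ws, (addW W c ws c).length = (W c).length + ws.length := by
    intro W c ws; simp [addW]
  refine wp_seq (wp_put hW hS hc hnc hG hF hi ho hr.p (by omega) ?_)
  intro o1 k1 io1 β1 e1 r1 h1 W1 he1 _
  have c1 : r1.c = r.c := by rw [h1]
  have F1 : F r1 = F r := by apply hS <;> rw [h1]
  rw [← c1] at W1
  have q1 : r1.q = r.q := by rw [h1]
  refine wp_seq (wp_put W1 hS (by rw [c1]; exact hc) hnc (by rw [c1]; exact hG)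
    (by rw [c1, F1]; exact hF) (by rw [F1]; exact hi) (by rw [F1]; exact ho)
    (by rw [q1]; exact hr.q) (by rw [hWl, c1, List.length_singleton]; omega) ?_)
  intro o2 k2 io2 β2 e2 r2 h2 W2 he2 _
  have c2 : r2.c = r.c := by rw [h2, h1]
  have F2 : F r2 = F r := by apply hS <;> rw [h2, h1]
  have l2 : lf r2 = lf r := hlf _ (by rw [h2, h1]) (by rw [h2, h1])
  rw [addW_addW, c1, q1, ← c2] at W2
  refine wp_put W2 hS (by rw [c2]; exact hc) hnc (by rw [c2]; exact hG)
    (by rw [c2, F2]; exact hF) (by rw [F2]; exact hi) (by rw [F2]; exact ho)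
    (by rw [l2]; exact hl) (by rw [hWl, c2, List.length_append, List.length_singleton, List.length_singleton]; omega) ?_
  intro o3 k3 io3 β3 e3 r3 h3 W3 he3 ok3
  rw [addW_addW, c2, l2] at W3
  refine hQ o3 k3 io3 β3 e3 r3 (by rw [h3, h2, h1]) W3 (by omega) ok3

/-- Number of nonempty buffers among the first `nc`. -/
def busy (nc : ℕ) (r : Ram) : ℕ := ((Finset.range nc).filter fun c => r.out c ≠ []).card

/-- The number of nonempty buffers falls with every flush. Each of the `nc` sequences gains at most
one partial block, at three I/Os each. -/
theorem wp_flushAll (hW : Wr P nc G β₀ W r β) (hS : Stable F) (hnc : nc ≤ P.f)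
    (hG : ∀ c < nc, ∀ c' < nc, G c = G c' → c = c')
    (hF : ∀ c < nc, ∀ r', r'.lev = r.lev → r'.i = r.i → r'.j = r.j → r'.c = c → F r' = G c)
    (hi : ∀ c < nc, G c ≠ File.input) (ho : ∀ c < nc, G c ≠ File.output) (hB : 1 ≤ P.B)
    (hN : ∀ c < nc, (β₀ (G c)).flatten.length + (W c).length + 1 ≤ P.N) (hfN : nc ≤ P.N)
    (hQ : ∀ c k io β' e' r', r' = { r with out := fun _ => [], c := c, cnt := k, io := io } →
      RamOK P r' → StoreOK P β' →
      (∀ c < nc, (β' (G c)).flatten = (β₀ (G c)).flatten ++ W c) →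
      (∀ F, (∀ c < nc, F ≠ G c) → β' F = β₀ F) →
      (∀ c < nc, P.B * (β' (G c)).length ≤ P.B * (β₀ (G c)).length + (W c).length + P.B) →
      e' ≤ e + 3 * nc → Q r' β' e') :
    WP P (P.flushAll F) r β e Q := by
  let I : ℕ → Ram → Store → ℕ → Prop := fun n r1 β1 e1 =>
    (∃ c o k io, r1 = { r with out := o, c := c, cnt := k, io := io }) ∧ n = busy nc r1 ∧
    (∀ c < nc, (β1 (G c)).flatten ++ r1.out c = (β₀ (G c)).flatten ++ W c) ∧
    (∀ c, nc ≤ c → r1.out c = []) ∧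
    (∀ F, (∀ c < nc, F ≠ G c) → β1 F = β₀ F) ∧
    -- The conditional term reserves a whole block for a buffer that is still nonempty; flushing it,
    -- however short it is, uses up this reserve.
    (∀ c < nc, P.B * (β1 (G c)).length + (r1.out c).length + (if r1.out c = [] then 0 else P.B) ≤
      P.B * (β₀ (G c)).length + (W c).length + P.B) ∧
    e1 + 3 * n ≤ e + 3 * busy nc r
  refine wp_loop I id (busy nc r) ?_ ?_ ?_
  · refine ⟨⟨r.c, r.out, r.cnt, r.io, rfl⟩, rfl, hW.cont, hW.nil, hW.frame, fun c hc => ?_, le_rfl⟩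
    have := hW.blocks c hc
    split <;> omega
  · rintro n r1 β1 e1 hr1 hβ1 ⟨⟨c1, o1, k1, io1, h1⟩, rfl, hcont, hnil, hframe, hblocks, he⟩ hb
    have hfind : ∃ c, (List.range P.f).find? (fun c => !(r1.out c).isEmpty) = some c := by
      rw [← Option.isSome_iff_exists, List.find?_isSome]
      simpa using hb
    obtain ⟨c, hc⟩ := hfind
    have hcne : r1.out c ≠ [] := by simpa using List.find?_some hc
    have hcnc : c < nc := by
      by_contra h
      exact hcne (hnil c (by omega))
    refine wp_seq (wp_assign fun _ _ => ?_)
    simp only [hc, Option.getD_some]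
    refine ⟨{ hr1 with c := by dsimp only; omega }, ?_⟩
    have hFc : F { r1 with c := c } = G c := by
      apply hF c hcnc <;> simp [h1]
    have hnb : (β1 (G c)).length + 1 ≤ P.N := by
      have e1 := length_le_flatten fun y hy => (hβ1 (G c) y hy).1
      have e2 := congrArg List.length (hcont _ hcnc)
      have e3 := hN c hcnc
      simp only [List.length_append] at e2
      omega
    refine wp_flush hS (by rw [hFc]; exact hi c hcnc) (by rw [hFc]; exact ho c hcnc) hB hcne
      (by rw [hFc]; exact hnb) ?_
    rw [hFc]
    rintro r' hr' hok
    have hout : r'.out = update r1.out c [] := by rw [hr']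
    have hbusy : busy nc r' + 1 = busy nc r1 := by
      unfold busy
      have : (Finset.range nc).filter (fun c' => r'.out c' ≠ []) =
          ((Finset.range nc).filter fun c' => r1.out c' ≠ []).erase c := by
        ext c'
        simp only [Finset.mem_filter, Finset.mem_erase, hout]
        by_cases h : c' = c
        · subst h; simp
        · simp [h]
      rw [this]
      apply Finset.card_erase_add_one
      simp [hcnc, hcne]
    refine ⟨busy nc r', by simp only [id]; omega, ⟨c, r'.out, r'.cnt, r'.io, by rw [hr', h1]⟩, rfl,
      ?_, ?_, ?_, ?_, by omega⟩
    · intro c' hc'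
      have := hcont c' hc'
      rw [hout]
      by_cases h : c' = c
      · subst h
        simpa using this
      · rw [update_of_ne h, update_of_ne (fun h' => h (hG _ hc' _ hcnc h'))]
        exact this
    · intro c' hc'
      rw [hout, update_of_ne (by omega)]
      exact hnil c' hc'
    · intro F' hF'
      rw [update_of_ne (hF' _ hcnc)]
      exact hframe F' hF'
    · intro c' hc'
      have := hblocks c' hc'
      rw [hout]
      by_cases h : c' = c
      · subst h
        rw [if_neg hcne] at this
        simp only [update_self, List.length_append, List.length_singleton, List.length_nil,
          if_true, mul_add]
        omega
      · rw [update_of_ne h, update_of_ne (fun h' => h (hG _ hc' _ hcnc h'))]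
        exact this
  · rintro n r1 β1 e1 hr1 hβ1 ⟨⟨c1, o1, k1, io1, h1⟩, rfl, hcont, hnil, hframe, hblocks, he⟩ hb
    have hall : ∀ c, r1.out c = [] := by
      intro c
      by_cases hc : c < nc
      · simp only [List.any_eq_false, List.mem_range, Bool.not_eq_true', Bool.not_eq_false,
          List.isEmpty_iff] at hb
        exact hb c (by omega)
      · exact hnil c (by omega)
    have hbr : busy nc r ≤ nc := (Finset.card_filter_le _ _).trans (by simp)
    refine hQ c1 k1 io1 β1 e1 r1 ?_ hr1 hβ1 ?_ hframe ?_ (by omega)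
    · have : o1 = fun _ => [] := by
        funext c
        have := hall c
        rw [h1] at this
        exact this
      rw [h1, this]
    · intro c hc
      have := hcont c hc
      rwa [hall, List.append_nil] at this
    · intro c hc
      have := hblocks c hc
      omega

end rules

/-! Splitting a factorization at the segment boundaries. -/

/-- The standing assumptions on the parameters and the string. -/
structure Ctx (P : Params) (X : List ℕ) : Prop where
  len : X.length = P.n
  lt : ∀ x ∈ X, x < P.σ
  two_le : 2 ≤ P.n
  two_le_sigma : 2 ≤ P.σ
  B_pos : 1 ≤ P.B
  le_M : 64 * P.B ≤ P.M
  adm : P.Admissible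

/-! ### Substrings and elementary bounds on the parameters. -/

def slice (X : List ℕ) (q l : ℕ) : List ℕ := (X.drop q).take l

theorem slice_length {X : List ℕ} {q l : ℕ} (h : q + l ≤ X.length) : (slice X q l).length = l := by
  simp [slice]; omega

theorem slice_take {X : List ℕ} {q l t : ℕ} (h : t ≤ l) : (slice X q l).take t = slice X q t := by
  simp [slice, List.take_take, h]

theorem slice_drop {X : List ℕ} {q l t : ℕ} :
    (slice X q l).drop t = slice X (q + t) (l - t) := by
  simp [slice, List.drop_take, List.drop_drop]

theorem mem_of_mem_slice {X : List ℕ} {q l x : ℕ} (h : x ∈ slice X q l) : x ∈ X :=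
  List.mem_of_mem_drop (List.mem_of_mem_take h)

theorem slice_getD {X : List ℕ} {q l u : ℕ} (hu : u < l) : (slice X q l).getD u 0 = X.getD (q + u) 0 := by
  simp [slice, List.getD_eq_getElem?_getD, hu]

theorem Params.d_pos (P : Params) : 1 ≤ P.d := le_max_left _ _

namespace Ctx

variable {P : Params} {X : List ℕ} (h : Ctx P X)
include h

theorem d_le : P.d ≤ P.n := by
  have := h.two_le
  exact max_le (by omega) (Nat.log_le_self _ _)

theorem m_ge : 32 * P.B ≤ P.m := by
  have := h.adm.half
  have := h.le_M
  omega

theorem m_pos : 1 ≤ P.m := by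
  have := h.m_ge
  have := h.B_pos
  omega

theorem d_le_b : P.d ≤ P.b := Nat.le_mul_of_pos_right _ h.m_pos

theorem b_pos : 0 < P.b := lt_of_lt_of_le P.d_pos h.d_le_b

theorem n_le : P.n ≤ P.segs * P.b := by
  have hb := h.b_pos
  have := Nat.div_add_mod (P.n + P.b - 1) P.b
  have := Nat.mod_lt (P.n + P.b - 1) hb
  unfold Params.segs
  rw [mul_comm]
  omega

theorem segs_pos : 0 < P.segs := by
  have h1 := h.two_le
  have := h.n_le
  rcases Nat.eq_zero_or_pos P.segs with h0 | h0
  · rw [h0, zero_mul] at this; omega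
  · exact h0

theorem segs_mul_lt : P.segs * P.b < P.n + P.b := by
  have hb := h.b_pos
  have h1 : P.segs * P.b ≤ P.n + P.b - 1 := Nat.div_mul_le_self _ _
  omega

theorem segs_le : P.segs ≤ P.n := by
  have hb := h.b_pos
  have h1 := h.segs_mul_lt
  have h2 := h.two_le
  by_contra hlt
  have h3 : (P.n + 1) * P.b ≤ P.segs * P.b := Nat.mul_le_mul_right _ (by omega)
  have h4 : P.n * 1 ≤ P.n * P.b := Nat.mul_le_mul_left _ hb
  rw [add_mul] at h3
  omega

theorem lt_segs {j : ℕ} (hj : j < P.n) : j / P.b < P.segs := by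
  rw [Nat.div_lt_iff_lt_mul h.b_pos]
  have := h.n_le
  omega

theorem f_pow_L : P.segs ≤ P.f ^ P.L :=
  Nat.le_pow_clog (by have := h.adm.four_le; omega) _

theorem L_le : P.L ≤ P.n := by
  have h1 := h.adm.four_le
  have h2 : P.L ≤ P.segs := by
    refine Nat.clog_le_of_le_pow ?_
    exact (Nat.lt_pow_self (by omega)).le
  exact h2.trans h.segs_le

end Ctx

/-! ### Parts of repeat phrases, pieces of literal runs, and how they tile a prefix. -/

/-- A part of a repeat phrase: source position, position, length. -/
structure Part where
  p : ℕ
  q : ℕ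
  l : ℕ

def trip (x : Part) : List Cell := [Cell.int x.p, Cell.int x.q, Cell.int x.l]

def litw (X : List ℕ) (y : ℕ × ℕ) : List Cell := [Cell.int y.1, Cell.str (slice X y.1 y.2)]

structure PartOK (P : Params) (X : List ℕ) (x : Part) : Prop where
  pos : 0 < x.l
  lt : x.p < x.q
  le : x.q + x.l ≤ P.n
  qseg : x.q % P.b + x.l ≤ P.b
  pseg : x.p % P.b + x.l ≤ P.b
  copy : ∀ t < x.l, X[x.p + t]? = X[x.q + t]?

structure LitOK (P : Params) (y : ℕ × ℕ) : Prop where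
  pos : 0 < y.2
  le_d : y.2 ≤ P.d
  le : y.1 + y.2 ≤ P.n
  seg : y.1 % P.b + y.2 ≤ P.b

/-- The first `i` positions are split into the parts `ps` of repeat phrases and the literal
pieces `ls`. -/
structure Splitting (P : Params) (X : List ℕ) (i : ℕ) (ps : List Part) (ls : List (ℕ × ℕ)) :
    Prop where
  parts : ∀ x ∈ ps, PartOK P X x
  lits : ∀ y ∈ ls, LitOK P y
  parts_le : ∀ x ∈ ps, x.q + x.l ≤ i
  lits_le : ∀ y ∈ ls, y.1 + y.2 ≤ i
  parts_sorted : ps.Pairwise fun x y => x.q + x.l ≤ y.q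
  lits_sorted : ls.Pairwise fun x y => x.1 + x.2 ≤ y.1
  cover : ∀ u < i, (∃ x ∈ ps, x.q ≤ u ∧ u < x.q + x.l) ∨ ∃ y ∈ ls, y.1 ≤ u ∧ u < y.1 + y.2
  sum : (ps.map Part.l).sum + (ls.map Prod.snd).sum = i

theorem splitting_nil (P : Params) (X : List ℕ) : Splitting P X 0 [] [] := by
  constructor <;> simp

theorem Splitting.addPart {P X i ps ls} (h : Splitting P X i ps ls) {x : Part} (hx : PartOK P X x)
    (hq : x.q = i) : Splitting P X (i + x.l) (ps ++ [x]) ls where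
  parts y hy := by
    rw [List.mem_append, List.mem_singleton] at hy
    rcases hy with hy | rfl
    exacts [h.parts y hy, hx]
  lits := h.lits
  parts_le y hy := by
    rw [List.mem_append, List.mem_singleton] at hy
    rcases hy with hy | rfl
    · have := h.parts_le y hy; omega
    · omega
  lits_le y hy := by have := h.lits_le y hy; omega
  parts_sorted := by
    rw [List.pairwise_append]
    refine ⟨h.parts_sorted, List.pairwise_singleton _ _, fun y hy z hz => ?_⟩
    rw [List.mem_singleton] at hz
    subst hz
    rw [hq]; exact h.parts_le y hy
  lits_sorted := h.lits_sorted
  cover u hu := by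
    by_cases hui : u < i
    · rcases h.cover u hui with ⟨y, hy, h1⟩ | h1
      · exact Or.inl ⟨y, by simp [hy], h1⟩
      · exact Or.inr h1
    · exact Or.inl ⟨x, by simp, by omega, by omega⟩
  sum := by
    have := h.sum
    simp only [List.map_append, List.sum_append, List.map_cons, List.map_nil, List.sum_cons,
      List.sum_nil]
    omega

theorem Splitting.addLit {P X i ps ls} (h : Splitting P X i ps ls) {y : ℕ × ℕ} (hy : LitOK P y)
    (hq : y.1 = i) : Splitting P X (i + y.2) ps (ls ++ [y]) where
  parts := h.parts
  lits z hz := by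
    rw [List.mem_append, List.mem_singleton] at hz
    rcases hz with hz | rfl
    exacts [h.lits z hz, hy]
  parts_le x hx := by have := h.parts_le x hx; omega
  lits_le z hz := by
    rw [List.mem_append, List.mem_singleton] at hz
    rcases hz with hz | rfl
    · have := h.lits_le z hz; omega
    · omega
  parts_sorted := h.parts_sorted
  lits_sorted := by
    rw [List.pairwise_append]
    refine ⟨h.lits_sorted, List.pairwise_singleton _ _, fun x hx z hz => ?_⟩
    rw [List.mem_singleton] at hz
    subst hz
    rw [hq]; exact h.lits_le x hx
  cover u hu := by
    by_cases hui : u < i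
    · rcases h.cover u hui with h1 | ⟨z, hz, h1⟩
      · exact Or.inl h1
      · exact Or.inr ⟨z, by simp [hz], h1⟩
    · exact Or.inr ⟨y, by simp, by omega, by omega⟩
  sum := by
    have := h.sum
    simp only [List.map_append, List.sum_append, List.map_cons, List.map_nil, List.sum_cons,
      List.sum_nil]
    omega

theorem length_le_sum_map {α : Type*} {l : List α} {g : α → ℕ} (h : ∀ x ∈ l, 0 < g x) :
    l.length ≤ (l.map g).sum := by
  induction l with
  | nil => simp
  | cons x l ih =>
    have h1 := ih fun y hy => h y (List.mem_cons_of_mem _ hy)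
    have h2 := h x List.mem_cons_self
    simp only [List.length_cons, List.map_cons, List.sum_cons]
    omega

theorem Splitting.length_le {P X i ps ls} (h : Splitting P X i ps ls) :
    ps.length + ls.length ≤ i := by
  rw [← h.sum]
  exact Nat.add_le_add (length_le_sum_map fun x hx => (h.parts x hx).pos)
    (length_le_sum_map fun y hy => (h.lits y hy).pos)

/-- The sequence to which a part is written while the input is split. -/
def Part.kind (P : Params) (x : Part) : ℕ :=
  if x.p + P.b < x.q then 0 else if x.p / P.b = x.q / P.b then 3 else 2

def ofKind (P : Params) (k : ℕ) (ps : List Part) : List Part := ps.filter fun x => x.kind P = k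

/-! ### The input as a list of items, and its length. -/

/-- Items of the input: packed runs of literals and repeat phrases. -/
inductive Item where
  | run (s : List ℕ)
  | rep (p l : ℕ)

def Item.words : Item → List Cell
  | run s => [Cell.str s]
  | rep p l => [Cell.int p, Cell.int l]

def items (d : ℕ) : List Phrase → List Item
  | [] => []
  | Phrase.rep p l :: zs => Item.rep p l :: items d zs
  | Phrase.lit c :: zs =>
      match items d zs with
      | Item.run s :: ws =>
          if s.length < d then Item.run (c :: s) :: ws else Item.run [c] :: Item.run s :: ws
      | ws => Item.run [c] :: ws

/-- `items` follows the recursion of `encode` but keeps the words of one phrase together, so that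
the input can be read as a sequence of records. -/
theorem encode_eq_items (d : ℕ) (zs : List Phrase) :
    encode d zs = (items d zs).flatMap Item.words := by
  induction zs with
  | nil => rfl
  | cons z zs ih =>
    cases z with
    | rep p l => simp [encode, items, ih, Item.words]
    | lit c =>
      simp only [encode, items, ih]
      rcases items d zs with _ | ⟨x, ws⟩
      · simp [Item.words]
      · cases x with
        | rep p l => simp [Item.words]
        | run s =>
          simp only [List.flatMap_cons, Item.words, List.singleton_append]
          split <;> simp [Item.words]

/-- The items describe the suffix of `X` from position `i` on. -/
def ItemsFrom (d : ℕ) (X : List ℕ) : ℕ → List Item → Prop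
  | i, [] => i = X.length
  | i, Item.run s :: ws => s ≠ [] ∧ s.length ≤ d ∧ i + s.length ≤ X.length ∧
      s = slice X i s.length ∧ ItemsFrom d X (i + s.length) ws
  | i, Item.rep p l :: ws => 0 < l ∧ p < i ∧ i + l ≤ X.length ∧
      (∀ t < l, X[p + t]? = X[i + t]?) ∧ ItemsFrom d X (i + l) ws

theorem slice_cons {X : List ℕ} {i c l : ℕ} (h : X[i]? = some c) :
    c :: slice X (i + 1) l = slice X i (l + 1) := by
  obtain ⟨hi, rfl⟩ := List.getElem?_eq_some_iff.1 h
  unfold slice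
  rw [List.drop_eq_getElem_cons hi, List.take_succ_cons]

theorem itemsFrom_items {d : ℕ} (hd : 1 ≤ d) {X : List ℕ} {zs : List Phrase} {i : ℕ}
    (h : FactorsFrom X i zs) : ItemsFrom d X i (items d zs) := by
  induction zs generalizing i with
  | nil => exact h
  | cons z zs ih =>
    cases z with
    | rep p l =>
      obtain ⟨h1, h2, h3, h4, h5⟩ := h
      exact ⟨h1, h2, h3, h4, ih h5⟩
    | lit c =>
      obtain ⟨h1, h2⟩ := h
      have hi : i + 1 ≤ X.length := (List.getElem?_eq_some_iff.1 h1).1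
      have hs : [c] = slice X i 1 := by
        have := slice_cons (l := 0) h1
        simpa [slice] using this
      have ih := ih h2
      simp only [items]
      generalize items d zs = its at ih ⊢
      rcases its with _ | ⟨x, ws⟩
      · exact ⟨by simp, by simpa using hd, by simpa using hi, hs, ih⟩
      · cases x with
        | rep p l => exact ⟨by simp, by simpa using hd, by simpa using hi, hs, ih⟩
        | run s =>
          obtain ⟨g1, g2, g3, g4, g5⟩ := ih
          dsimp only
          split
          · refine ⟨by simp, by simp; omega, by simp; omega, ?_, ?_⟩
            · rw [List.length_cons, ← slice_cons h1, ← g4]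
            · rw [List.length_cons, show i + (s.length + 1) = i + 1 + s.length by omega]
              exact g5
          · exact ⟨by simp, by simpa using hd, by simpa using hi, hs, g1, g2, g3, g4, g5⟩

def runs : List Item → ℕ
  | [] => 0
  | Item.run _ :: ws => runs ws + 1
  | Item.rep _ _ :: ws => runs ws

def reps : List Item → ℕ
  | [] => 0
  | Item.run _ :: ws => reps ws
  | Item.rep _ _ :: ws => reps ws + 1

theorem runs_append (a b : List Item) : runs (a ++ b) = runs a + runs b := by
  induction a with
  | nil => simp [runs]
  | cons x a ih => cases x <;> (simp [runs, ih]; try omega)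

theorem reps_append (a b : List Item) : reps (a ++ b) = reps a + reps b := by
  induction a with
  | nil => simp [reps]
  | cons x a ih => cases x <;> (simp [reps, ih]; try omega)

theorem words_length (T : List Item) :
    (T.flatMap Item.words).length = runs T + 2 * reps T := by
  induction T with
  | nil => simp [runs, reps]
  | cons x a ih =>
    cases x <;> simp only [List.flatMap_cons, List.length_append, ih, runs, reps, Item.words,
      List.length_cons, List.length_nil] <;> omega

theorem reps_items (d : ℕ) (zs : List Phrase) : reps (items d zs) = repCount zs := by
  induction zs with
  | nil => rfl
  | cons z zs ih =>
    cases z with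
    | rep p l => simp [items, reps, repCount, ih]
    | lit c =>
      simp only [items, repCount, ← ih]
      rcases items d zs with _ | ⟨x, ws⟩
      · simp [reps]
      · cases x with
        | rep p l => simp [reps]
        | run s => dsimp only; split <;> simp [reps]

/-- Free places in the first item, if it is a run. -/
def slack (d : ℕ) : List Item → ℕ
  | Item.run s :: _ => d - s.length
  | _ => 0

/-- Amortization with `slack` as potential. A literal that joins a run trades one free place for one
symbol. A new run is opened only in front of an item without slack or at the end; of its cost `d`,
one is its symbol and `d - 1` reappear as slack. A repeat phrase forfeits the slack behind it, at
most `d`, which its own summand covers. -/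
theorem runs_items {d : ℕ} (hd : 1 ≤ d) {X : List ℕ} {zs : List Phrase} {i : ℕ}
    (h : FactorsFrom X i zs) :
    d * runs (items d zs) ≤ (X.length - i) + d * repCount zs + slack d (items d zs) := by
  induction zs generalizing i with
  | nil => simp [items, runs]
  | cons z zs ih =>
    cases z with
    | rep p l =>
      obtain ⟨h1, h2, h3, h4, h5⟩ := h
      have := ih h5
      have hs : slack d (items d zs) ≤ d := by
        rcases items d zs with _ | ⟨x, ws⟩
        · simp [slack]
        · cases x <;> simp [slack]
      simp only [items, runs, repCount, slack, mul_add]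
      omega
    | lit c =>
      obtain ⟨h1, h2⟩ := h
      have hi : i + 1 ≤ X.length := (List.getElem?_eq_some_iff.1 h1).1
      have := ih h2
      simp only [items, repCount]
      generalize items d zs = its at this ⊢
      rcases its with _ | ⟨x, ws⟩
      · simp only [runs, slack, List.length_singleton, mul_add] at this ⊢
        omega
      · cases x with
        | rep p l =>
          simp only [runs, slack, List.length_singleton, mul_add] at this ⊢
          omega
        | run s =>
          dsimp only
          split <;>
          · simp only [runs, slack, List.length_nil, List.length_cons, mul_add] at this ⊢
            omega

/-! The splitting phase. -/

/-- `Params.splitFile` as a function of the buffer number alone. Number `1` is for literals; the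
other three are the values of `Part.kind`. -/
def splitG (P : Params) (c : ℕ) : File :=
  if c = 0 then File.R P.L 0 else if c = 1 then File.lits else if c = 2 then File.prev
  else File.same

def splitW (P : Params) (X : List ℕ) (ps : List Part) (ls : List (ℕ × ℕ)) (c : ℕ) : List Cell :=
  if c = 1 then ls.flatMap (litw X) else (ofKind P c ps).flatMap trip

theorem flatMap_trip_length (ps : List Part) : (ps.flatMap trip).length = 3 * ps.length := by
  induction ps with
  | nil => rfl
  | cons x ps ih => simp only [List.flatMap_cons, List.length_append, ih, trip,
      List.length_cons, List.length_nil]; omega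

theorem flatMap_litw_length (X : List ℕ) (ls : List (ℕ × ℕ)) :
    (ls.flatMap (litw X)).length = 2 * ls.length := by
  induction ls with
  | nil => rfl
  | cons x ps ih => simp only [List.flatMap_cons, List.length_append, ih, litw,
      List.length_cons, List.length_nil]; omega

theorem ofKind_length_le (P : Params) (k : ℕ) (ps : List Part) :
    (ofKind P k ps).length ≤ ps.length := List.length_filter_le _ _

theorem splitW_length (P : Params) (X : List ℕ) (ps : List Part) (ls : List (ℕ × ℕ)) (c : ℕ) :
    (splitW P X ps ls c).length ≤ 3 * (ps.length + ls.length) := by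
  unfold splitW
  split
  · rw [flatMap_litw_length]; omega
  · rw [flatMap_trip_length]
    have := ofKind_length_le P c ps
    omega

theorem splitW_addPart (P : Params) (X : List ℕ) (ps : List Part) (ls : List (ℕ × ℕ)) (x : Part) :
    addW (splitW P X ps ls) (x.kind P) (trip x) = splitW P X (ps ++ [x]) ls := by
  have h1 : x.kind P ≠ 1 := by unfold Part.kind; split_ifs <;> simp
  funext c
  by_cases hc : c = x.kind P
  · subst hc
    simp [addW, splitW, h1, ofKind, List.filter_append]
  · simp [addW, hc, splitW, ofKind, List.filter_append, Ne.symm hc]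

theorem splitW_addLit (P : Params) (X : List ℕ) (ps : List Part) (ls : List (ℕ × ℕ)) (y : ℕ × ℕ) :
    addW (splitW P X ps ls) 1 (litw X y) = splitW P X ps (ls ++ [y]) := by
  funext c
  by_cases hc : c = 1
  · subst hc
    simp [addW, splitW]
  · simp [addW, hc, splitW]

theorem splitG_inj (P : Params) : ∀ c < 4, ∀ c' < 4, splitG P c = splitG P c' → c = c' := by
  intro c hc c' hc' h
  interval_cases c <;> interval_cases c' <;> simp [splitG] at h <;> rfl

theorem splitG_ne_input (P : Params) (c : ℕ) : splitG P c ≠ File.input := by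
  unfold splitG; split_ifs <;> simp

theorem splitG_ne_output (P : Params) (c : ℕ) : splitG P c ≠ File.output := by
  unfold splitG; split_ifs <;> simp

theorem stable_splitFile (P : Params) : Stable P.splitFile := by
  intro r r' h1 h2 h3 h4
  simp [Params.splitFile, h4]

/-- `E` is the prepaid cost of reading the input, times `B`. A part writes three words and a literal
piece two, at three units each: hence the factors nine and six. -/
structure SplitInv (P : Params) (X : List ℕ) (β₀ : Store) (Y₀ : List ℕ) (E : ℕ)
    (ps : List Part) (ls : List (ℕ × ℕ)) (r : Ram) (β : Store) (v : ℕ) : Prop where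
  split : Splitting P X r.q ps ls
  le : r.q ≤ P.n
  wr : Wr P 4 (splitG P) β₀ (splitW P X ps ls) r β
  Y : r.Y = Y₀
  slots : ∀ s ≠ Slot.scan, r.inp s = [] ∧ r.pos s = 0
  cost : P.B * v + 3 * tot 4 r ≤ E + 9 * ps.length + 6 * ls.length

theorem SplitInv.input {P X β₀ Y₀ E ps ls r β v} (h : SplitInv P X β₀ Y₀ E ps ls r β v) :
    β File.input = β₀ File.input :=
  h.wr.frame _ fun c _ => (splitG_ne_input P c).symm

theorem SplitInv.scan {P X β₀ Y₀ E ps ls r β v} {r' : Ram} (h : SplitInv P X β₀ Y₀ E ps ls r β v)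
    (hq : r'.q = r.q) (ho : r'.out = r.out) (hY : r'.Y = r.Y)
    (hs : ∀ s ≠ Slot.scan, r'.inp s = r.inp s ∧ r'.pos s = r.pos s) :
    SplitInv P X β₀ Y₀ E ps ls r' β v where
  split := by rw [hq]; exact h.split
  le := by rw [hq]; exact h.le
  wr := h.wr.congr ho
  Y := by rw [hY]; exact h.Y
  slots s h' := by rw [(hs s h').1, (hs s h').2]; exact h.slots s h'
  cost := by rw [tot_congr ho]; exact h.cost

theorem mod_add_min {a b t : ℕ} (h : a % b + t ≤ b) :
    (a + t) % b = if a % b + t = b then 0 else a % b + t := by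
  rw [← Nat.mod_add_mod]
  split
  · next h' => rw [h', Nat.mod_self]
  · exact Nat.mod_eq_of_lt (by omega)

section

variable {P : Params} {X : List ℕ} {β₀ : Store} {Y₀ : List ℕ} {E : ℕ} {ps : List Part}
  {ls : List (ℕ × ℕ)} {r : Ram} {β : Store} {e : ℕ} {Q : Ram → Store → ℕ → Prop}
  {bl : List (List Cell)} {ws : List Cell}

/-- Apart from the last cut, every cut ends where the target or the source meets a segment boundary,
so a phrase of length `l` yields at most `2 * l / b + 3` parts. -/
theorem wp_splitRep (ctx : Ctx P X) (h0 : ∀ c, β₀ (splitG P c) = []) (hbl : β₀ File.input = bl)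
    (hN : bl.length ≤ P.N) (hI : SplitInv P X β₀ Y₀ E ps ls r β (e + rem bl Slot.scan r)) {p l : ℕ}
    (hR : Rd bl Slot.scan 0 r (Cell.int p :: Cell.int l :: ws)) (hpq : p < r.q)
    (hle : r.q + l ≤ P.n) (hcopy : ∀ t < l, X[p + t]? = X[r.q + t]?)
    (hQ : ∀ ps' r' β' e', SplitInv P X β₀ Y₀ E ps' ls r' β' (e' + rem bl Slot.scan r') →
      r'.q = r.q + l → Rd bl Slot.scan 0 r' ws →
      P.b * ps'.length ≤ P.b * ps.length + 2 * l + 3 * P.b → Q r' β' e') :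
    WP P P.splitRep r β e Q := by
  have hb := ctx.b_pos
  refine wp_seq (wp_next (by rw [hI.input, hbl]) hR hN ?_)
  intro y1 k1 io1 e1 r1 hr1 ok1 hc1 R1 he1
  refine ⟨{ ok1 with p := hc1 }, ?_⟩
  refine wp_seq (wp_next (bl := bl) (a := 0) (ws := ws) (x := Cell.int l)
    (by rw [hI.input, hbl]) (R1.congr rfl rfl) hN ?_)
  intro y2 k2 io2 e2 r2 hr2 ok2 hc2 R2 he2
  refine ⟨{ ok2 with l := hc2 }, ?_⟩
  let I : ℕ → Ram → Store → ℕ → Prop := fun l' r' β' e' => r'.l = l' ∧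
    Rd bl Slot.scan 0 r' ws ∧ r'.p < r'.q ∧ r'.q + l' = r.q + l ∧
    (∀ t < l', X[r'.p + t]? = X[r'.q + t]?) ∧
    ∃ ps', SplitInv P X β₀ Y₀ E ps' ls r' β' (e' + rem bl Slot.scan r') ∧
      -- Potential for the number of cuts. A cut of length `t` lowers `2 * l'` by `2 * t` and raises
      -- each residue by `t`, except that a residue reaching a boundary drops by `b` on top. Thus
      -- every cut but the last releases at least `b`, and the last one releases the reserve `P.b`.
      -- Both residues start below `b`, which gives the `3 * P.b` on the right.
      P.b * ps'.length + (if l' = 0 then 0 else 2 * l' + P.b + r'.q % P.b + r'.p % P.b) ≤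
        P.b * ps.length + 2 * l + 3 * P.b
  have e1q : r1.q = r.q := by rw [hr1]
  have e2q : r2.q = r.q := by rw [hr2, hr1]
  have e2p : r2.p = p := by rw [hr2]; rfl
  refine wp_loop I id l ⟨rfl, R2.congr rfl rfl, ?_, ?_, ?_, ps, ?_, ?_⟩ ?_ ?_
  · dsimp only; rw [e2q, e2p]; exact hpq
  · dsimp only; rw [e2q]
  · dsimp only; rw [e2q, e2p]; exact hcopy
  · have hrem : rem bl Slot.scan { r2 with l := l } = rem bl Slot.scan r2 := rfl
    have hrem' : rem bl Slot.scan { r1 with p := p } = rem bl Slot.scan r1 := rfl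
    have hsum : e2 + rem bl Slot.scan r2 = e + rem bl Slot.scan r := by
      simp only [Cell.val] at he2; omega
    rw [show (Cell.int l).val = l from rfl, hrem, hsum]
    refine hI.scan ?_ ?_ ?_ ?_
    · exact e2q
    · dsimp only; rw [hr2, hr1]
    · dsimp only; rw [hr2, hr1]
    · intro s hs
      dsimp only
      rw [hr2, hr1]
      simp [hs]
  · have := Nat.mod_lt p hb
    have := Nat.mod_lt r.q hb
    dsimp only
    rw [e2q, e2p]
    split <;> omega
  · rintro l' r' β' e' hr' hβ' ⟨rfl, hRd, hlt, hend, hcp, ps', hI', hpot⟩ hl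
    have hl : 0 < r'.l := by simpa using hl
    rw [if_neg hl.ne'] at hpot
    have hqm := Nat.mod_lt r'.q hb
    have hpm := Nat.mod_lt r'.p hb
    set t := min r'.l (min (P.b - r'.q % P.b) (P.b - r'.p % P.b)) with ht
    have ht0 : 0 < t := by omega
    set x : Part := ⟨r'.p, r'.q, t⟩ with hx
    have hxOK : PartOK P X x := by
      refine ⟨ht0, hlt, ?_, ?_, ?_, fun u hu => hcp u ?_⟩ <;> simp only [hx] at * <;> omega
    have hk4 : x.kind P < 4 := by unfold Part.kind; split_ifs <;> simp
    refine wp_seq (wp_assign fun _ _ => ?_)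
    have hc : (if r'.p + P.b < r'.q then 0 else if r'.p / P.b = r'.q / P.b then 3 else 2) =
      x.kind P := rfl
    rw [hc, ← ht]
    have hN' : P.N = 8 * P.n + 8 := rfl
    refine ⟨{ hr' with t := by dsimp only; omega, c := by dsimp only; omega }, ?_⟩
    have hlen := hI'.split.length_le
    have hqn := hI'.le
    refine wp_seq (wp_putTriple (hI'.wr.congr rfl) (stable_splitFile P) hk4 ctx.adm.four_le
      (fun c h => splitG_inj P _ hk4 c h) rfl (splitG_ne_input P _) (splitG_ne_output P _)
      (by dsimp only; omega) (fun _ _ h => h) ?_ ?_)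
    · rw [h0]
      have := splitW_length P X ps' ls (x.kind P)
      simp only [List.flatten_nil, List.length_nil]
      omega
    intro o k io β3 e3 r3 hr3 W3 he3 ok3
    have hw : [Cell.int r'.p, Cell.int r'.q, Cell.int t] = trip x := rfl
    dsimp only at W3
    rw [hw, splitW_addPart] at W3
    have q3 : r3.q = r'.q := by rw [hr3]
    have p3 : r3.p = r'.p := by rw [hr3]
    have l3 : r3.l = r'.l := by rw [hr3]
    have t3 : r3.t = t := by rw [hr3]
    refine wp_assign fun _ _ => ⟨{ ok3 with
      p := by dsimp only; omega
      q := by dsimp only; omega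
      l := by dsimp only; omega }, r'.l - t, by simp only [id]; omega, ?_⟩
    have htot : tot 4 { r' with c := x.kind P, t := t } = tot 4 r' := rfl
    refine ⟨?_, ?_, ?_, ?_, ?_, ps' ++ [x], ⟨?_, ?_, ?_, ?_, ?_, ?_⟩, ?_⟩
    · dsimp only; rw [l3, t3]
    · exact hRd.congr (by dsimp only; rw [hr3]) (by dsimp only; rw [hr3])
    · dsimp only; omega
    · dsimp only; omega
    · intro u hu
      dsimp only
      rw [p3, q3, t3, add_assoc, add_assoc]
      exact hcp _ (by omega)
    · dsimp only
      rw [q3, t3]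
      exact hI'.split.addPart hxOK rfl
    · dsimp only; omega
    · exact W3.congr rfl
    · dsimp only; rw [hr3]; exact hI'.Y
    · dsimp only; rw [hr3]; exact hI'.slots
    · have hc := hI'.cost
      have hrem : rem bl Slot.scan { r3 with p := r3.p + r3.t, q := r3.q + r3.t, l := r3.l - r3.t } =
        rem bl Slot.scan r' := by
        refine rem_congr ?_
        rw [hr3]
      have htot' : tot 4 { r3 with p := r3.p + r3.t, q := r3.q + r3.t, l := r3.l - r3.t } = tot 4 r3 :=
        rfl
      rw [hrem, htot', mul_add]
      rw [mul_add] at hc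
      rw [htot] at he3
      simp only [List.length_append, List.length_singleton]
      omega
    · dsimp only
      rw [q3, p3, t3, List.length_append, List.length_singleton, mul_add]
      rw [mod_add_min hxOK.qseg, mod_add_min hxOK.pseg]
      simp only [hx]
      split_ifs <;> omega
  · rintro l' r' β' e' hr' hβ' ⟨rfl, hRd, hlt, hend, hcp, ps', hI', hpot⟩ hl
    have hl : r'.l = 0 := by simpa using hl
    exact hQ ps' r' β' e' hI' (by omega) hRd (by rw [if_pos hl] at hpot; omega)

/-- A run has at most `d ≤ b` symbols, so it crosses at most one segment boundary and yields at most
two pieces. -/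
theorem wp_splitLits (ctx : Ctx P X) (h0 : ∀ c, β₀ (splitG P c) = []) (hbl : β₀ File.input = bl)
    (hN : bl.length ≤ P.N) (hI : SplitInv P X β₀ Y₀ E ps ls r β (e + rem bl Slot.scan r)) {s : List ℕ}
    (hR : Rd bl Slot.scan 0 r (Cell.str s :: ws)) (hsd : s.length ≤ P.d)
    (hle : r.q + s.length ≤ P.n) (hsl : s = slice X r.q s.length)
    (hQ : ∀ ls' r' β' e', SplitInv P X β₀ Y₀ E ps ls' r' β' (e' + rem bl Slot.scan r') →
      r'.q = r.q + s.length → Rd bl Slot.scan 0 r' ws →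
      ls'.length ≤ ls.length + 2 → Q r' β' e') :
    WP P P.splitLits r β e Q := by
  have hb := ctx.b_pos
  have hdb := ctx.d_le_b
  have hN' : P.N = 8 * P.n + 8 := rfl
  refine wp_seq (wp_next (by rw [hI.input, hbl]) hR hN ?_)
  intro y1 k1 io1 e1 r1 hr1 ok1 hc1 R1 he1
  refine ⟨{ ok1 with w_len := hc1.1, w_lt := hc1.2, c := by dsimp only; omega }, ?_⟩
  let I : ℕ → Ram → Store → ℕ → Prop := fun l' r' β' e' => r'.w = slice X r'.q l' ∧ r'.c = 1 ∧
    Rd bl Slot.scan 0 r' ws ∧ r'.q + l' = r.q + s.length ∧ l' ≤ P.d ∧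
    ∃ ls', SplitInv P X β₀ Y₀ E ps ls' r' β' (e' + rem bl Slot.scan r') ∧
      ls'.length + (if l' = 0 then 0 else if r'.q % P.b + l' ≤ P.b then 1 else 2) ≤
        ls.length + 2
  have e1q : r1.q = r.q := by rw [hr1]
  refine wp_loop I id s.length ⟨?_, rfl, R1.congr rfl rfl, ?_, hsd, ls, ?_, ?_⟩ ?_ ?_
  · dsimp only; rw [e1q]; exact hsl
  · dsimp only; rw [e1q]
  · have hrem : rem bl Slot.scan { r1 with w := s, c := 1 } = rem bl Slot.scan r1 := rfl
    rw [show (Cell.str s).syms = s from rfl, hrem, he1]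
    refine hI.scan e1q ?_ ?_ ?_
    · dsimp only; rw [hr1]
    · dsimp only; rw [hr1]
    · intro s hs
      dsimp only
      rw [hr1]
      simp [hs]
  · split_ifs <;> omega
  · rintro l' r' β' e' hr' hβ' ⟨hw, hc, hRd, hend, hld, ls', hI', hpot⟩ hl
    have hwl : r'.w.length = l' := by
      rw [hw]; exact slice_length (by rw [ctx.len]; omega)
    have hl : 0 < l' := by
      rw [← hwl, List.length_pos_iff]
      simpa using hl
    rw [if_neg hl.ne'] at hpot
    have hqm := Nat.mod_lt r'.q hb
    refine wp_seq (wp_assign fun _ _ => ?_)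
    rw [hwl]
    set t := min l' (P.b - r'.q % P.b) with ht
    have ht0 : 0 < t := by omega
    set y : ℕ × ℕ := ⟨r'.q, t⟩ with hy
    have hyOK : LitOK P y := by
      refine ⟨ht0, ?_, ?_, ?_⟩ <;> simp only [hy] <;> omega
    refine ⟨{ hr' with t := by dsimp only; omega }, ?_⟩
    have hlen := hI'.split.length_le
    have hqn := hI'.le
    refine wp_seq (wp_put (hI'.wr.congr rfl) (stable_splitFile P) (by dsimp only; omega) ctx.adm.four_le
      (fun c h => splitG_inj P _ (by dsimp only; omega) c h) rfl (splitG_ne_input P _)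
      (splitG_ne_output P _) hr'.q ?_ ?_)
    · rw [h0]
      have := splitW_length P X ps ls' r'.c
      simp only [List.flatten_nil, List.length_nil]
      omega
    intro o2 k2 io2 β2 e2 r2 hr2 W2 he2 ok2
    dsimp only at W2
    have c2 : r2.c = 1 := by rw [hr2]; exact hc
    have w2 : r2.w = r'.w := by rw [hr2]
    have t2 : r2.t = t := by rw [hr2]
    refine wp_seq (wp_put W2 (stable_splitFile P) (by omega) ctx.adm.four_le
      (fun c h => splitG_inj P _ (by omega) c h) rfl (splitG_ne_input P _)
      (splitG_ne_output P _) ?_ ?_ ?_)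
    · rw [w2, t2, hw, slice_take (by omega)]
      refine ⟨?_, fun x hx => ctx.lt x (mem_of_mem_slice hx)⟩
      rw [slice_length (by rw [ctx.len]; omega)]; omega
    · rw [h0, hc, c2]
      have := splitW_length P X ps ls' 1
      simp only [List.flatten_nil, List.length_nil, addW, update_self, List.length_append,
        List.length_singleton]
      omega
    intro o3 k3 io3 β3 e3 r3 hr3 W3 he3 ok3
    have hw3 : [Cell.int r'.q] ++ [Cell.str (r2.w.take r2.t)] = litw X y := by
      rw [w2, t2, hw, slice_take (by omega)]; rfl
    rw [hc, c2, addW_addW, hw3, splitW_addLit] at W3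
    have q3 : r3.q = r'.q := by rw [hr3, hr2]
    have w3 : r3.w = r'.w := by rw [hr3, hr2]
    have t3 : r3.t = t := by rw [hr3, hr2]
    have c3 : r3.c = 1 := by rw [hr3]; exact c2
    refine wp_assign fun _ _ => ⟨{ ok3 with
      q := by dsimp only; omega
      w_len := by dsimp only; rw [List.length_drop]; have := ok3.w_len; omega
      w_lt := fun x hx => ok3.w_lt x (List.mem_of_mem_drop hx) }, l' - t, by simp only [id]; omega, ?_⟩
    have htot : tot 4 { r' with t := t } = tot 4 r' := rfl
    refine ⟨?_, c3, ?_, ?_, by omega, ls' ++ [y], ⟨?_, ?_, ?_, ?_, ?_, ?_⟩, ?_⟩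
    · dsimp only; rw [w3, t3, hw, q3, slice_drop]
    · exact hRd.congr (by dsimp only; rw [hr3, hr2]) (by dsimp only; rw [hr3, hr2])
    · dsimp only; omega
    · dsimp only
      rw [q3, t3]
      exact hI'.split.addLit hyOK rfl
    · dsimp only; omega
    · exact W3.congr rfl
    · dsimp only; rw [hr3, hr2]; exact hI'.Y
    · dsimp only; rw [hr3, hr2]; exact hI'.slots
    · have hc := hI'.cost
      have hrem : rem bl Slot.scan { r3 with q := r3.q + r3.t, w := r3.w.drop r3.t } =
        rem bl Slot.scan r' := by
        refine rem_congr ?_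
        rw [hr3, hr2]
      have htot' : tot 4 { r3 with q := r3.q + r3.t, w := r3.w.drop r3.t } = tot 4 r3 := rfl
      rw [hrem, htot', mul_add]
      rw [mul_add] at hc
      rw [htot] at he2
      simp only [List.length_append, List.length_singleton]
      omega
    · dsimp only
      rw [q3, t3, List.length_append, List.length_singleton, mod_add_min hyOK.seg]
      simp only [hy]
      split_ifs at hpot ⊢ <;> omega
  · rintro l' r' β' e' hr' hβ' ⟨hw, hc, hRd, hend, hld, ls', hI', hpot⟩ hl
    have hl : l' = 0 := by
      have hwl : r'.w.length = l' := by
        rw [hw]; exact slice_length (by rw [ctx.len]; omega)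
      rw [← hwl]
      simpa using hl
    exact hQ ls' r' β' e' hI' (by omega) hRd (by rw [if_pos hl] at hpot; omega)

end

theorem wp_rewind {P : Params} {s : Slot} {r : Ram} {β : Store} {e : ℕ}
    {Q : Ram → Store → ℕ → Prop}
    (hQ : ∀ r', r' = { r with inp := update r.inp s [], pos := update r.pos s 0 } → RamOK P r' →
      Q r' β e) :
    WP P (rewind s) r β e Q := by
  refine wp_assign fun hr _ => ?_
  have hr' : RamOK P { r with inp := update r.inp s [], pos := update r.pos s 0 } := by
    refine { hr with inp := fun s' => ?_, pos := fun s' => ?_ }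
    · by_cases hs : s' = s
      · subst hs; simp only [update_self]; exact ⟨by simp, by simp⟩
      · simp only [update_of_ne hs]; exact hr.inp s'
    · by_cases hs : s' = s
      · subst hs; simp
      · simp only [update_of_ne hs]; exact hr.pos s'
  exact ⟨hr', hQ _ rfl hr'⟩

theorem words_ne_nil (x : Item) : x.words ≠ [] := by cases x <;> simp [Item.words]

/-- Beyond the prepaid reading and the amortized writing there are one read past the end of the
input and the final flush of four buffers: `13 = 1 + 3 * 4`. -/
theorem wp_split {P : Params} {X : List ℕ} {β₀ : Store} {r : Ram} {e : ℕ}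
    {Q : Ram → Store → ℕ → Prop} {T : List Item} (ctx : Ctx P X)
    (h0 : ∀ c, β₀ (splitG P c) = []) (hT : ItemsFrom P.d X 0 T)
    (hbl : (β₀ File.input).flatten = T.flatMap Item.words)
    (hN : (β₀ File.input).length + 1 ≤ P.N)
    (hq : r.q = 0) (hout : r.out = fun _ => [])
    (hslots : ∀ s ≠ Slot.scan, r.inp s = [] ∧ r.pos s = 0)
    (hQ : ∀ ps ls r' β' e', Splitting P X P.n ps ls →
      P.b * ps.length ≤ 2 * P.n + 3 * P.b * reps T → ls.length ≤ 2 * runs T →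
      r'.out = (fun _ => []) → r'.Y = r.Y → (∀ s ≠ Slot.scan, r'.inp s = [] ∧ r'.pos s = 0) →
      (∀ c < 4, (β' (splitG P c)).flatten = splitW P X ps ls c) →
      (∀ F, (∀ c < 4, F ≠ splitG P c) → β' F = β₀ F) →
      (∀ c < 4, P.B * (β' (splitG P c)).length ≤ (splitW P X ps ls c).length + P.B) →
      P.B * e' ≤ P.B * (e + (β₀ File.input).length + 13) + 9 * ps.length + 6 * ls.length →
      Q r' β' e') :
    WP P P.split r β₀ e Q := by
  set bl := β₀ File.input with hbl'
  have hb := ctx.b_pos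
  refine wp_seq (wp_rewind ?_)
  intro r1 hr1 ok1
  let J : List Item → Ram → Store → ℕ → Prop := fun pre r' β' v => ∃ ps ls,
    SplitInv P X β₀ r.Y (P.B * (e + bl.length)) ps ls r' β' v ∧
    (∀ post, T = pre ++ post → ItemsFrom P.d X r'.q post) ∧
    P.b * ps.length ≤ 2 * r'.q + 3 * P.b * reps pre ∧ ls.length ≤ 2 * runs pre
  refine wp_seq (wp_whileMore (bl := bl) (a := 0) Item.words T J (fun x _ => words_ne_nil x) ?_ ?_ ?_ ?_
    hN ?_ ?_)
  · rintro pre r β v ⟨ps, ls, hI, -⟩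
    exact hI.input
  · rintro pre r β v y k io ⟨ps, ls, hI, h⟩
    refine ⟨ps, ls, hI.scan rfl rfl rfl fun s hs => ?_, h⟩
    simp [hs]
  · rw [← hbl]
    exact rd_start (by rw [hr1]; simp) (by rw [hr1]; simp)
  · have hrem : rem bl Slot.scan r1 = bl.length := by
      rw [rem, hr1]; simp
    have q1 : r1.q = 0 := by rw [hr1]; exact hq
    have o1 : r1.out = fun _ => [] := by rw [hr1]; exact hout
    refine ⟨[], [], ⟨?_, ?_, ?_, ?_, ?_, ?_⟩, ?_, ?_, ?_⟩
    · rw [q1]; exact splitting_nil P X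
    · rw [q1]; exact Nat.zero_le _
    · have : splitW P X [] [] = fun _ => [] := by
        funext c; simp [splitW, ofKind]
      rw [this]
      exact wr_start ctx.B_pos o1
    · rw [hr1]
    · intro s hs
      rw [hr1]
      simpa [hs] using hslots s hs
    · rw [tot_start o1, hrem]; simp
    · rintro post rfl
      rw [q1]; exact hT
    · simp [reps]
    · simp
  · rintro pre x post r2 β2 e2 hpre ⟨ps, ls, hI, hit, hps, hls⟩ hR hne ok2 _
    have hit := hit _ hpre
    -- The branch is chosen from the kind of the buffered word before anything is extracted, so that
    -- word is identified first.
    have hhead : ∃ u, r2.inp Slot.scan = x.words.head (words_ne_nil x) :: u := by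
      obtain ⟨z, u, hu⟩ := List.exists_cons_of_ne_nil hne
      have := hR.1
      rw [hu] at this
      refine ⟨u, ?_⟩
      rw [hu]
      cases x <;> simp only [Item.words, List.cons_append, List.cons.injEq] at this <;>
        rw [this.1] <;> rfl
    obtain ⟨u, hu⟩ := hhead
    cases x with
    | rep p l =>
      obtain ⟨g1, g2, g3, g4, g5⟩ := hit
      rw [ctx.len] at g3
      refine wp_cond (fun h => ?_) (fun _ => ?_)
      · simp [hu, Item.words, Cell.isStr] at h
      · refine wp_splitRep ctx h0 hbl'.symm (by omega) hI hR g2 g3 g4 ?_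
        intro ps' r' β' e' hI' hq' hR' hlen
        refine ⟨hR', ps', ls, hI', ?_, ?_, ?_⟩
        · intro post' hpost'
          have : post' = post := by
            rw [hpre, List.append_assoc, List.append_cancel_left_eq] at hpost'
            simpa using hpost'.symm
          rw [hq', this]; exact g5
        · rw [hq', reps_append]
          simp only [reps, mul_add, mul_one, mul_zero]
          omega
        · rw [runs_append]; simp only [runs]; omega
    | run s =>
      obtain ⟨g1, g2, g3, g4, g5⟩ := hit
      rw [ctx.len] at g3
      refine wp_cond (fun _ => ?_) (fun h => ?_)
      · refine wp_splitLits ctx h0 hbl'.symm (by omega) hI hR g2 g3 g4 ?_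
        intro ls' r' β' e' hI' hq' hR' hlen
        refine ⟨hR', ps, ls', hI', ?_, ?_, ?_⟩
        · intro post' hpost'
          have : post' = post := by
            rw [hpre, List.append_assoc, List.append_cancel_left_eq] at hpost'
            simpa using hpost'.symm
          rw [hq', this]; exact g5
        · rw [hq', reps_append]
          simp only [reps, mul_add, mul_zero]
          omega
        · rw [runs_append]; simp only [runs]; omega
      · simp [hu, Item.words, Cell.isStr] at h
  · rintro r2 β2 v e2 ok2 _ ⟨ps, ls, hI, hit, hps, hls⟩ hev _
    have hqn : r2.q = P.n := by
      have := hit [] (by simp)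
      rw [← ctx.len]; exact this
    have hlen := hI.split.length_le
    have hN' : P.N = 8 * P.n + 8 := rfl
    refine wp_flushAll hI.wr (stable_splitFile P) ctx.adm.four_le (splitG_inj P) ?_
      (fun c _ => splitG_ne_input P c) (fun c _ => splitG_ne_output P c) ctx.B_pos ?_ (by omega) ?_
    · rintro c _ r' _ _ _ rfl
      rfl
    · intro c _
      rw [h0]
      have := splitW_length P X ps ls c
      simp only [List.flatten_nil, List.length_nil]
      omega
    · intro c k io β' e' r' hr' _ _ hcont hframe hblocks he
      refine hQ ps ls r' β' e' (hqn ▸ hI.split) (by omega) hls (by rw [hr']) (by rw [hr']; exact hI.Y)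
        (by rw [hr']; exact hI.slots) ?_ hframe ?_ ?_
      · intro c hc
        rw [hcont c hc, h0]; simp
      · intro c hc
        have := hblocks c hc
        rw [h0] at this
        simpa using this
      · have hc := hI.cost
        have h1 : P.B * e' ≤ P.B * (v + 13) := Nat.mul_le_mul_left _ (by omega)
        rw [mul_add] at h1 ⊢
        omega

/-! Distribution of the far parts by their sources. -/

/-- The data that distribution does not change. -/
structure Keep (r r' : Ram) : Prop where
  Y : r'.Y = r.Y
  j : r'.j = r.j
  inp : ∀ s ≠ Slot.scan, r'.inp s = r.inp s
  pos : ∀ s ≠ Slot.scan, r'.pos s = r.pos s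

theorem Keep.refl (r : Ram) : Keep r r := ⟨rfl, rfl, fun _ _ => rfl, fun _ _ => rfl⟩

theorem Keep.trans {r r' r'' : Ram} (h : Keep r r') (h' : Keep r' r'') : Keep r r'' :=
  ⟨h'.Y.trans h.Y, h'.j.trans h.j, fun s hs => (h'.inp s hs).trans (h.inp s hs),
    fun s hs => (h'.pos s hs).trans (h.pos s hs)⟩

/-- The words of the parts in `T` that satisfy `g x = c`. -/
def distW (g : Part → ℕ) (enc : Part → List Cell) (T : List Part) (c : ℕ) : List Cell :=
  (T.filter fun x => g x = c).flatMap enc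

theorem distW_append (g : Part → ℕ) (enc : Part → List Cell) (T : List Part) (x : Part) :
    addW (distW g enc T) (g x) (enc x) = distW g enc (T ++ [x]) := by
  funext c
  by_cases hc : c = g x
  · subst hc
    simp [addW, distW, List.filter_append]
  · simp [addW, hc, distW, List.filter_append, Ne.symm hc]

theorem Params.Admissible.f_mul_B_le {P : Params} (h : P.Admissible) :
    (P.f + 5) * P.B + 15 ≤ P.m := by
  have h1 := h.fits
  have h2 := h.half
  unfold Params.ramWords at h1
  omega

theorem Ctx.f_le_m {P : Params} {X : List ℕ} (ctx : Ctx P X) : P.f ≤ P.m := by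
  have h1 := ctx.adm.f_mul_B_le
  have h2 : P.f * 1 ≤ P.f * P.B := Nat.mul_le_mul_left _ ctx.B_pos
  rw [add_mul] at h1
  omega

theorem Params.two_le_segs {P : Params} (hL : 0 < P.L) : 2 ≤ P.segs := by
  by_contra h
  have : P.L = 0 := Nat.clog_of_right_le_one (by omega) _
  omega

theorem Ctx.b_lt {P : Params} {X : List ℕ} (ctx : Ctx P X) (hL : 0 < P.L) : P.b < P.n := by
  have h1 := Params.two_le_segs hL
  have h2 := ctx.segs_mul_lt
  have h3 : 2 * P.b ≤ P.segs * P.b := Nat.mul_le_mul_right _ h1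
  omega

/-- If any distribution takes place there are at least two segments, and then `f ≤ m ≤ b < n`. This
keeps buffer numbers within `Params.N`. -/
theorem Ctx.f_le {P : Params} {X : List ℕ} (ctx : Ctx P X) (hL : 0 < P.L) : P.f ≤ P.n := by
  have h1 := ctx.b_lt hL
  have h2 := ctx.f_le_m
  have h3 : 1 * P.m ≤ P.d * P.m := Nat.mul_le_mul_right _ P.d_pos
  have h4 : P.b = P.d * P.m := rfl
  omega

theorem stable_R (P : Params) : Stable fun r => File.R (r.lev - 1) (r.i * P.f + r.c) := by
  intro r r' h1 h2 h3 h4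
  simp [h1, h2, h4]

theorem stable_R' : Stable fun r => File.R r.lev r.i := by
  intro r r' h1 h2 h3 h4
  simp [h1, h2]

theorem flatMap_length_filter_le {α β : Type*} (p : α → Bool) (enc : α → List β) (T : List α) :
    ((T.filter p).flatMap enc).length ≤ (T.flatMap enc).length := by
  induction T with
  | nil => simp
  | cons x T ih =>
    rw [List.filter_cons]
    split <;> simp only [List.flatMap_cons, List.length_append] <;> omega

/-- One scan, one read past the end, a flush of `f` buffers, and nine units for each rewritten
triple. -/
theorem wp_distributeR {P : Params} {X : List ℕ} {β₀ : Store} {r : Ram} {e : ℕ}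
    {Q : Ram → Store → ℕ → Prop} {T : List Part} (ctx : Ctx P X)
    (hlev : 0 < r.lev) (hf : P.f ≤ P.n)
    (hbl : (β₀ (File.R r.lev r.i)).flatten = T.flatMap trip) (hT : T.length ≤ P.n)
    (h0 : ∀ c < P.f, β₀ (File.R (r.lev - 1) (r.i * P.f + c)) = [])
    (hout : r.out = fun _ => [])
    (hQ : ∀ r' β' e', RamOK P r' → Keep r r' → r'.lev = r.lev → r'.i = r.i →
      r'.out = (fun _ => []) →
      (∀ c < P.f, (β' (File.R (r.lev - 1) (r.i * P.f + c))).flatten =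
        distW (fun x => x.p / P.b / P.f ^ (r.lev - 1) % P.f) trip T c) →
      (∀ c < P.f, P.B * (β' (File.R (r.lev - 1) (r.i * P.f + c))).length ≤
        (distW (fun x => x.p / P.b / P.f ^ (r.lev - 1) % P.f) trip T c).length + P.B) →
      (∀ F, (∀ c < P.f, F ≠ File.R (r.lev - 1) (r.i * P.f + c)) → β' F = β₀ F) →
      P.B * e' ≤ P.B * (e + (β₀ (File.R r.lev r.i)).length + 1 + 3 * P.f) + 9 * T.length →
      Q r' β' e') :
    WP P P.distributeR r β₀ e Q := by
  set bl := β₀ (File.R r.lev r.i) with hbl'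
  set g : Part → ℕ := fun x => x.p / P.b / P.f ^ (r.lev - 1) % P.f with hg
  set G : ℕ → File := fun c => File.R (r.lev - 1) (r.i * P.f + c) with hG
  have hN' : P.N = 8 * P.n + 8 := rfl
  have hf4 := ctx.adm.four_le
  have hGinj : ∀ c < P.f, ∀ c' < P.f, G c = G c' → c = c' := by
    intro c _ c' _ h
    simpa [hG] using h
  have hGi : ∀ c, G c ≠ File.input := by simp [hG]
  have hGo : ∀ c, G c ≠ File.output := by simp [hG]
  -- Since `0 < lev`, the levels `lev` and `lev - 1` differ: the sequence being read is never
  -- written.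
  have hGR : ∀ c, File.R r.lev r.i ≠ G c := by
    intro c h
    simp only [hG, File.R.injEq] at h
    omega
  have hWlen : ∀ pre c, (distW g trip pre c).length ≤ 3 * pre.length := by
    intro pre c
    rw [← flatMap_trip_length]
    exact flatMap_length_filter_le _ _ _
  refine WP.intro fun _ hβ0 => wp_seq (wp_rewind ?_)
  have hnb : bl.length ≤ 3 * P.n := by
    have := length_le_flatten fun y hy => (hβ0 (File.R r.lev r.i) y hy).1
    rw [← hbl', hbl, flatMap_trip_length] at this
    omega
  intro r1 hr1 ok1
  let J : List Part → Ram → Store → ℕ → Prop := fun pre r' β' v =>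
    Keep r r' ∧ r'.lev = r.lev ∧ r'.i = r.i ∧ Wr P P.f G β₀ (distW g trip pre) r' β' ∧
    P.B * v + 3 * tot P.f r' ≤ P.B * (e + bl.length) + 9 * pre.length
  refine wp_seq (wp_whileMore (bl := bl) (a := 0) trip T J (fun x _ => by simp [trip]) ?_ ?_ ?_ ?_
    (by omega) ?_ ?_)
  · rintro pre r' β v ⟨_, h1, h2, h3, _⟩
    rw [h1, h2]
    exact h3.frame _ fun c _ => hGR c
  · rintro pre r' β v y k io ⟨h1, h2, h3, h4, h5⟩
    refine ⟨h1.trans ⟨rfl, rfl, fun s hs => ?_, fun s hs => ?_⟩, h2, h3, h4.congr rfl, h5⟩ <;> simp [hs]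
  · rw [← hbl]
    exact rd_start (by rw [hr1]; simp) (by rw [hr1]; simp)
  · have hrem : rem bl Slot.scan r1 = bl.length := by
      rw [rem, hr1]; simp
    have o1 : r1.out = fun _ => [] := by rw [hr1]; exact hout
    refine ⟨⟨by rw [hr1], by rw [hr1], fun s hs => ?_, fun s hs => ?_⟩, by rw [hr1], by rw [hr1],
      wr_start ctx.B_pos o1, ?_⟩
    · rw [hr1]; simp [hs]
    · rw [hr1]; simp [hs]
    · rw [tot_start o1, hrem]; simp
  · rintro pre x post r2 β2 e2 hpre ⟨hk2, hl2, hi2, hW2, hc2⟩ hR _ ok2 _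
    have hF2 : β2 (File.R r2.lev r2.i) = bl := by
      rw [hl2, hi2]
      exact hW2.frame _ fun c _ => hGR c
    refine wp_seq (wp_nextTriple stable_R' hF2 hR (by omega) ?_)
    intro y k io e3 r3 hr3 R3 he3 ok3
    have hgx : r3.p / P.b / P.f ^ (r3.lev - 1) % P.f = g x := by
      rw [hr3]; simp only [hl2, hg]
    have hgf : g x < P.f := Nat.mod_lt _ (by omega)
    refine wp_seq (wp_assign fun _ _ => ?_)
    rw [hgx]
    refine ⟨{ ok3 with c := by dsimp only; omega }, ?_⟩
    have hlen : pre.length ≤ P.n := by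
      rw [hpre] at hT; simp at hT; omega
    have l3 : r3.lev = r.lev := by rw [hr3]; exact hl2
    have i3 : r3.i = r.i := by rw [hr3]; exact hi2
    have o3 : r3.out = r2.out := by rw [hr3]
    refine wp_putTriple (hW2.congr (r' := { r3 with c := g x }) o3) (stable_R P) hgf le_rfl
      (fun c h => hGinj _ hgf c h) ?_ (by simp) (by simp) ok3.l (fun _ h _ => h) ?_ ?_
    · simp only [hG, l3, i3]
    · simp only [hG]
      rw [h0 _ hgf]
      have := hWlen pre (g x)
      simp only [List.flatten_nil, List.length_nil]
      omega
    · intro o k' io' β4 e4 r4 hr4 W4 he4 ok4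
      have hw : [Cell.int r3.p, Cell.int r3.q, Cell.int r3.l] = trip x := by
        rw [hr3]; rfl
      dsimp only at W4
      rw [hw, distW_append] at W4
      have hpo : r4.pos = r3.pos := by rw [hr4]
      refine ⟨R3.congr (by rw [hr4]) (by rw [hr4]), hk2.trans ⟨?_, ?_, fun s hs => ?_, fun s hs => ?_⟩,
        ?_, ?_, W4, ?_⟩
      · rw [hr4, hr3]
      · rw [hr4, hr3]
      · rw [hr4, hr3]; simp [hs]
      · rw [hr4, hr3]; simp [hs]
      · rw [hr4]; exact l3
      · rw [hr4]; exact i3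
      · have hrem : rem bl Slot.scan r4 = rem bl Slot.scan r3 := rem_congr (by rw [hpo])
        have htot : tot P.f { r3 with c := g x } = tot P.f r2 := tot_congr o3
        rw [htot] at he4
        rw [hrem, mul_add]
        have he5 := congrArg (P.B * ·) he3
        simp only [mul_add] at he5 hc2 ⊢
        simp only [List.length_append, List.length_singleton]
        omega
  · rintro r2 β2 v e2 ok2 _ ⟨hk2, hl2, hi2, hW2, hc2⟩ hev _
    refine wp_flushAll hW2 (stable_R P) le_rfl hGinj ?_ (fun c _ => hGi c) (fun c _ => hGo c)
      ctx.B_pos ?_ (by omega) ?_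
    · rintro c _ r' h1 h2 _ rfl
      simp only [hG, h1, h2, hl2, hi2]
    · intro c hc
      simp only [hG]
      rw [h0 c hc]
      have := hWlen T c
      simp only [List.flatten_nil, List.length_nil]
      omega
    · intro c k io β' e' r' hr' ok' _ hcont hframe hblocks he
      refine hQ r' β' e' ok' (hk2.trans ⟨by rw [hr'], by rw [hr'], by rw [hr']; simp,
        by rw [hr']; simp⟩) (by rw [hr']; exact hl2) (by rw [hr']; exact hi2) (by rw [hr']) ?_ ?_
        hframe ?_
      · intro c hc
        have := hcont c hc
        simp only [hG] at this
        rw [this, h0 c hc]; simp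
      · intro c hc
        have := hblocks c hc
        simp only [hG] at this
        rw [h0 c hc] at this
        simpa using this
      · have h1 : P.B * e' ≤ P.B * (v + 1 + 3 * P.f) := Nat.mul_le_mul_left _ (by omega)
        simp only [mul_add] at h1 hc2 ⊢
        omega

theorem length_filter_lt_succ {α : Type*} (T : List α) (g : α → ℕ) (i : ℕ) :
    (T.filter fun x => g x < i + 1).length =
      (T.filter fun x => g x < i).length + (T.filter fun x => g x = i).length := by
  induction T with
  | nil => rfl
  | cons x T ih =>
    simp only [List.filter_cons, decide_eq_true_eq]
    split_ifs <;> simp only [List.length_cons, ih] <;> omega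

theorem filter_eq_nil_of {α : Type*} {T : List α} {p : α → Prop} [DecidablePred p]
    (h : ∀ x ∈ T, ¬ p x) : T.filter (fun x => p x) = [] := by
  rw [List.filter_eq_nil_iff]
  intro x hx
  simpa using h x hx

/-- The far parts with source in supersegment `i` of level `lev`. -/
def srcIn (P : Params) (lev i : ℕ) (T : List Part) : List Part :=
  T.filter fun x => x.p / P.b / P.f ^ lev = i

theorem div_pow_succ (a f l : ℕ) : a / f ^ (l + 1) = a / f ^ l / f := by
  rw [pow_succ, Nat.div_div_eq_div_mul]

/-- Supersegment numbers are prefixes of the base-`f` expansion of the segment number: the number at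
level `l + 1` and one further digit determine the number at level `l`. -/
theorem distW_srcIn (P : Params) (l i c : ℕ) (hc : c < P.f) (T : List Part) :
    distW (fun x => x.p / P.b / P.f ^ l % P.f) trip (srcIn P (l + 1) i T) c =
      (srcIn P l (i * P.f + c) T).flatMap trip := by
  unfold distW srcIn
  rw [List.filter_filter]
  congr 1
  refine List.filter_congr fun x _ => ?_
  dsimp only
  rw [div_pow_succ, ← Bool.decide_and, decide_eq_decide]
  generalize x.p / P.b / P.f ^ l = s
  have := Nat.div_add_mod s P.f
  constructor
  · rintro ⟨rfl, rfl⟩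
    rw [mul_comm]; omega
  · rintro rfl
    rw [mul_comm i, Nat.mul_add_mod, Nat.mod_eq_of_lt hc, Nat.mul_add_div (by omega),
      Nat.div_eq_of_lt hc]
    simp

/-- In each round a triple is read for three units and written for nine. A supersegment adds the
flush of `f` buffers, a partial input block and a read past the end, together `3 * f + 2`. The
number of supersegments of a level is simply bounded by the number of segments. -/
theorem wp_distributeAllR {P : Params} {X : List ℕ} {β₀ : Store} {r : Ram} {e : ℕ}
    {Q : Ram → Store → ℕ → Prop} {T : List Part} (ctx : Ctx P X)
    (hT : T.length ≤ P.n) (hTn : ∀ x ∈ T, x.p < P.n)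
    (hbl : (β₀ (File.R P.L 0)).flatten = T.flatMap trip)
    (hnb : P.B * (β₀ (File.R P.L 0)).length ≤ 3 * T.length + P.B)
    (h0 : ∀ l i, (l, i) ≠ (P.L, 0) → β₀ (File.R l i) = [])
    (hout : r.out = fun _ => [])
    (hQ : ∀ r' β' e', RamOK P r' → Keep r r' → r'.out = (fun _ => []) →
      (∀ i, (β' (File.R 0 i)).flatten = (srcIn P 0 i T).flatMap trip) →
      (∀ i, P.B * (β' (File.R 0 i)).length ≤ 3 * (srcIn P 0 i T).length + P.B) →
      (∀ F, (∀ l i, F ≠ File.R l i) → β' F = β₀ F) →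
      P.B * e' ≤ P.B * e + P.L * (12 * T.length + P.segs * (P.B * (3 * P.f + 2))) →
      Q r' β' e') :
    WP P P.distributeAllR r β₀ e Q := by
  have hN' : P.N = 8 * P.n + 8 := rfl
  have hf4 := ctx.adm.four_le
  have hLn := ctx.L_le
  set K := 12 * T.length + P.segs * (P.B * (3 * P.f + 2)) with hK
  have hsegs : ∀ x ∈ T, x.p / P.b < P.segs := fun x hx => ctx.lt_segs (hTn x hx)
  -- Supersegments that begin after the last segment contain no sources, so a round may stop there
  -- although the sequences are indexed by all natural numbers.
  have hsrc : ∀ l i, P.segs ≤ i * P.f ^ l → srcIn P l i T = [] := by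
    intro l i hi
    refine filter_eq_nil_of fun x hx h => ?_
    have h1 := hsegs x hx
    have h2 : x.p / P.b / P.f ^ l < i := by
      rw [Nat.div_lt_iff_lt_mul (pow_pos (by omega) _)]
      omega
    omega
  refine wp_seq (wp_assign fun hr _ => ⟨{ hr with lev := by dsimp only; omega }, ?_⟩)
  let Lev : ℕ → Ram → Store → Prop := fun l r' β' => Keep r r' ∧
    r'.out = (fun _ => []) ∧
    (∀ i, (β' (File.R l i)).flatten = (srcIn P l i T).flatMap trip) ∧
    (∀ i, P.B * (β' (File.R l i)).length ≤ 3 * (srcIn P l i T).length + P.B) ∧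
    (∀ F, (∀ l i, F ≠ File.R l i) → β' F = β₀ F)
  let I : ℕ → Ram → Store → ℕ → Prop := fun l r' β' e' => r'.lev = l ∧ l ≤ P.L ∧ Lev l r' β' ∧
    (∀ l' < l, ∀ i, β' (File.R l' i) = []) ∧ P.B * e' + l * K ≤ P.B * e + P.L * K
  refine wp_loop I id P.L ⟨rfl, le_rfl, ⟨⟨rfl, rfl, fun _ _ => rfl, fun _ _ => rfl⟩, hout, ?_, ?_,
    fun _ _ => rfl⟩, ?_, le_rfl⟩ ?_ ?_
  · intro i
    have hall : ∀ x ∈ T, x.p / P.b / P.f ^ P.L = 0 := fun x hx =>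
      Nat.div_eq_of_lt ((hsegs x hx).trans_le ctx.f_pow_L)
    rcases Nat.eq_zero_or_pos i with rfl | hi
    · rw [hbl]
      congr 1
      symm
      refine List.filter_eq_self.2 fun x hx => ?_
      simpa using hall x hx
    · rw [h0 _ _ (by simp; omega), srcIn, filter_eq_nil_of fun x hx h => ?_]
      · rfl
      · have := hall x hx; omega
  · intro i
    rcases Nat.eq_zero_or_pos i with rfl | hi
    · have hall : ∀ x ∈ T, x.p / P.b / P.f ^ P.L = 0 := fun x hx =>
        Nat.div_eq_of_lt ((hsegs x hx).trans_le ctx.f_pow_L)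
      have : srcIn P P.L 0 T = T := by
        refine List.filter_eq_self.2 fun x hx => ?_
        simpa using hall x hx
      rw [this]; exact hnb
    · rw [h0 _ _ (by simp; omega)]; simp
  · intro l hl i
    exact h0 _ _ (by simp; omega)
  · rintro l r1 β1 e1 _ _ ⟨rfl, hlL, hLev, hlow, hcost⟩ hl
    have hl : 0 < r1.lev := by simpa using hl
    obtain ⟨l, hl'⟩ : ∃ l, r1.lev = l + 1 := ⟨r1.lev - 1, by omega⟩
    have hf := ctx.f_le (by omega)
    rw [hl'] at hLev hlow hcost
    refine wp_seq (wp_assign fun hr _ => ⟨{ hr with i := by dsimp only; omega }, ?_⟩)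
    -- For a sequence of level `l` with number `i`, the quotient `i / P.f` is the number of its
    -- parent: children of processed parents are complete, all others are still empty.
    let I' : ℕ → Ram → Store → ℕ → Prop := fun n r' β' e' => n = P.segs - r'.i ∧ r'.i ≤ P.segs ∧
      r'.lev = l + 1 ∧
      Lev (l + 1) r' β' ∧ (∀ l' < l, ∀ i, β' (File.R l' i) = []) ∧
      (∀ i, i / P.f < r'.i → (β' (File.R l i)).flatten = (srcIn P l i T).flatMap trip ∧
        P.B * (β' (File.R l i)).length ≤ 3 * (srcIn P l i T).length + P.B) ∧
      (∀ i, r'.i ≤ i / P.f → β' (File.R l i) = []) ∧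
      P.B * e' + (l + 1) * K ≤ P.B * e + P.L * K +
        12 * (T.filter fun x => x.p / P.b / P.f ^ (l + 1) < r'.i).length +
        r'.i * (P.B * (3 * P.f + 2))
    refine wp_seq (wp_loop I' id P.segs ⟨by simp, by simp, hl', ⟨hLev.1.trans ⟨rfl, rfl, fun _ _ => rfl, fun _ _ => rfl⟩, hLev.2⟩, fun l' h => hlow l' (by omega),
      fun i h => absurd h (by simp), fun i _ => hlow l (by omega) i, by simpa using hcost⟩ ?_ ?_)
    · rintro n r2 β2 e2 ok2 _ ⟨rfl, _, hl2, ⟨hk2, hout2, hc2, hb2, hf2⟩, hlow2, hdone2, htodo2, hcost2⟩ hb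
      have hlt : r2.i < P.segs := by
        have : 1 ≤ P.f ^ r2.lev := Nat.one_le_pow _ _ (by omega)
        have h1 : r2.i * 1 ≤ r2.i * P.f ^ r2.lev := Nat.mul_le_mul_left _ this
        have h2 : r2.i * P.f ^ r2.lev < P.segs := by simpa using hb
        omega
      have hsn := ctx.segs_le
      refine wp_seq (wp_distributeR (T := srcIn P (l + 1) r2.i T) ctx (by omega) hf
        (by rw [hl2]; exact hc2 _) ((List.length_filter_le _ _).trans hT) ?_ hout2 ?_)
      · intro c hc
        rw [hl2]
        apply htodo2
        rw [mul_comm, Nat.mul_add_div (by omega), Nat.div_eq_of_lt hc]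
        simp
      · rw [hl2]
        simp only [Nat.add_sub_cancel]
        intro r3 β3 e3 ok3 hk3 hl3 hi3 hout3 hcont hblocks hframe hcost3
        refine wp_assign fun _ _ => ⟨{ ok3 with i := by dsimp only; omega }, P.segs - (r3.i + 1),
          by simp only [id]; omega, rfl, by dsimp only; omega, hl3, ⟨?_, hout3, ?_, ?_, ?_⟩,
          ?_, ?_, ?_, ?_⟩
        · exact hk2.trans (hk3.trans ⟨rfl, rfl, fun _ _ => rfl, fun _ _ => rfl⟩)
        · intro i
          rw [hframe _ (fun c _ => by simp)]
          exact hc2 i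
        · intro i
          rw [hframe _ (fun c _ => by simp)]
          exact hb2 i
        · intro F hF
          rw [hframe _ (fun c _ => hF _ _)]
          exact hf2 F hF
        · intro l' hl' i
          rw [hframe _ (fun c _ => by simp; omega)]
          exact hlow2 l' hl' i
        · intro i hi
          dsimp only at hi
          have hdm := Nat.div_add_mod i P.f
          have hm := Nat.mod_lt i (show 0 < P.f by omega)
          rcases Nat.lt_or_ge (i / P.f) r2.i with h | h
          · rw [hframe _ (fun c hc h' => ?_)]
            · exact hdone2 i h
            · simp only [File.R.injEq, true_and] at h'
              rw [h', mul_comm, Nat.mul_add_div (by omega), Nat.div_eq_of_lt hc] at h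
              omega
          · have hieq : i = r2.i * P.f + i % P.f := by
              have : i / P.f = r2.i := by omega
              rw [this, mul_comm] at hdm
              exact hdm.symm
            have g1 := hcont _ hm
            have g2 := hblocks _ hm
            rw [distW_srcIn _ _ _ _ hm, ← hieq] at g1 g2
            rw [flatMap_trip_length] at g2
            exact ⟨g1, g2⟩
        · intro i hi
          dsimp only at hi
          rw [hframe _ (fun c hc h' => ?_)]
          · exact htodo2 i (by omega)
          · simp only [File.R.injEq, true_and] at h'
            rw [h', mul_comm, Nat.mul_add_div (by omega), Nat.div_eq_of_lt hc] at hi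
            omega
        · dsimp only
          rw [hi3, length_filter_lt_succ]
          have g1 := hb2 r2.i
          have g2 : (T.filter fun x => x.p / P.b / P.f ^ (l + 1) = r2.i).length =
            (srcIn P (l + 1) r2.i T).length := rfl
          rw [g2]
          have e1 : P.B * (3 * P.f + 2) = P.B * (3 * P.f) + 2 * P.B := by ring
          generalize P.B * (3 * P.f + 2) = D at e1 hcost2 ⊢
          simp only [mul_add, mul_one] at hcost3
          rw [add_mul r2.i, one_mul]
          omega
    · rintro n r2 β2 e2 ok2 _ ⟨rfl, hile, hl2, ⟨hk2, hout2, hc2, hb2, hf2⟩, hlow2, hdone2, htodo2, hcost2⟩ hb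
      have hge : P.segs ≤ r2.i * P.f ^ (l + 1) := by
        rw [← hl2]; simpa using hb
      have hge' : ∀ i, r2.i ≤ i / P.f → srcIn P l i T = [] := by
        intro i hi
        apply hsrc
        refine hge.trans ?_
        rw [pow_succ']
        calc r2.i * (P.f * P.f ^ l) ≤ i / P.f * (P.f * P.f ^ l) := Nat.mul_le_mul_right _ hi
          _ = i / P.f * P.f * P.f ^ l := by ring
          _ ≤ i * P.f ^ l := Nat.mul_le_mul_right _ (Nat.div_mul_le_self _ _)
      refine wp_assign fun _ _ => ⟨{ ok2 with lev := by dsimp only; have := ok2.lev; omega }, l,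
        by simp only [id]; omega, by dsimp only; omega, by omega,
        ⟨?_, hout2, ?_, ?_, hf2⟩, hlow2, ?_⟩
      · exact hk2.trans ⟨rfl, rfl, fun _ _ => rfl, fun _ _ => rfl⟩
      · intro i
        rcases Nat.lt_or_ge (i / P.f) r2.i with h | h
        · exact (hdone2 i h).1
        · rw [htodo2 i h, hge' i h]; rfl
      · intro i
        rcases Nat.lt_or_ge (i / P.f) r2.i with h | h
        · exact (hdone2 i h).2
        · rw [htodo2 i h]; simp
      · have g1 : (T.filter fun x => x.p / P.b / P.f ^ (l + 1) < r2.i).length ≤ T.length :=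
          List.length_filter_le _ _
        have g2 : r2.i * (P.B * (3 * P.f + 2)) ≤ P.segs * (P.B * (3 * P.f + 2)) :=
          Nat.mul_le_mul_right _ hile
        rw [add_mul, one_mul] at hcost2
        omega
  · rintro l r1 β1 e1 ok1 _ ⟨rfl, hlL, ⟨hk, hout1, hc, hb, hf⟩, hlow, hcost⟩ hl
    have hl : r1.lev = 0 := by simpa using hl
    rw [hl] at hc hb hcost
    exact hQ r1 β1 e1 ok1 (Keep.trans ⟨rfl, rfl, fun _ _ => rfl, fun _ _ => rfl⟩ hk) hout1 hc hb hf
      (by omega)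

/-! Distribution of the queues. -/

theorem pack_nil {d : ℕ} (hd : 1 ≤ d) : pack d [] = [] := by
  have : (0 + d - 1) / d = 0 := Nat.div_eq_of_lt (by omega)
  rw [pack, List.length_nil, this]; rfl

/-- One iteration of the copying loops handles one packed word; peeling off the first word is the
matching recursion. -/
theorem pack_of_ne_nil {d : ℕ} (hd : 1 ≤ d) {s : List ℕ} (hs : s ≠ []) :
    pack d s = Cell.str (s.take d) :: pack d (s.drop d) := by
  have hs' := List.length_pos_iff.2 hs
  have h : (s.length + d - 1) / d = ((s.drop d).length + d - 1) / d + 1 := by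
    rw [List.length_drop, ← Nat.add_div_right _ (by omega)]
    rcases Nat.lt_or_ge s.length d with h | h
    · have h1 : s.length + d - 1 = (s.length - 1) + d := by omega
      have h2 : s.length - d + d - 1 + d = (d - 1) + d := by omega
      rw [h1, h2, Nat.add_div_right _ (by omega), Nat.add_div_right _ (by omega),
        Nat.div_eq_of_lt (by omega), Nat.div_eq_of_lt (by omega)]
    · congr 1; omega
  unfold pack
  rw [h, List.range_succ_eq_map, List.map_cons, List.map_map]
  simp only [zero_mul, List.drop_zero, List.cons.injEq, true_and]
  refine List.map_congr_left fun t _ => ?_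
  simp only [comp_apply, Nat.succ_eq_add_one, List.drop_drop, add_mul, one_mul]
  rw [add_comm]

theorem pack_length (d : ℕ) (s : List ℕ) : (pack d s).length = (s.length + d - 1) / d := by
  simp [pack]

/-- The entry of a part in a queue. -/
def qenc (P : Params) (X : List ℕ) (x : Part) : List Cell :=
  Cell.int x.q :: Cell.int x.l :: pack P.d (slice X x.q x.l)

theorem ceil_le {d : ℕ} (hd : 1 ≤ d) (l : ℕ) : (l + d - 1) / d ≤ l := by
  rcases Nat.eq_zero_or_pos l with rfl | hl
  · rw [Nat.div_eq_of_lt (by omega)]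
  · refine Nat.div_le_of_le_mul ?_
    obtain ⟨d, rfl⟩ : ∃ k, d = k + 1 := ⟨d - 1, by omega⟩
    have : d * 1 ≤ d * l := Nat.mul_le_mul_left _ hl
    rw [add_mul]
    omega

theorem qenc_length {P : Params} {X : List ℕ} {x : Part} (ctx : Ctx P X) (h : PartOK P X x) :
    (qenc P X x).length = 2 + (x.l + P.d - 1) / P.d := by
  have : (slice X x.q x.l).length = x.l := slice_length (by rw [ctx.len]; exact h.le)
  simp only [qenc, List.length_cons, pack_length, this]
  omega

theorem qenc_length_le {P : Params} {X : List ℕ} {x : Part} (ctx : Ctx P X) (h : PartOK P X x) :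
    (qenc P X x).length ≤ 3 * x.l := by
  rw [qenc_length ctx h]
  have := ceil_le P.d_pos x.l
  have := h.pos
  omega

/-- Two integers, the packed string, and less than one word lost by rounding. The factor `d` keeps
the estimate free of division. -/
theorem d_mul_qenc_length_le {P : Params} {X : List ℕ} {x : Part} (ctx : Ctx P X)
    (h : PartOK P X x) : P.d * (qenc P X x).length ≤ 3 * P.d + x.l := by
  rw [qenc_length ctx h, mul_add]
  have := Nat.mul_div_le (x.l + P.d - 1) P.d
  omega

theorem stable_Q (P : Params) : Stable fun r => File.Q (r.lev - 1) (r.i * P.f + r.c) := by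
  intro r r' h1 h2 h3 h4
  simp [h1, h2, h4]

theorem distW_length_le (g : Part → ℕ) (enc : Part → List Cell) (T : List Part) (c : ℕ) :
    (distW g enc T c).length ≤ (T.flatMap enc).length := flatMap_length_filter_le _ _ _

/-- As in `wp_distributeR`, but entries have variable length: the inner loop copies the string word
by word and recognizes its end from the remaining length. Every word written costs three units. -/
theorem wp_distributeQ {P : Params} {X : List ℕ} {β₀ : Store} {r : Ram} {e : ℕ}
    {Q : Ram → Store → ℕ → Prop} {T : List Part} (ctx : Ctx P X)
    (hlev : 0 < r.lev) (hf : P.f ≤ P.n) (hTok : ∀ x ∈ T, PartOK P X x)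
    (hbl : (β₀ (File.Q r.lev r.i)).flatten = T.flatMap (qenc P X))
    (hT : (T.flatMap (qenc P X)).length ≤ 3 * P.n)
    (h0 : ∀ c < P.f, β₀ (File.Q (r.lev - 1) (r.i * P.f + c)) = [])
    (hout : r.out = fun _ => [])
    (hQ : ∀ r' β' e', RamOK P r' → Keep r r' → r'.lev = r.lev → r'.i = r.i →
      r'.out = (fun _ => []) →
      (∀ c < P.f, (β' (File.Q (r.lev - 1) (r.i * P.f + c))).flatten =
        distW (fun x => x.q / P.b / P.f ^ (r.lev - 1) % P.f) (qenc P X) T c) →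
      (∀ c < P.f, P.B * (β' (File.Q (r.lev - 1) (r.i * P.f + c))).length ≤
        (distW (fun x => x.q / P.b / P.f ^ (r.lev - 1) % P.f) (qenc P X) T c).length + P.B) →
      (∀ F, (∀ c < P.f, F ≠ File.Q (r.lev - 1) (r.i * P.f + c)) → β' F = β₀ F) →
      P.B * e' ≤ P.B * (e + (β₀ (File.Q r.lev r.i)).length + 1 + 3 * P.f) +
        3 * (T.flatMap (qenc P X)).length →
      Q r' β' e') :
    WP P P.distributeQ r β₀ e Q := by
  set bl := β₀ (File.Q r.lev r.i) with hbl'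
  set g : Part → ℕ := fun x => x.q / P.b / P.f ^ (r.lev - 1) % P.f with hg
  set G : ℕ → File := fun c => File.Q (r.lev - 1) (r.i * P.f + c) with hG
  have hN' : P.N = 8 * P.n + 8 := rfl
  have hf4 := ctx.adm.four_le
  have hGinj : ∀ c < P.f, ∀ c' < P.f, G c = G c' → c = c' := by
    intro c _ c' _ h
    simpa [hG] using h
  have hGi : ∀ c, G c ≠ File.input := by simp [hG]
  have hGo : ∀ c, G c ≠ File.output := by simp [hG]
  have hGR : ∀ c, File.Q r.lev r.i ≠ G c := by
    intro c h
    simp only [hG, File.Q.injEq] at h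
    omega
  refine WP.intro fun _ hβ0 => wp_seq (wp_rewind ?_)
  have hnb : bl.length ≤ 3 * P.n := by
    have := length_le_flatten fun y hy => (hβ0 (File.Q r.lev r.i) y hy).1
    rw [← hbl', hbl] at this
    omega
  intro r1 hr1 ok1
  let J : List Part → Ram → Store → ℕ → Prop := fun pre r' β' v =>
    Keep r r' ∧ r'.lev = r.lev ∧ r'.i = r.i ∧ Wr P P.f G β₀ (distW g (qenc P X) pre) r' β' ∧
    P.B * v + 3 * tot P.f r' ≤ P.B * (e + bl.length) + 3 * (pre.flatMap (qenc P X)).length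
  refine wp_seq (wp_whileMore (bl := bl) (a := 0) (qenc P X) T J (fun x _ => by simp [qenc])
    ?_ ?_ ?_ ?_ (by omega) ?_ ?_)
  · rintro pre r' β' v ⟨_, h1, h2, h3, _⟩
    rw [h1, h2]
    exact h3.frame _ fun c _ => hGR c
  · rintro pre r' β v y k io ⟨h1, h2, h3, h4, h5⟩
    refine ⟨h1.trans ⟨rfl, rfl, fun s hs => ?_, fun s hs => ?_⟩, h2, h3, h4.congr rfl, h5⟩ <;> simp [hs]
  · rw [← hbl]
    exact rd_start (by rw [hr1]; simp) (by rw [hr1]; simp)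
  · have hrem : rem bl Slot.scan r1 = bl.length := by
      rw [rem, hr1]; simp
    have o1 : r1.out = fun _ => [] := by rw [hr1]; exact hout
    refine ⟨⟨by rw [hr1], by rw [hr1], fun s hs => ?_, fun s hs => ?_⟩, by rw [hr1], by rw [hr1],
      wr_start ctx.B_pos o1, ?_⟩
    · rw [hr1]; simp [hs]
    · rw [hr1]; simp [hs]
    · rw [tot_start o1, hrem]; simp
  · rintro pre x post r2 β2 e2 hpre ⟨hk2, hl2, hi2, hW2, hc2⟩ hR _ ok2 _
    have hxok := hTok x (by simp [hpre])
    have hxlen : (pre.flatMap (qenc P X)).length + (qenc P X x).length ≤ 3 * P.n := by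
      rw [hpre, List.flatMap_append, List.flatMap_cons, List.length_append,
        List.length_append] at hT
      omega
    have hF : ∀ r' β', r'.lev = r.lev → r'.i = r.i → ∀ W, Wr P P.f G β₀ W r' β' →
        β' (File.Q r'.lev r'.i) = bl := by
      intro r' β' h1 h2 W hW
      rw [h1, h2]
      exact hW.frame _ fun c _ => hGR c
    have hgf : g x < P.f := Nat.mod_lt _ (by omega)
    refine wp_seq (wp_next (hF _ _ hl2 hi2 _ hW2) hR (by omega) ?_)
    intro y3 k3 io3 e3 r3 hr3 ok3 hx3 R3 he3
    refine ⟨{ ok3 with q := hx3 }, ?_⟩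
    have l3 : r3.lev = r.lev := by rw [hr3]; exact hl2
    have i3 : r3.i = r.i := by rw [hr3]; exact hi2
    have W3 := hW2.congr (r' := { r3 with q := x.q }) (show r3.out = r2.out by rw [hr3])
    refine wp_seq (wp_next (bl := bl) (a := 0) (x := Cell.int x.l) (hF _ _ l3 i3 _ W3)
      (R3.congr rfl rfl) (by omega) ?_)
    intro y4 k4 io4 e4 r4 hr4 ok4 hx4 R4 he4
    have l4 : r4.lev = r.lev := by rw [hr4]; exact l3
    have i4 : r4.i = r.i := by rw [hr4]; exact i3
    have q4 : r4.q = x.q := by rw [hr4]; rfl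
    refine ⟨{ ok4 with l := hx4 }, wp_seq (wp_assign fun _ _ => ?_)⟩
    have hgx : r4.q / P.b / P.f ^ (r4.lev - 1) % P.f = g x := by
      rw [q4, l4]
    dsimp only
    rw [hgx]
    refine ⟨{ ok4 with l := hx4, c := by dsimp only; omega }, ?_⟩
    set r4' : Ram := { r4 with l := (Cell.int x.l).val, c := g x } with hr4'
    have o4 : r4'.out = r2.out := by rw [hr4', hr4, hr3]
    have lx : r4'.l = x.l := rfl
    have c4 : r4'.c = g x := rfl
    have hdl : ∀ c, (β₀ (G (g x))).flatten.length + (distW g (qenc P X) pre c).length ≤ 3 * P.n := by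
      intro c
      simp only [hG]
      rw [h0 _ hgf]
      have := distW_length_le g (qenc P X) pre c
      simp only [List.flatten_nil, List.length_nil]
      omega
    have hGc : ∀ c' < P.f, G (g x) = G c' → g x = c' := fun c h => hGinj _ hgf c h
    refine wp_seq (wp_put (hW2.congr o4) (stable_Q P) hgf le_rfl hGc
      (by simp only [hG, hr4', l4, i4]) (by simp) (by simp) ok4.q ?_ ?_)
    · have := hdl (g x); rw [c4]; omega
    intro o5 k5 io5 β5 e5 r5 hr5 W5 he5 ok5
    have l5 : r5.lev = r.lev := by rw [hr5]; exact l4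
    have i5 : r5.i = r.i := by rw [hr5]; exact i4
    have c5 : r5.c = g x := by rw [hr5]
    rw [c4] at W5
    refine wp_seq (wp_put W5 (stable_Q P) (by rw [c5]; exact hgf) le_rfl (by rw [c5]; exact hGc)
      (by simp only [hG, c5, l5, i5]) (by simp) (by simp) ok5.l ?_ ?_)
    · have := hdl (g x)
      rw [c5]
      simp only [addW, update_self, List.length_append, List.length_singleton]
      omega
    intro o6 k6 io6 β6 e6 r6 hr6 W6 he6 ok6
    have l6 : r6.lev = r.lev := by rw [hr6]; exact l5
    have i6 : r6.i = r.i := by rw [hr6]; exact i5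
    have c6 : r6.c = g x := by rw [hr6]; exact c5
    have x6 : r6.l = x.l := by rw [hr6, hr5]; exact lx
    rw [c5, addW_addW] at W6
    have hq5 : r4'.q = x.q := q4
    have hl5 : r5.l = x.l := by rw [hr5]; exact lx
    rw [hq5, hl5] at W6
    -- `s` is the string still to be copied and `wr` the words of the entry already written.
    -- Together they always form the whole entry, so that `distW_append` applies when `s` is empty.
    let I : List ℕ → Ram → Store → ℕ → Prop := fun s r' β' e' => r'.l = s.length ∧
      r'.lev = r.lev ∧ r'.i = r.i ∧ r'.c = g x ∧ Keep r r' ∧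
      Rd bl Slot.scan 0 r' (pack P.d s ++ post.flatMap (qenc P X)) ∧
      ∃ wr, wr ++ pack P.d s = qenc P X x ∧
        Wr P P.f G β₀ (addW (distW g (qenc P X) pre) (g x) wr) r' β' ∧
        P.B * (e' + rem bl Slot.scan r') + 3 * tot P.f r' ≤ P.B * (e + bl.length) +
          3 * (pre.flatMap (qenc P X)).length + 3 * wr.length
    have hslen : (slice X x.q x.l).length = x.l := slice_length (by rw [ctx.len]; exact hxok.le)
    refine wp_loop I List.length (slice X x.q x.l) ⟨by rw [x6, hslen], l6, i6, c6, ?_,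
      R4.congr (by rw [hr6, hr5]) (by rw [hr6, hr5]), _, rfl, W6, ?_⟩ ?_ ?_
    · refine hk2.trans ⟨?_, ?_, fun s hs => ?_, fun s hs => ?_⟩ <;>
        rw [hr6, hr5, hr4', hr4, hr3] <;> simp [hs]
    · have hrem : rem bl Slot.scan r6 = rem bl Slot.scan r4 := rem_congr (by rw [hr6, hr5])
      have htot : tot P.f r4' = tot P.f r2 := tot_congr o4
      have hrem3 : rem bl Slot.scan { r3 with q := (Cell.int x.q).val } = rem bl Slot.scan r3 := rfl
      rw [htot] at he5
      rw [hrem3] at he4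
      rw [hrem, mul_add]
      have he7 := congrArg (P.B * ·) he4
      have he8 := congrArg (P.B * ·) he3
      simp only [mul_add] at he7 he8 hc2 ⊢
      simp only [List.length_append, List.length_singleton]
      omega
    · rintro s r7 β7 e7 ok7 _ ⟨hl7, l7, i7, c7, hk7, R7, wr, hwr, W7, hc7⟩ hb
      have hspos : 0 < s.length := by
        rw [← hl7]; simpa using hb
      have hsne := List.length_pos_iff.1 hspos
      rw [pack_of_ne_nil P.d_pos hsne] at R7 hwr
      have hwlen := congrArg List.length hwr
      simp only [List.length_append, List.length_cons] at hwlen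
      refine wp_seq (wp_next (hF _ _ l7 i7 _ W7) R7 (by omega) ?_)
      intro y8 k8 io8 e8 r8 hr8 ok8 hx8 R8 he8
      have ok8' : RamOK P { r8 with w := (Cell.str (s.take P.d)).syms } :=
        { ok8 with w_len := hx8.1, w_lt := hx8.2 }
      refine ⟨ok8', ?_⟩
      have l8 : r8.lev = r.lev := by rw [hr8]; exact l7
      have i8 : r8.i = r.i := by rw [hr8]; exact i7
      have c8 : r8.c = g x := by rw [hr8]; exact c7
      have o8 : r8.out = r7.out := by rw [hr8]
      refine wp_seq (wp_put (W7.congr (r' := { r8 with w := (Cell.str (s.take P.d)).syms }) o8)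
        (stable_Q P) (by dsimp only; rw [c8]; exact hgf) le_rfl
        (by dsimp only; rw [c8]; exact hGc)
        (by simp only [hG, c8, l8, i8]) (by simp) (by simp) ⟨ok8'.w_len, ok8'.w_lt⟩ ?_ ?_)
      · have := hdl (g x)
        dsimp only
        rw [c8]
        simp only [addW, update_self, List.length_append]
        simp only [hG] at this ⊢
        rw [h0 _ hgf] at *
        have h1 := distW_length_le g (qenc P X) pre (g x)
        simp only [List.flatten_nil, List.length_nil]
        omega
      intro o9 k9 io9 β9 e9 r9 hr9 W9 he9 ok9
      dsimp only at W9
      rw [c8, addW_addW] at W9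
      have l9 : r9.l = s.length := by rw [hr9, hr8]; exact hl7
      refine wp_assign fun _ _ => ⟨{ ok9 with l := by dsimp only; have := ok9.l; omega }, s.drop P.d, ?_,
        ?_, ?_, ?_, ?_, ?_, ?_, wr ++ [Cell.str (s.take P.d)], ?_, ?_, ?_⟩
      · rw [List.length_drop]; have := P.d_pos; omega
      · dsimp only; rw [List.length_drop, l9]
      · dsimp only; rw [hr9]; exact l8
      · dsimp only; rw [hr9]; exact i8
      · dsimp only; rw [hr9]; exact c8
      · refine hk7.trans ⟨?_, ?_, fun s hs => ?_, fun s hs => ?_⟩ <;> dsimp only <;>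
          rw [hr9, hr8] <;> simp [hs]
      · exact R8.congr (by dsimp only; rw [hr9]) (by dsimp only; rw [hr9])
      · rw [← hwr]; simp
      · exact W9.congr rfl
      · have hrem : rem bl Slot.scan { r9 with l := r9.l - P.d } = rem bl Slot.scan r8 :=
          rem_congr (by dsimp only; rw [hr9])
        have htot : tot P.f { r8 with w := (Cell.str (s.take P.d)).syms } = tot P.f r7 :=
          tot_congr o8
        have htot' : tot P.f { r9 with l := r9.l - P.d } = tot P.f r9 := rfl
        rw [htot] at he9
        rw [hrem, htot', mul_add]
        have he10 := congrArg (P.B * ·) he8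
        simp only [mul_add] at he10 hc7 ⊢
        simp only [List.length_append, List.length_singleton]
        omega
    · rintro s r7 β7 e7 ok7 _ ⟨hl7, l7, i7, c7, hk7, R7, wr, hwr, W7, hc7⟩ hb
      have hs : s = [] := by
        rw [← List.length_eq_zero_iff, ← hl7]
        simpa using hb
      subst hs
      rw [pack_nil P.d_pos] at R7 hwr
      rw [List.append_nil] at hwr
      subst hwr
      rw [distW_append] at W7
      refine ⟨R7, hk7, l7, i7, W7, ?_⟩
      rw [List.flatMap_append, List.length_append, List.flatMap_singleton]
      omega
  · rintro r2 β2 v e2 ok2 _ ⟨hk2, hl2, hi2, hW2, hc2⟩ hev _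
    refine wp_flushAll hW2 (stable_Q P) le_rfl hGinj ?_ (fun c _ => hGi c) (fun c _ => hGo c)
      ctx.B_pos ?_ (by omega) ?_
    · rintro c _ r' h1 h2 _ rfl
      simp only [hG, h1, h2, hl2, hi2]
    · intro c hc
      simp only [hG]
      rw [h0 c hc]
      have := distW_length_le g (qenc P X) T c
      simp only [List.flatten_nil, List.length_nil]
      omega
    · intro c k io β' e' r' hr' ok' _ hcont hframe hblocks he
      refine hQ r' β' e' ok' (hk2.trans ⟨by rw [hr'], by rw [hr'], by rw [hr']; simp,
        by rw [hr']; simp⟩) (by rw [hr']; exact hl2) (by rw [hr']; exact hi2) (by rw [hr']) ?_ ?_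
        hframe ?_
      · intro c hc
        have := hcont c hc
        simp only [hG] at this
        rw [this, h0 c hc]; simp
      · intro c hc
        have := hblocks c hc
        simp only [hG] at this
        rw [h0 c hc] at this
        simpa using this
      · have h1 : P.B * e' ≤ P.B * (v + 1 + 3 * P.f) := Nat.mul_le_mul_left _ (by omega)
        simp only [mul_add] at h1 hc2 ⊢
        omega

/-! ### Contents of the queues and the cost of opening them. -/

/-- The queue of supersegment `i` of level `l` holds the parts of `T` that satisfy `S`, in some
order, and has been appended to in `k` passes. -/
def QSt (P : Params) (X : List ℕ) (T : List Part) (β : Store) (l i : ℕ) (S : Part → Bool)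
    (k : ℕ) : Prop :=
  ∃ ts : List Part, ts.Perm (T.filter S) ∧ (β (File.Q l i)).flatten = ts.flatMap (qenc P X) ∧
    P.B * (β (File.Q l i)).length ≤ (ts.flatMap (qenc P X)).length + P.B * k

/-- The queues before segment `j`, when the queues of the supersegments starting with segment `j`
have been distributed down to level `lev`. -/
structure Queues (P : Params) (X : List ℕ) (T : List Part) (lev j : ℕ) (β : Store) : Prop where
  top : ∀ l, P.L ≤ l → ∀ i, β (File.Q l i) = []
  closed : ∀ l < P.L, ∀ i, j ≤ i * P.f ^ l →
    (if lev ≤ l then j + 1 else j) ≤ i / P.f * P.f ^ (l + 1) → β (File.Q l i) = []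
  opened : ∀ l < P.L, ∀ i, j ≤ i * P.f ^ l →
    i / P.f * P.f ^ (l + 1) < (if lev ≤ l then j + 1 else j) →
    QSt P X T β l i (fun x => x.q / P.b / P.f ^ l = i ∧ x.p / P.b < j)
      (j - i / P.f * P.f ^ (l + 1) + 1)
  len : ∀ l i, (β (File.Q l i)).flatten.length ≤ 3 * P.n

/-- Total length of the queue entries of the parts in `T`. -/
def wt (P : Params) (X : List ℕ) (T : List Part) : ℕ := (T.flatMap (qenc P X)).length

theorem wt_perm {P : Params} {X : List ℕ} {T T' : List Part} (h : T.Perm T') :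
    wt P X T = wt P X T' := (h.flatMap_right _).length_eq

theorem wt_filter_le (P : Params) (X : List ℕ) (T : List Part) (S : Part → Bool) :
    wt P X (T.filter S) ≤ wt P X T := flatMap_length_filter_le _ _ _

theorem wt_cons (P : Params) (X : List ℕ) (x : Part) (T : List Part) :
    wt P X (x :: T) = (qenc P X x).length + wt P X T := by
  simp only [wt, List.flatMap_cons, List.length_append]

theorem wt_filter_mono {P : Params} {X : List ℕ} {T : List Part} {S S' : Part → Bool}
    (h : ∀ x ∈ T, S x = true → S' x = true) : wt P X (T.filter S) ≤ wt P X (T.filter S') := by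
  induction T with
  | nil => simp
  | cons x T ih =>
    have h1 := h x List.mem_cons_self
    have ih := ih fun y hy => h y (List.mem_cons_of_mem _ hy)
    simp only [List.filter_cons]
    split_ifs with a b
    · rw [wt_cons, wt_cons]; omega
    · exact absurd (h1 a) b
    · rw [wt_cons]; omega
    · exact ih

theorem wt_filter_lt_succ (P : Params) (X : List ℕ) (T : List Part) (g : Part → ℕ) (i : ℕ) :
    wt P X (T.filter fun x => g x < i + 1) =
      wt P X (T.filter fun x => g x < i) + wt P X (T.filter fun x => g x = i) := by
  induction T with
  | nil => rfl
  | cons x T ih =>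
    simp only [List.filter_cons, decide_eq_true_eq]
    split_ifs <;> simp only [wt_cons, ih] <;> omega

/-- Number of multiples of `a` below `j`. -/
def cdiv (j a : ℕ) : ℕ := (j + a - 1) / a

theorem cdiv_succ {a : ℕ} (ha : 0 < a) (j : ℕ) :
    cdiv (j + 1) a = cdiv j a + if j % a = 0 then 1 else 0 := by
  have h := Nat.div_add_mod j a
  have hm := Nat.mod_lt j ha
  set k := j / a
  set m := j % a
  have h1 : j + 1 + a - 1 = m + a * (k + 1) := by rw [mul_add]; omega
  unfold cdiv
  rw [h1, Nat.add_mul_div_left _ _ ha, Nat.div_eq_of_lt hm]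
  split
  · have h2 : j + a - 1 = (a - 1) + a * k := by omega
    rw [h2, Nat.add_mul_div_left _ _ ha, Nat.div_eq_of_lt (by omega)]
    omega
  · have h2 : j + a - 1 = (m - 1) + a * (k + 1) := by rw [mul_add]; omega
    rw [h2, Nat.add_mul_div_left _ _ ha, Nat.div_eq_of_lt (by omega)]
    omega

theorem cdiv_mul {a : ℕ} (ha : 0 < a) (i : ℕ) : cdiv (i * a) a = i := by
  unfold cdiv
  have : i * a + a - 1 = (a - 1) + a * i := by rw [mul_comm]; omega
  rw [this, Nat.add_mul_div_left _ _ ha, Nat.div_eq_of_lt (by omega), zero_add]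

/-- A bound for the cost, times `B`, of opening the queues of level `v` before segment `j`. -/
def openCost (P : Params) (X : List ℕ) (T : List Part) (v j : ℕ) : ℕ :=
  4 * wt P X (T.filter fun x => x.q / P.b / P.f ^ v < cdiv j (P.f ^ v)) +
    P.B * ((if v < P.L then P.f ^ (v + 1) else 0) + (1 + 3 * P.f)) * cdiv j (P.f ^ v)

/-- Opening supersegment `i` reads its queue at one unit per word and writes it at three. The
summand `f ^ (v + 1)` accounts for partial blocks in the queue, at most one per pass, with no more
passes than the parent has segments; `1 + 3 * f` stands for a read past the end and the final flush.
-/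
theorem openCost_succ_of_dvd {P : Params} {X : List ℕ} {T : List Part} {v i : ℕ} (hf : 0 < P.f) :
    openCost P X T v (i * P.f ^ v + 1) = openCost P X T v (i * P.f ^ v) +
      4 * wt P X (T.filter fun x => x.q / P.b / P.f ^ v = i) +
      P.B * ((if v < P.L then P.f ^ (v + 1) else 0) + (1 + 3 * P.f)) := by
  have hp : 0 < P.f ^ v := pow_pos hf v
  unfold openCost
  rw [cdiv_succ hp, cdiv_mul hp, Nat.mul_mod_left, if_pos rfl, wt_filter_lt_succ]
  ring

theorem openCost_succ_of_not_dvd {P : Params} {X : List ℕ} {T : List Part} {v j : ℕ} (hf : 0 < P.f)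
    (h : j % P.f ^ v ≠ 0) : openCost P X T v (j + 1) = openCost P X T v j := by
  unfold openCost
  rw [cdiv_succ (pow_pos hf v), if_neg h, add_zero]

theorem openCost_zero (P : Params) (X : List ℕ) (T : List Part) (v : ℕ) (hf : 0 < P.f) :
    openCost P X T v 0 = 0 := by
  have : cdiv 0 (P.f ^ v) = 0 := by
    have := cdiv_mul (pow_pos hf v) 0
    simpa using this
  unfold openCost
  rw [this, filter_eq_nil_of fun x _ => Nat.not_lt_zero _]
  rfl

/-- There are `⌈segs / f ^ v⌉` supersegments with up to `f ^ (v + 1)` partial blocks each, which is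
`O(f * segs)` at every level. Rounding up at most doubles this, because `f ^ v < segs` for `v < L`.
-/
theorem openCost_segs_le {P : Params} {X : List ℕ} (ctx : Ctx P X) (T : List Part) (v : ℕ) :
    openCost P X T v P.segs ≤ 4 * wt P X T + P.segs * (P.B * (5 * P.f + 1)) := by
  have hf4 := ctx.adm.four_le
  have hp : 0 < P.f ^ v := pow_pos (by omega) v
  have h1 : wt P X (T.filter fun x => x.q / P.b / P.f ^ v < cdiv P.segs (P.f ^ v)) ≤ wt P X T :=
    wt_filter_le _ _ _ _
  have h2 : cdiv P.segs (P.f ^ v) ≤ P.segs := ceil_le hp P.segs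
  have h3 : (if v < P.L then P.f ^ (v + 1) else 0) * cdiv P.segs (P.f ^ v) ≤ 2 * P.f * P.segs := by
    split
    · next hv =>
      have h4 : P.f ^ v * cdiv P.segs (P.f ^ v) ≤ P.segs + P.f ^ v - 1 := Nat.mul_div_le _ _
      have h5 : P.f ^ v < P.segs := by
        rw [← Nat.lt_clog_iff_pow_lt (by omega)]
        exact hv
      calc P.f ^ (v + 1) * cdiv P.segs (P.f ^ v) = P.f * (P.f ^ v * cdiv P.segs (P.f ^ v)) := by
            rw [pow_succ]; ring
        _ ≤ P.f * (2 * P.segs) := Nat.mul_le_mul_left _ (by omega)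
        _ = 2 * P.f * P.segs := by ring
    · simp
  have h4 : (1 + 3 * P.f) * cdiv P.segs (P.f ^ v) ≤ (1 + 3 * P.f) * P.segs :=
    Nat.mul_le_mul_left _ h2
  unfold openCost
  calc _ = 4 * wt P X (T.filter fun x => x.q / P.b / P.f ^ v < cdiv P.segs (P.f ^ v)) +
        P.B * ((if v < P.L then P.f ^ (v + 1) else 0) * cdiv P.segs (P.f ^ v) +
          (1 + 3 * P.f) * cdiv P.segs (P.f ^ v)) := by ring
    _ ≤ 4 * wt P X T + P.B * (2 * P.f * P.segs + (1 + 3 * P.f) * P.segs) := by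
        gcongr
    _ = _ := by ring

/-- The counterpart of `distW_srcIn` for targets. A queue collects entries in the order of their
emission, so its contents are known only up to permutation. -/
theorem distW_perm_filter {P : Params} {T ts : List Part} {l i c j : ℕ}
    (hc : c < P.f)
    (h : ts.Perm (T.filter fun x => x.q / P.b / P.f ^ (l + 1) = i ∧ x.p / P.b < j)) :
    (ts.filter fun x => x.q / P.b / P.f ^ l % P.f = c).Perm
      (T.filter fun x => x.q / P.b / P.f ^ l = i * P.f + c ∧ x.p / P.b < j) := by
  refine (h.filter _).trans ?_
  rw [List.filter_filter]
  refine List.Perm.of_eq (List.filter_congr fun x _ => ?_)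
  rw [div_pow_succ, ← Bool.decide_and, decide_eq_decide]
  generalize x.q / P.b / P.f ^ l = s
  have := Nat.div_add_mod s P.f
  constructor
  · rintro ⟨h1, h2, h3⟩
    refine ⟨?_, h3⟩
    rw [← h1, ← h2, mul_comm]; omega
  · rintro ⟨h1, h2⟩
    rw [h1, mul_comm i, Nat.mul_add_mod, Nat.mod_eq_of_lt hc, Nat.mul_add_div (by omega),
      Nat.div_eq_of_lt hc]
    simp [h2]

theorem QSt.congr {P X T β β' l i S k} (h : QSt P X T β l i S k)
    (hβ : β' (File.Q l i) = β (File.Q l i)) : QSt P X T β' l i S k := by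
  unfold QSt at *
  rw [hβ]; exact h

/-- Going down the levels, the threshold in `Queues` rises from `j` to `j + 1` at one level after
the other. A queue has received one pass when its parent was opened and one for each segment
recovered since, which is the number of passes in `Queues.opened`. -/
theorem wp_openQueues {P : Params} {X : List ℕ} {β₀ : Store} {r : Ram} {e : ℕ}
    {Q : Ram → Store → ℕ → Prop} {T : List Part} (ctx : Ctx P X) (hTok : ∀ x ∈ T, PartOK P X x)
    (hT : wt P X T ≤ 3 * P.n) (hj : r.j < P.segs)
    (hq : Queues P X T P.L r.j β₀) (hout : r.out = fun _ => [])
    (hQ : ∀ r' β' e', RamOK P r' → Keep r r' → r'.out = (fun _ => []) → Queues P X T 0 r.j β' →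
      (∀ F, (∀ l i, F ≠ File.Q l i) → β' F = β₀ F) →
      P.B * e' + ∑ v ∈ Finset.Ioc 0 P.L, openCost P X T v r.j ≤
        P.B * e + ∑ v ∈ Finset.Ioc 0 P.L, openCost P X T v (r.j + 1) → Q r' β' e') :
    WP P P.openQueues r β₀ e Q := by
  have hN' : P.N = 8 * P.n + 8 := rfl
  have hf4 := ctx.adm.four_le
  have hLn := ctx.L_le
  set j := r.j with hjd
  refine wp_seq (wp_assign fun hr _ => ⟨{ hr with lev := by dsimp only; omega }, ?_⟩)
  let I : ℕ → Ram → Store → ℕ → Prop := fun l r' β' e' => r'.lev = l ∧ l ≤ P.L ∧ Keep r r' ∧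
    r'.out = (fun _ => []) ∧ Queues P X T l j β' ∧ (∀ F, (∀ l i, F ≠ File.Q l i) → β' F = β₀ F) ∧
    P.B * e' + ∑ v ∈ Finset.Ioc l P.L, openCost P X T v j ≤
        P.B * e + ∑ v ∈ Finset.Ioc l P.L, openCost P X T v (j + 1)
  refine wp_loop I id P.L ⟨rfl, le_rfl, ⟨rfl, rfl, fun _ _ => rfl, fun _ _ => rfl⟩, hout, hq,
    fun _ _ => rfl, by simp⟩ ?_ ?_
  · rintro l r1 β1 e1 ok1 _ ⟨rfl, hlL, hk1, hout1, hq1, hf1, hcost1⟩ hl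
    have hl : 0 < r1.lev := by simpa using hl
    obtain ⟨l, hl'⟩ : ∃ l, r1.lev = l + 1 := ⟨r1.lev - 1, by omega⟩
    have hf := ctx.f_le (by omega)
    have hj1 : r1.j = j := hk1.j
    have hIoc : Finset.Ioc l P.L = insert (l + 1) (Finset.Ioc (l + 1) P.L) := by
      ext v; simp only [Finset.mem_Ioc, Finset.mem_insert]; omega
    have hnot : l + 1 ∉ Finset.Ioc (l + 1) P.L := by simp
    rw [hl'] at hq1 hcost1
    have hpow : 0 < P.f ^ (l + 1) := pow_pos (by omega) _
    refine wp_seq (wp_cond (fun hb => ?_) (fun hb => ?_))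
    · have hb : j % P.f ^ (l + 1) = 0 := by
        rw [← hj1, ← hl']; simpa using hb
      set i := j / P.f ^ (l + 1) with hi
      have hij : i * P.f ^ (l + 1) = j := Nat.div_mul_cancel (Nat.dvd_of_mod_eq_zero hb)
      have hi1 : r1.j / P.f ^ r1.lev = i := by rw [hj1, hl']
      have hin : i ≤ P.N := by
        have := Nat.div_le_self j (P.f ^ (l + 1))
        have := ctx.segs_le
        omega
      refine wp_seq (wp_assign fun _ _ => ?_)
      rw [hi1]
      refine ⟨{ ok1 with i := hin }, ?_⟩
      have hchild : ∀ c < P.f, (i * P.f + c) / P.f = i := by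
        intro c hc
        rw [mul_comm, Nat.mul_add_div (by omega), Nat.div_eq_of_lt hc, add_zero]
      have hjc : ∀ c, j ≤ (i * P.f + c) * P.f ^ l := by
        intro c
        rw [← hij, pow_succ, add_mul]
        have : i * (P.f ^ l * P.f) = i * P.f * P.f ^ l := by ring
        omega
      -- Below the top level this is the invariant, with the number of passes bounded by the number
      -- of segments of the parent. The top supersegment is only opened at `j = 0`, when nothing has
      -- been emitted, so its queue is empty.
      obtain ⟨ts, hts, hcont, hnb⟩ : ∃ ts : List Part,
          ts.Perm (T.filter fun x => x.q / P.b / P.f ^ (l + 1) = i ∧ x.p / P.b < j) ∧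
          (β1 (File.Q (l + 1) i)).flatten = ts.flatMap (qenc P X) ∧
          P.B * (β1 (File.Q (l + 1) i)).length ≤ (ts.flatMap (qenc P X)).length +
            P.B * (if l + 1 < P.L then P.f ^ (l + 1 + 1) else 0) := by
        rcases Nat.lt_or_ge (l + 1) P.L with h | h
        · have hle : i / P.f * P.f ^ (l + 1 + 1) ≤ j := by
            rw [← hij, pow_succ' P.f (l + 1), ← mul_assoc]
            exact Nat.mul_le_mul_right _ (Nat.div_mul_le_self _ _)
          obtain ⟨ts, h1, h2, h3⟩ := hq1.opened (l + 1) h i hij.ge (by rw [if_pos le_rfl]; omega)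
          refine ⟨ts, h1, h2, h3.trans (Nat.add_le_add_left (Nat.mul_le_mul_left _ ?_) _)⟩
          rw [if_pos h, ← hij]
          have hdm := Nat.div_add_mod i P.f
          have hm := Nat.mod_lt i (show 0 < P.f by omega)
          have h4 : i * P.f ^ (l + 1) = i / P.f * P.f ^ (l + 1 + 1) + i % P.f * P.f ^ (l + 1) := by
            rw [pow_succ' P.f (l + 1), ← mul_assoc, ← add_mul, mul_comm _ P.f, hdm]
          have h5 : (i % P.f + 1) * P.f ^ (l + 1) ≤ P.f ^ (l + 1 + 1) := by
            rw [pow_succ' P.f (l + 1)]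
            exact Nat.mul_le_mul_right _ hm
          rw [add_mul] at h5
          omega
        · have hL : l + 1 = P.L := by omega
          have hj0 : j = 0 := by
            have := ctx.f_pow_L
            rw [← hL] at this
            have h0 : i = 0 := Nat.div_eq_of_lt (by omega)
            rw [← hij, h0, zero_mul]
          refine ⟨[], ?_, ?_, ?_⟩
          · rw [filter_eq_nil_of fun x _ h => Nat.not_lt_zero _ (hj0 ▸ h.2)]
          · rw [hq1.top _ h]; rfl
          · rw [hq1.top _ h]; simp
      have htsw : wt P X ts ≤ 3 * P.n := by
        rw [wt_perm hts]
        exact (wt_filter_le _ _ _ _).trans hT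
      refine wp_distributeQ (r := { r1 with i := i }) (T := ts) ctx hl hf
        (fun x hx => hTok x (List.mem_of_mem_filter (hts.subset hx))) (by dsimp only; rw [hl']; exact hcont)
        htsw ?_ hout1 ?_
      · intro c hc
        dsimp only
        rw [hl', Nat.add_sub_cancel]
        apply hq1.closed l (by omega) _ (hjc c)
        rw [if_neg (by omega), hchild c hc, hij]
      · dsimp only
        rw [hl', Nat.add_sub_cancel]
        intro r2 β2 e2 ok2 hk2 hl2 hi2 hout2 hcont2 hblocks2 hframe2 hcost2
        refine wp_assign fun _ _ => ⟨{ ok2 with lev := by dsimp only; have := ok2.lev; omega }, l,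
          by simp only [id]; omega, by dsimp only; omega, by omega,
          (hk1.trans ⟨hk2.Y, hk2.j, hk2.inp, hk2.pos⟩).trans
            ⟨rfl, rfl, fun _ _ => rfl, fun _ _ => rfl⟩, hout2, ⟨?_, ?_, ?_, ?_⟩, ?_, ?_⟩
        · intro l' h i'
          rw [hframe2 _ (fun c _ h' => ?_)]
          · exact hq1.top l' h i'
          · simp only [File.Q.injEq] at h'
            omega
        · intro l' h' i' hji hp
          rw [hframe2 _ (fun c hc h' => ?_)]
          · refine hq1.closed l' h' i' hji ?_
            split_ifs at hp ⊢ <;> omega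
          · simp only [File.Q.injEq] at h'
            obtain ⟨rfl, rfl⟩ := h'
            rw [if_pos le_rfl, hchild c hc, hij] at hp
            omega
        · intro l' h' i' hji hp
          by_cases hc : l' = l ∧ i' / P.f = i
          · obtain ⟨rfl, hi'⟩ := hc
            have hm := Nat.mod_lt i' (show 0 < P.f by omega)
            have hieq : i * P.f + i' % P.f = i' := by
              rw [← hi', mul_comm]; exact Nat.div_add_mod _ _
            refine ⟨_, ?_, (?_ : _ = distW (fun x => x.q / P.b / P.f ^ l' % P.f) (qenc P X) ts (i' % P.f)), ?_⟩
            · have := distW_perm_filter (j := j) hm hts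
              rw [hieq] at this
              exact this
            · rw [← hcont2 _ hm, hieq]
            · have := hblocks2 _ hm
              rw [hieq] at this
              refine this.trans (Nat.add_le_add_left ?_ _)
              exact Nat.le_mul_of_pos_right _ (Nat.succ_pos _)
          · refine (hq1.opened l' h' i' hji ?_).congr (hframe2 _ fun c hc' h => hc ?_)
            · rcases Nat.lt_trichotomy l' l with h1 | rfl | h1
              · rw [if_neg (by omega)] at hp ⊢; exact hp
              · rw [if_pos le_rfl] at hp
                rw [if_neg (by omega)]
                -- A parent starting exactly at `j` would be supersegment `i` itself, so for all
                -- other parents the thresholds `j` and `j + 1` agree.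
                refine lt_of_le_of_ne (by omega) fun heq => hc ⟨rfl, ?_⟩
                rw [← hij] at heq
                exact Nat.eq_of_mul_eq_mul_right hpow heq
              · rw [if_pos (by omega)] at hp ⊢; exact hp
            · simp only [File.Q.injEq] at h
              obtain ⟨rfl, rfl⟩ := h
              exact ⟨rfl, hchild c hc'⟩
        · intro l' i'
          by_cases hc : ∃ c < P.f, File.Q l' i' = File.Q l (i * P.f + c)
          · obtain ⟨c, hc, h'⟩ := hc
            rw [h', hcont2 c hc]
            exact (distW_length_le _ _ _ _).trans htsw
          · rw [hframe2 _ fun c h h' => hc ⟨c, h, h'⟩]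
            exact hq1.len l' i'
        · intro F hF
          rw [hframe2 _ (fun c _ => hF _ _)]
          exact hf1 F hF
        · rw [hIoc, Finset.sum_insert hnot, Finset.sum_insert hnot]
          have hs := openCost_succ_of_dvd (X := X) (T := T) (v := l + 1) (i := i)
            (show 0 < P.f by omega)
          rw [hij] at hs
          have hw : wt P X ts ≤ wt P X (T.filter fun x => x.q / P.b / P.f ^ (l + 1) = i) := by
            rw [wt_perm hts]
            refine wt_filter_mono fun x _ h => ?_
            simp only [decide_eq_true_eq] at h ⊢
            exact h.1
          have hwd : wt P X ts = (ts.flatMap (qenc P X)).length := rfl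
          rw [hs]
          have hBe : P.B * ((if l + 1 < P.L then P.f ^ (l + 1 + 1) else 0) + (1 + 3 * P.f)) =
            P.B * (if l + 1 < P.L then P.f ^ (l + 1 + 1) else 0) + P.B + P.B * (3 * P.f) := by ring
          rw [hBe]
          simp only [mul_add, mul_one] at hcost2
          omega
    · have hb : j % P.f ^ (l + 1) ≠ 0 := by
        rw [← hj1, ← hl']; simpa using hb
      -- No supersegment of level `l + 1` starts at `j`, so raising the threshold at level `l` has
      -- no effect.
      have hne : ∀ i', i' / P.f * P.f ^ (l + 1) ≠ j := by
        intro i' h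
        rw [← h] at hb
        simp at hb
      refine wp_skip fun _ _ => wp_assign fun ok2 _ =>
        ⟨{ ok2 with lev := by dsimp only; have := ok2.lev; omega }, l,
        by simp only [id]; omega, by dsimp only; omega, by omega, ?_, hout1, ⟨hq1.top, ?_, ?_, hq1.len⟩, hf1, ?_⟩
      · exact hk1.trans ⟨rfl, rfl, fun _ _ => rfl, fun _ _ => rfl⟩
      · intro l' h' i' hji hp
        refine hq1.closed l' h' i' hji ?_
        split_ifs at hp ⊢ <;> omega
      · intro l' h' i' hji hp
        refine hq1.opened l' h' i' hji ?_
        rcases Nat.lt_trichotomy l' l with h1 | rfl | h1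
        · rw [if_neg (by omega)] at hp ⊢; exact hp
        · rw [if_pos le_rfl] at hp
          rw [if_neg (by omega)]
          have := hne i'
          omega
        · rw [if_pos (by omega)] at hp ⊢; exact hp
      · rw [hIoc, Finset.sum_insert hnot, Finset.sum_insert hnot,
          openCost_succ_of_not_dvd (by omega) hb]
        omega
  · rintro l r1 β1 e1 ok1 _ ⟨rfl, hlL, hk1, hout1, hq1, hf1, hcost1⟩ hl
    have hl : r1.lev = 0 := by simpa using hl
    rw [hl] at hq1 hcost1
    exact hQ r1 β1 e1 ok1 hk1 hout1 hq1 hf1 hcost1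

/-! Recovery of a segment. -/

theorem getD_set (Y : List ℕ) {i : ℕ} (a u : ℕ) (hi : i < Y.length) :
    (Y.set i a).getD u 0 = if u = i then a else Y.getD u 0 := by
  simp only [List.getD_eq_getElem?_getD, List.getElem?_set]
  by_cases h : u = i
  · subst h; simp [hi]
  · simp [h, Ne.symm h]

theorem copyWithin_succ (Y : List ℕ) (p q l : ℕ) :
    copyWithin Y p q (l + 1) =
      (copyWithin Y p q l).set (q + l) ((copyWithin Y p q l).getD (p + l) 0) := by
  simp [copyWithin, List.range_succ]

theorem copyWithin_length (Y : List ℕ) (p q l : ℕ) : (copyWithin Y p q l).length = Y.length := by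
  induction l with
  | zero => rfl
  | succ l ih => rw [copyWithin_succ, List.length_set, ih]

theorem copyWithin_lt {Y : List ℕ} {σ : ℕ} (hσ : 0 < σ) (h : ∀ x ∈ Y, x < σ) (p q l : ℕ) :
    ∀ x ∈ copyWithin Y p q l, x < σ := by
  induction l with
  | zero => exact h
  | succ l ih =>
    rw [copyWithin_succ]
    intro x hx
    rcases List.mem_or_eq_of_mem_set hx with hx | rfl
    · exact ih x hx
    · rcases Nat.lt_or_ge (p + l) (copyWithin Y p q l).length with h | h
      · rw [List.getD_eq_getElem _ _ h]
        exact ih _ (List.getElem_mem h)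
      · rw [List.getD_eq_default _ _ h]; exact hσ

/-- Copying to the left reads only old symbols. -/
theorem copyWithin_getD_left {Y : List ℕ} {p q l : ℕ} (hqp : q ≤ p) (hl : q + l ≤ Y.length)
    (u : ℕ) : (copyWithin Y p q l).getD u 0 =
      if q ≤ u ∧ u < q + l then Y.getD (p + (u - q)) 0 else Y.getD u 0 := by
  induction l generalizing u with
  | zero => rw [if_neg (by omega)]; rfl
  | succ l ih =>
    have ih := ih (by omega)
    have hr : (copyWithin Y p q l).getD (p + l) 0 = Y.getD (p + l) 0 := by
      rw [ih, if_neg (by omega)]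
    rw [copyWithin_succ, getD_set _ _ _ (by rw [copyWithin_length]; omega), hr, ih u]
    by_cases h : u = q + l
    · subst h
      rw [if_pos rfl, if_pos (by omega)]
      congr 1; omega
    · rw [if_neg h]
      by_cases h2 : q ≤ u ∧ u < q + l
      · rw [if_pos h2, if_pos (by omega)]
      · rw [if_neg h2, if_neg (by omega)]

/-- Copying to the right, possibly with overlap, of a string that repeats in `Z`. -/
theorem copyWithin_getD_right {Y : List ℕ} {Z : ℕ → ℕ} {p q l : ℕ} (hpq : p < q)
    (hl : q + l ≤ Y.length) (hY : ∀ u, p ≤ u → u < q → Y.getD u 0 = Z u)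
    (hZ : ∀ t < l, Z (p + t) = Z (q + t)) (u : ℕ) : (copyWithin Y p q l).getD u 0 =
      if q ≤ u ∧ u < q + l then Z u else Y.getD u 0 := by
  induction l generalizing u with
  | zero => rw [if_neg (by omega)]; rfl
  | succ l ih =>
    have ih := ih (by omega) fun t ht => hZ t (by omega)
    have hr : (copyWithin Y p q l).getD (p + l) 0 = Z (q + l) := by
      rw [ih, ← hZ l (by omega)]
      split
      · rfl
      · exact hY _ (by omega) (by omega)
    rw [copyWithin_succ, getD_set _ _ _ (by rw [copyWithin_length]; omega), hr, ih u]
    by_cases h : u = q + l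
    · subst h
      rw [if_pos rfl, if_pos (by omega)]
    · rw [if_neg h]
      by_cases h2 : q ≤ u ∧ u < q + l
      · rw [if_pos h2, if_pos (by omega)]
      · rw [if_neg h2, if_neg (by omega)]

theorem overwrite_length {Y s : List ℕ} {q : ℕ} (h : q + s.length ≤ Y.length) :
    (overwrite Y q s).length = Y.length := by
  simp [overwrite]; omega

theorem overwrite_lt {Y s : List ℕ} {σ : ℕ} (hY : ∀ x ∈ Y, x < σ) (hs : ∀ x ∈ s, x < σ) (q : ℕ) :
    ∀ x ∈ overwrite Y q s, x < σ := by
  intro x hx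
  simp only [overwrite, List.mem_append] at hx
  rcases hx with (hx | hx) | hx
  exacts [hY x (List.mem_of_mem_take hx), hs x hx, hY x (List.mem_of_mem_drop hx)]

theorem overwrite_getD {Y s : List ℕ} {q : ℕ} (h : q + s.length ≤ Y.length) (u : ℕ) :
    (overwrite Y q s).getD u 0 =
      if q ≤ u ∧ u < q + s.length then s.getD (u - q) 0 else Y.getD u 0 := by
  have htake : (Y.take q).length = q := by simp; omega
  simp only [overwrite, List.getD_eq_getElem?_getD, List.append_assoc]
  rcases Nat.lt_or_ge u q with h1 | h1
  · rw [List.getElem?_append_left (by omega), List.getElem?_take, if_pos h1, if_neg (by omega)]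
  · rw [List.getElem?_append_right (by omega), htake]
    rcases Nat.lt_or_ge u (q + s.length) with h2 | h2
    · rw [List.getElem?_append_left (by omega), if_pos (by omega)]
    · rw [List.getElem?_append_right (by omega), List.getElem?_drop, if_neg (by omega)]
      congr 2; omega

/-- The array holds the symbols of segment `j` at the positions in `S`. -/
def Known (P : Params) (X : List ℕ) (j : ℕ) (S : ℕ → Prop) (Y : List ℕ) : Prop :=
  ∀ u < P.b, S (j * P.b + u) → Y.getD u 0 = X.getD (j * P.b + u) 0

def CovP (ps : List Part) (v : ℕ) : Prop := ∃ x ∈ ps, x.q ≤ v ∧ v < x.q + x.l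

def CovL (ls : List (ℕ × ℕ)) (v : ℕ) : Prop := ∃ y ∈ ls, y.1 ≤ v ∧ v < y.1 + y.2

theorem covP_append {ps : List Part} {x : Part} {v : ℕ} :
    CovP (ps ++ [x]) v ↔ CovP ps v ∨ (x.q ≤ v ∧ v < x.q + x.l) := by
  simp [CovP, or_and_right, exists_or]

theorem covL_append {ls : List (ℕ × ℕ)} {y : ℕ × ℕ} {v : ℕ} :
    CovL (ls ++ [y]) v ↔ CovL ls v ∨ (y.1 ≤ v ∧ v < y.1 + y.2) := by
  simp only [CovL, List.mem_append, List.mem_singleton]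
  constructor
  · rintro ⟨z, hz | rfl, h⟩
    exacts [Or.inl ⟨z, hz, h⟩, Or.inr h]
  · rintro (⟨z, hz, h⟩ | h)
    exacts [⟨z, Or.inl hz, h⟩, ⟨y, Or.inr rfl, h⟩]

/-- What the recovery through slot `s` leaves unchanged. -/
structure Keep' (s : Slot) (r r' : Ram) : Prop where
  out : r'.out = r.out
  j : r'.j = r.j
  inp : ∀ s' ≠ s, r'.inp s' = r.inp s'
  pos : ∀ s' ≠ s, r'.pos s' = r.pos s'

theorem Keep'.refl (s : Slot) (r : Ram) : Keep' s r r := ⟨rfl, rfl, fun _ _ => rfl, fun _ _ => rfl⟩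

theorem Keep'.trans {s : Slot} {r r' r'' : Ram} (h : Keep' s r r') (h' : Keep' s r' r'') :
    Keep' s r r'' :=
  ⟨h'.out.trans h.out, h'.j.trans h.j, fun s hs => (h'.inp s hs).trans (h.inp s hs),
    fun s hs => (h'.pos s hs).trans (h.pos s hs)⟩

theorem PartOK.copy_getD {P : Params} {X : List ℕ} {x : Part} (h : PartOK P X x) {t : ℕ}
    (ht : t < x.l) : X.getD (x.p + t) 0 = X.getD (x.q + t) 0 := by
  rw [List.getD_eq_getElem?_getD, List.getD_eq_getElem?_getD, h.copy t ht]

section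

variable {P : Params} {X : List ℕ} {r : Ram} {β : Store} {e : ℕ} {Q : Ram → Store → ℕ → Prop}
  {a : ℕ}

/-- From `q ≤ p + b` and adjacent segments, the array index of the target is at most that of the
source, so the copy never reads what it has written itself. Earlier parts end before the current
target, hence before the current source: every source is still a piece of the preceding segment. -/
theorem wp_recoverPrev {T₁ T₂ : List Part} (ctx : Ctx P X) (hT₁ : ∀ x ∈ T₁, PartOK P X x)
    (hs : ∀ x ∈ T₁, x.q / P.b = r.j ∧ x.p / P.b + 1 = r.j ∧ x.q ≤ x.p + P.b)
    (hT₂ : ∀ x ∈ T₂, r.j * P.b ≤ x.p) (hsort : T₁.Pairwise fun x y => x.q + x.l ≤ y.q)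
    (hR : Rd (β File.prev) Slot.prev a r ((T₁ ++ T₂).flatMap trip))
    (hN : (β File.prev).length + a + 1 ≤ P.N) (hlen : r.Y.length = P.b)
    (hY : T₁ ≠ [] → Known P X (r.j - 1) (fun _ => True) r.Y)
    (hQ : ∀ r' e', RamOK P r' → Keep' Slot.prev r r' → r'.Y.length = P.b →
      Known P X r.j (CovP T₁) r'.Y →
      Rd (β File.prev) Slot.prev (a + 1) r' (T₂.flatMap trip) →
      e' + rem (β File.prev) Slot.prev r' ≤ e + rem (β File.prev) Slot.prev r + 1 → Q r' β e') :
    WP P P.recoverPrev r β e Q := by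
  have hb := ctx.b_pos
  set bl := β File.prev with hbl
  let J : List Part → Ram → Store → ℕ → Prop := fun pre r' β' v => β' = β ∧ Keep' Slot.prev r r' ∧
    r'.Y.length = P.b ∧ Known P X r.j (CovP pre) r'.Y ∧
    -- Behind all targets processed so far the array is untouched; the remaining sources lie there.
    (∀ u < P.b, (∀ x ∈ pre, x.q + x.l ≤ r.j * P.b + u) → r'.Y.getD u 0 = r.Y.getD u 0) ∧
    v = e + rem bl Slot.prev r
  refine wp_whileBelow (bl := bl) (a := a) Part.p (fun x => [Cell.int x.q, Cell.int x.l]) T₁ T₂ _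
    (r.j * P.b) J ?_ hT₂ ?_ ?_ hR ?_ hN ?_ ?_
  · intro x hx
    obtain ⟨-, h, -⟩ := hs x hx
    rw [← h]
    have := Nat.lt_div_mul_add (a := x.p) hb
    rw [add_mul]; omega
  · rintro pre r' β' v ⟨rfl, hk, -⟩
    exact ⟨rfl, by rw [hk.j]⟩
  · rintro pre r' β' v y k io ⟨h0, hk, h⟩
    refine ⟨h0, hk.trans ⟨rfl, rfl, fun s hs => ?_, fun s hs => ?_⟩, h⟩ <;> simp [hs]
  · refine ⟨rfl, Keep'.refl _ _, hlen, ?_, fun _ _ _ => rfl, rfl⟩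
    rintro u _ ⟨x, hx, -⟩
    simp at hx
  · rintro pre x post ws r1 β1 e1 hpre ⟨rfl, hk1, hlen1, hK1, hO1, hv⟩ hR1 ok1 _
    refine wp_seq (wp_nextTriple (bl := bl) (p := x.p) (q := x.q) (l := x.l) (ws := ws)
      (fun _ _ _ _ _ _ => rfl) rfl hR1 (by omega) ?_)
    intro y k io e2 r2 hr2 R2 he2 ok2
    have hx := hT₁ x (by simp [hpre])
    obtain ⟨hq, hp, hqp⟩ := hs x (by simp [hpre])
    have Y2 : r2.Y = r1.Y := by rw [hr2]
    have hrY : copyWithin r2.Y (r2.p % P.b) (r2.q % P.b) r2.l =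
        copyWithin r1.Y (x.p % P.b) (x.q % P.b) x.l := by rw [hr2]
    have hlen2 : (copyWithin r1.Y (x.p % P.b) (x.q % P.b) x.l).length = P.b := by
      rw [copyWithin_length, hlen1]
    have hqd : r.j * P.b + x.q % P.b = x.q := by rw [← hq, mul_comm]; exact Nat.div_add_mod _ _
    have hpd : (r.j - 1) * P.b + x.p % P.b = x.p := by
      rw [← hp, Nat.add_sub_cancel, mul_comm]; exact Nat.div_add_mod _ _
    have hjb : r.j * P.b = (r.j - 1) * P.b + P.b := by
      rw [← hp, Nat.add_sub_cancel, add_mul, one_mul]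
    have hqs := hx.qseg
    have hps := hx.pseg
    have hend : ∀ y ∈ pre, y.q + y.l ≤ x.q := by
      intro y hy
      rw [hpre, List.pairwise_append] at hsort
      exact hsort.2.2 y hy x List.mem_cons_self
    have hget := copyWithin_getD_left (Y := r1.Y) (p := x.p % P.b) (q := x.q % P.b) (l := x.l)
      (by omega) (by omega)
    refine wp_assign fun _ _ => ?_
    rw [hrY]
    have ok3 : RamOK P { r2 with Y := copyWithin r1.Y (x.p % P.b) (x.q % P.b) x.l } :=
      { ok2 with
        Y_len := hlen2.le
        Y_lt := copyWithin_lt (by have := ctx.two_le_sigma; omega) ok1.Y_lt _ _ _ }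
    refine ⟨ok3, R2.congr rfl rfl, rfl, hk1.trans ⟨?_, ?_, fun s hs => ?_, fun s hs => ?_⟩, hlen2,
      ?_, ?_, ?_⟩
    · rw [hr2]
    · rw [hr2]
    · rw [hr2]; simp [hs]
    · rw [hr2]; simp [hs]
    · intro u hu hc
      dsimp only
      rw [hget]
      by_cases h : x.q % P.b ≤ u ∧ u < x.q % P.b + x.l
      · rw [if_pos h, hO1 _ (by omega) fun y hy => ?_, hY (by simp [hpre]) _ (by omega) trivial]
        · have h1 : (r.j - 1) * P.b + (x.p % P.b + (u - x.q % P.b)) = x.p + (u - x.q % P.b) := by omega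
          have h2 : r.j * P.b + u = x.q + (u - x.q % P.b) := by omega
          rw [h1, h2]
          exact hx.copy_getD (by omega)
        · have := hend y hy
          omega
      · rw [if_neg h]
        rw [covP_append] at hc
        rcases hc with hc | hc
        · exact hK1 u hu hc
        · omega
    · intro u hu hc
      dsimp only
      have h1 := hc x (by simp)
      rw [hget, if_neg (by omega)]
      exact hO1 u hu fun y hy => hc y (by simp [hy])
    · have : rem bl Slot.prev { r2 with Y := copyWithin r1.Y (x.p % P.b) (x.q % P.b) x.l } =
        rem bl Slot.prev r2 := rfl
      rw [this]
      omega
  · rintro r1 β1 v e1 ok1 _ ⟨rfl, hk1, hlen1, hK1, -, hv⟩ hev hR1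
    exact hQ r1 e1 ok1 hk1 hlen1 hK1 hR1 (by omega)

theorem wp_recoverLits {T₁ T₂ : List (ℕ × ℕ)} {S : ℕ → Prop} (ctx : Ctx P X)
    (hT₁ : ∀ y ∈ T₁, LitOK P y)
    (hs : ∀ y ∈ T₁, y.1 / P.b = r.j) (hT₂ : ∀ y ∈ T₂, (r.j + 1) * P.b ≤ y.1)
    (hR : Rd (β File.lits) Slot.lits a r ((T₁ ++ T₂).flatMap (litw X)))
    (hN : (β File.lits).length + a + 1 ≤ P.N) (hlen : r.Y.length = P.b)
    (hY : Known P X r.j S r.Y)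
    (hQ : ∀ r' e', RamOK P r' → Keep' Slot.lits r r' → r'.Y.length = P.b →
      Known P X r.j (fun v => S v ∨ CovL T₁ v) r'.Y →
      Rd (β File.lits) Slot.lits (a + 1) r' (T₂.flatMap (litw X)) →
      e' + rem (β File.lits) Slot.lits r' ≤ e + rem (β File.lits) Slot.lits r + 1 → Q r' β e') :
    WP P P.recoverLits r β e Q := by
  have hb := ctx.b_pos
  set bl := β File.lits with hbl
  let J : List (ℕ × ℕ) → Ram → Store → ℕ → Prop := fun pre r' β' v => β' = β ∧
    Keep' Slot.lits r r' ∧ r'.Y.length = P.b ∧ Known P X r.j (fun v => S v ∨ CovL pre v) r'.Y ∧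
    v = e + rem bl Slot.lits r
  refine wp_whileBelow (bl := bl) (a := a) Prod.fst (fun y => [Cell.str (slice X y.1 y.2)]) T₁ T₂ _
    ((r.j + 1) * P.b) J ?_ hT₂ ?_ ?_ hR ?_ hN ?_ ?_
  · intro y hy
    rw [← hs y hy]
    have := Nat.lt_div_mul_add (a := y.1) hb
    rw [add_mul]; omega
  · rintro pre r' β' v ⟨rfl, hk, -⟩
    exact ⟨rfl, by rw [hk.j]⟩
  · rintro pre r' β' v y k io ⟨h0, hk, h⟩
    refine ⟨h0, hk.trans ⟨rfl, rfl, fun s hs => ?_, fun s hs => ?_⟩, h⟩ <;> simp [hs]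
  · refine ⟨rfl, Keep'.refl _ _, hlen, ?_, rfl⟩
    rintro u hu (h | ⟨x, hx, -⟩)
    · exact hY u hu h
    · simp at hx
  · rintro pre y post ws r1 β1 e1 hpre ⟨rfl, hk1, hlen1, hK1, hv⟩ hR1 ok1 _
    have hy := hT₁ y (by simp [hpre])
    have hq := hs y (by simp [hpre])
    refine wp_seq (wp_next (bl := bl) (x := Cell.int y.1) rfl hR1 (by omega) ?_)
    intro y2 k2 io2 e2 r2 hr2 ok2 hc2 R2 he2
    refine ⟨{ ok2 with q := hc2 }, ?_⟩
    refine wp_next (bl := bl) (a := a) (ws := ws) (x := Cell.str (slice X y.1 y.2)) rfl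
      (R2.congr rfl rfl) (by omega) ?_
    intro y3 k3 io3 e3 r3 hr3 ok3 hc3 R3 he3
    have hqd : r.j * P.b + y.1 % P.b = y.1 := by rw [← hq, mul_comm]; exact Nat.div_add_mod _ _
    have hsl : (slice X y.1 y.2).length = y.2 := slice_length (by rw [ctx.len]; exact hy.le)
    have hseg := hy.seg
    have hrY : overwrite r3.Y (r3.q % P.b) (Cell.str (slice X y.1 y.2)).syms =
        overwrite r1.Y (y.1 % P.b) (slice X y.1 y.2) := by rw [hr3, hr2]; rfl
    have hl : y.1 % P.b + (slice X y.1 y.2).length ≤ r1.Y.length := by omega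
    have hlen3 := overwrite_length hl
    rw [hrY]
    have ok4 : RamOK P { r3 with Y := overwrite r1.Y (y.1 % P.b) (slice X y.1 y.2) } :=
      { ok3 with
        Y_len := by dsimp only; omega
        Y_lt := overwrite_lt ok1.Y_lt hc3.2 _ }
    refine ⟨ok4, R3.congr rfl rfl, rfl, hk1.trans ⟨?_, ?_, fun s hs => ?_, fun s hs => ?_⟩,
      hlen3.trans hlen1, ?_, ?_⟩
    · rw [hr3, hr2]
    · rw [hr3, hr2]
    · rw [hr3, hr2]; simp [hs]
    · rw [hr3, hr2]; simp [hs]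
    · intro u hu hc
      dsimp only
      rw [overwrite_getD hl, hsl]
      by_cases h : y.1 % P.b ≤ u ∧ u < y.1 % P.b + y.2
      · rw [if_pos h, slice_getD (by omega)]
        congr 1; omega
      · rw [if_neg h]
        rw [covL_append, ← or_assoc] at hc
        rcases hc with hc | hc
        · exact hK1 u hu hc
        · omega
    · have h1 : rem bl Slot.lits { r3 with Y := overwrite r1.Y (y.1 % P.b) (slice X y.1 y.2) } =
        rem bl Slot.lits r3 := rfl
      have h2 : rem bl Slot.lits { r2 with q := (Cell.int y.1).val } = rem bl Slot.lits r2 := rfl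
      rw [h1]
      omega
  · rintro r1 β1 v e1 ok1 _ ⟨rfl, hk1, hlen1, hK1, hv⟩ hev hR1
    exact hQ r1 e1 ok1 hk1 hlen1 hK1 hR1 (by omega)

/-- `hcov` provides every symbol of the segment to the left of the current target: it is known from
the earlier steps or from an earlier part of this list. Nothing more is needed, as the source begins
to the left of the target. -/
theorem wp_recoverSame {T₁ T₂ : List Part} {S : ℕ → Prop} (ctx : Ctx P X)
    (hT₁ : ∀ x ∈ T₁, PartOK P X x)
    (hs : ∀ x ∈ T₁, x.q / P.b = r.j ∧ x.p / P.b = r.j)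
    (hT₂ : ∀ x ∈ T₂, (r.j + 1) * P.b ≤ x.p)
    (hcov : ∀ pre x post, T₁ = pre ++ x :: post → ∀ v, r.j * P.b ≤ v → v < x.q → S v ∨ CovP pre v)
    (hR : Rd (β File.same) Slot.same a r ((T₁ ++ T₂).flatMap trip))
    (hN : (β File.same).length + a + 1 ≤ P.N) (hlen : r.Y.length = P.b)
    (hY : Known P X r.j S r.Y)
    (hQ : ∀ r' e', RamOK P r' → Keep' Slot.same r r' → r'.Y.length = P.b →
      Known P X r.j (fun v => S v ∨ CovP T₁ v) r'.Y →
      Rd (β File.same) Slot.same (a + 1) r' (T₂.flatMap trip) →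
      e' + rem (β File.same) Slot.same r' ≤ e + rem (β File.same) Slot.same r + 1 → Q r' β e') :
    WP P P.recoverSame r β e Q := by
  have hb := ctx.b_pos
  set bl := β File.same with hbl
  let J : List Part → Ram → Store → ℕ → Prop := fun pre r' β' v => β' = β ∧ Keep' Slot.same r r' ∧
    r'.Y.length = P.b ∧ Known P X r.j (fun v => S v ∨ CovP pre v) r'.Y ∧
    v = e + rem bl Slot.same r
  refine wp_whileBelow (bl := bl) (a := a) Part.p (fun x => [Cell.int x.q, Cell.int x.l]) T₁ T₂ _
    ((r.j + 1) * P.b) J ?_ hT₂ ?_ ?_ hR ?_ hN ?_ ?_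
  · intro x hx
    rw [← (hs x hx).2]
    have := Nat.lt_div_mul_add (a := x.p) hb
    rw [add_mul]; omega
  · rintro pre r' β' v ⟨rfl, hk, -⟩
    exact ⟨rfl, by rw [hk.j]⟩
  · rintro pre r' β' v y k io ⟨h0, hk, h⟩
    refine ⟨h0, hk.trans ⟨rfl, rfl, fun s hs => ?_, fun s hs => ?_⟩, h⟩ <;> simp [hs]
  · refine ⟨rfl, Keep'.refl _ _, hlen, ?_, rfl⟩
    rintro u hu (h | ⟨x, hx, -⟩)
    · exact hY u hu h
    · simp at hx
  · rintro pre x post ws r1 β1 e1 hpre ⟨rfl, hk1, hlen1, hK1, hv⟩ hR1 ok1 _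
    refine wp_seq (wp_nextTriple (bl := bl) (p := x.p) (q := x.q) (l := x.l) (ws := ws)
      (fun _ _ _ _ _ _ => rfl) rfl hR1 (by omega) ?_)
    intro y k io e2 r2 hr2 R2 he2 ok2
    have hx := hT₁ x (by simp [hpre])
    obtain ⟨hq, hp⟩ := hs x (by simp [hpre])
    have hrY : copyWithin r2.Y (r2.p % P.b) (r2.q % P.b) r2.l =
        copyWithin r1.Y (x.p % P.b) (x.q % P.b) x.l := by rw [hr2]
    have hlen2 : (copyWithin r1.Y (x.p % P.b) (x.q % P.b) x.l).length = P.b := by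
      rw [copyWithin_length, hlen1]
    have hqd : r.j * P.b + x.q % P.b = x.q := by rw [← hq, mul_comm]; exact Nat.div_add_mod _ _
    have hpd : r.j * P.b + x.p % P.b = x.p := by rw [← hp, mul_comm]; exact Nat.div_add_mod _ _
    have hqs := hx.qseg
    have hps := hx.pseg
    have hlt := hx.lt
    -- With `Z` the string itself, shifted to the segment, known symbols and the repetition of the
    -- phrase become statements on one fixed function, and overlapping copies need no separate
    -- treatment.
    have hget := copyWithin_getD_right (Y := r1.Y) (Z := fun u => X.getD (r.j * P.b + u) 0)
      (p := x.p % P.b) (q := x.q % P.b) (l := x.l) (by omega) (by omega)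
      (fun u _ hu => hK1 u (by omega) (hcov pre x post hpre _ (by omega) (by omega)))
      (fun t ht => by
        rw [← add_assoc, ← add_assoc, hpd, hqd]
        exact hx.copy_getD ht)
    refine wp_assign fun _ _ => ?_
    rw [hrY]
    have ok3 : RamOK P { r2 with Y := copyWithin r1.Y (x.p % P.b) (x.q % P.b) x.l } :=
      { ok2 with
        Y_len := hlen2.le
        Y_lt := copyWithin_lt (by have := ctx.two_le_sigma; omega) ok1.Y_lt _ _ _ }
    refine ⟨ok3, R2.congr rfl rfl, rfl, hk1.trans ⟨?_, ?_, fun s hs => ?_, fun s hs => ?_⟩, hlen2,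
      ?_, ?_⟩
    · rw [hr2]
    · rw [hr2]
    · rw [hr2]; simp [hs]
    · rw [hr2]; simp [hs]
    · intro u hu hc
      dsimp only
      rw [hget]
      by_cases h : x.q % P.b ≤ u ∧ u < x.q % P.b + x.l
      · rw [if_pos h]
      · rw [if_neg h]
        rw [covP_append, ← or_assoc] at hc
        rcases hc with hc | hc
        · exact hK1 u hu hc
        · omega
    · have : rem bl Slot.same { r2 with Y := copyWithin r1.Y (x.p % P.b) (x.q % P.b) x.l } =
        rem bl Slot.same r2 := rfl
      rw [this]
      omega
  · rintro r1 β1 v e1 ok1 _ ⟨rfl, hk1, hlen1, hK1, hv⟩ hev hR1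
    exact hQ r1 e1 ok1 hk1 hlen1 hK1 hR1 (by omega)

/-- Entries carry their strings, so they can be processed in any order and nothing is read from the
array. -/
theorem wp_recoverFar {T : List Part} {S : ℕ → Prop} (ctx : Ctx P X)
    (hT : ∀ x ∈ T, PartOK P X x) (hs : ∀ x ∈ T, x.q / P.b = r.j)
    (hbl : (β (File.Q 0 r.j)).flatten = T.flatMap (qenc P X))
    (hN : (β (File.Q 0 r.j)).length + 1 ≤ P.N) (hlen : r.Y.length = P.b)
    (hY : Known P X r.j S r.Y)
    (hQ : ∀ r' e', RamOK P r' → Keep' Slot.scan r r' → r'.Y.length = P.b →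
      Known P X r.j (fun v => S v ∨ CovP T v) r'.Y →
      e' ≤ e + (β (File.Q 0 r.j)).length + 1 → Q r' β e') :
    WP P P.recoverFar r β e Q := by
  have hb := ctx.b_pos
  have hdn := ctx.d_le
  have hN' : P.N = 8 * P.n + 8 := rfl
  set bl := β (File.Q 0 r.j) with hbl'
  refine wp_seq (wp_rewind ?_)
  intro r0 hr0 ok0
  let J : List Part → Ram → Store → ℕ → Prop := fun pre r' β' v => β' = β ∧
    Keep' Slot.scan r r' ∧ r'.Y.length = P.b ∧ Known P X r.j (fun v => S v ∨ CovP pre v) r'.Y ∧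
    v = e + bl.length
  refine wp_whileMore (bl := bl) (a := 0) (qenc P X) T J (fun x _ => by simp [qenc]) ?_ ?_ ?_ ?_ hN ?_ ?_
  · rintro pre r' β' v ⟨rfl, hk, -⟩
    rw [hk.j]
  · rintro pre r' β' v y k io ⟨h0, hk, h⟩
    refine ⟨h0, hk.trans ⟨rfl, rfl, fun s hs => ?_, fun s hs => ?_⟩, h⟩ <;> simp [hs]
  · rw [← hbl]
    exact rd_start (by rw [hr0]; simp) (by rw [hr0]; simp)
  · refine ⟨rfl, ⟨by rw [hr0], by rw [hr0], fun s hs => ?_, fun s hs => ?_⟩, by rw [hr0]; exact hlen,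
      ?_, ?_⟩
    · rw [hr0]; simp [hs]
    · rw [hr0]; simp [hs]
    · rintro u hu (h | ⟨x, hx, -⟩)
      · rw [hr0]; exact hY u hu h
      · simp at hx
    · rw [rem, hr0]; simp
  · rintro pre x post r1 β1 e1 hpre ⟨rfl, hk1, hlen1, hK1, hv⟩ hR1 _ ok1 _
    have hx := hT x (by simp [hpre])
    have hq := hs x (by simp [hpre])
    have hqd : r.j * P.b + x.q % P.b = x.q := by rw [← hq, mul_comm]; exact Nat.div_add_mod _ _
    have hxle := hx.le
    have hqs := hx.qseg
    have hF : ∀ r' : Ram, r'.j = r.j → β1 (File.Q 0 r'.j) = bl := by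
      intro r' h; rw [h]
    refine wp_seq (wp_next (bl := bl) (x := Cell.int x.q) (hF _ hk1.j) hR1 (by omega) ?_)
    intro y2 k2 io2 e2 r2 hr2 ok2 hc2 R2 he2
    have j2 : r2.j = r.j := by rw [hr2]; exact hk1.j
    refine ⟨{ ok2 with q := hc2 }, ?_⟩
    refine wp_seq (wp_next (bl := bl) (a := 0) (x := Cell.int x.l) (hF _ j2)
      (R2.congr rfl rfl) (by omega) ?_)
    intro y3 k3 io3 e3 r3 hr3 ok3 hc3 R3 he3
    refine ⟨{ ok3 with l := hc3 }, ?_⟩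
    let I : ℕ → Ram → Store → ℕ → Prop := fun l r' β' e' => β' = β1 ∧ Keep' Slot.scan r r' ∧
      -- The equation for `q` is guarded by `0 < l`: the register advances by a full `d` even after
      -- a shorter last word and then overshoots the end of the part.
      r'.l = l ∧ l ≤ x.l ∧ r'.Y.length = P.b ∧ (0 < l → r'.q + l = x.q + x.l) ∧
      Known P X r.j (fun v => (S v ∨ CovP pre v) ∨ (x.q ≤ v ∧ v < x.q + (x.l - l))) r'.Y ∧
      Rd bl Slot.scan 0 r' (pack P.d (slice X (x.q + (x.l - l)) l) ++ post.flatMap (qenc P X)) ∧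
      e' + rem bl Slot.scan r' = e + bl.length
    refine wp_loop I id x.l ⟨rfl, hk1.trans ⟨?_, ?_, fun s hs => ?_, fun s hs => ?_⟩, rfl, le_rfl, ?_, ?_,
      ?_, ?_, ?_⟩ ?_ ?_
    · rw [hr3, hr2]
    · rw [hr3, hr2]
    · rw [hr3, hr2]; simp [hs]
    · rw [hr3, hr2]; simp [hs]
    · rw [hr3, hr2]; exact hlen1
    · intro _; rw [hr3, hr2]; rfl
    · have : r3.Y = r1.Y := by rw [hr3, hr2]
      dsimp only
      rw [this]
      intro u hu hc
      rcases hc with hc | hc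
      · exact hK1 u hu hc
      · omega
    · rw [Nat.sub_self, add_zero]
      exact R3.congr rfl rfl
    · have h1 : rem bl Slot.scan { r3 with l := (Cell.int x.l).val } = rem bl Slot.scan r3 := rfl
      have h2 : rem bl Slot.scan { r2 with q := (Cell.int x.q).val } = rem bl Slot.scan r2 := rfl
      rw [h1]
      omega
    · rintro l r4 β4 e4 ok4 _ ⟨rfl, hk4, rfl, hl4, hlen4, hq4, hK4, hR4, he4⟩ hb4
      have hlpos : 0 < r4.l := by simpa using hb4
      have hq4 := hq4 hlpos
      have hsl : (slice X (x.q + (x.l - r4.l)) r4.l).length = r4.l :=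
        slice_length (by rw [ctx.len]; omega)
      rw [pack_of_ne_nil P.d_pos (by rw [← List.length_pos_iff]; omega)] at hR4
      refine wp_next (bl := bl) (hF _ hk4.j) hR4 (by omega) ?_
      intro y5 k5 io5 e5 r5 hr5 ok5 hc5 R5 he5
      set s := (slice X (x.q + (x.l - r4.l)) r4.l).take P.d with hsd
      have hs5 : s = slice X r4.q (min P.d r4.l) := by
        rw [hsd, show x.q + (x.l - r4.l) = r4.q by omega, slice, slice, List.take_take]
      have hslen : s.length = min P.d r4.l := by
        rw [hs5]; exact slice_length (by rw [ctx.len]; omega)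
      have hqm : r4.q % P.b = x.q % P.b + (x.l - r4.l) := by
        have h1 : r4.q = x.q % P.b + (x.l - r4.l) + r.j * P.b := by omega
        rw [h1, Nat.add_mul_mod_self_right, Nat.mod_eq_of_lt (by omega)]
      have hrY : overwrite r5.Y (r5.q % P.b) (Cell.str s).syms = overwrite r4.Y (r4.q % P.b) s := by
        rw [hr5]; rfl
      have q5 : r5.q = r4.q := by rw [hr5]
      have l5 : r5.l = r4.l := by rw [hr5]
      have hle : r4.q % P.b + s.length ≤ r4.Y.length := by omega
      have hlen5 := overwrite_length hle
      rw [hrY]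
      refine ⟨{ ok5 with
        Y_len := by dsimp only; omega
        Y_lt := overwrite_lt ok4.Y_lt hc5.2 _
        q := by dsimp only; omega
        l := by dsimp only; have := ok5.l; omega }, r4.l - P.d, ?_, rfl,
        hk4.trans ⟨?_, ?_, fun s hs => ?_, fun s hs => ?_⟩, ?_, by omega, hlen5.trans hlen4, ?_, ?_, ?_, ?_⟩
      · have := P.d_pos
        simp only [id]; omega
      · rw [hr5]
      · rw [hr5]
      · rw [hr5]; simp [hs]
      · rw [hr5]; simp [hs]
      · dsimp only; rw [l5]
      · dsimp only; intro _; omega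
      · intro u hu hc
        dsimp only
        rw [overwrite_getD hle, hslen]
        by_cases h : r4.q % P.b ≤ u ∧ u < r4.q % P.b + min P.d r4.l
        · rw [if_pos h, hs5, slice_getD (by omega)]
          congr 1; omega
        · rw [if_neg h]
          refine hK4 u hu ?_
          rcases hc with hc | hc
          · exact Or.inl hc
          · right; omega
      · rw [slice_drop] at R5
        rcases Nat.lt_or_ge P.d r4.l with h | h
        · rw [show x.q + (x.l - (r4.l - P.d)) = x.q + (x.l - r4.l) + P.d by omega]
          exact R5.congr rfl rfl
        · have h0 : r4.l - P.d = 0 := by omega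
          rw [h0] at R5 ⊢
          simp only [slice, List.take_zero] at R5 ⊢
          exact R5.congr rfl rfl
      · refine Eq.trans ?_ (he5.trans he4)
        rfl
    · rintro l r4 β4 e4 ok4 _ ⟨rfl, hk4, rfl, hl4, hlen4, hq4, hK4, hR4, he4⟩ hb4
      have hl0 : r4.l = 0 := by simpa using hb4
      rw [hl0] at hR4 hK4
      refine ⟨?_, rfl, hk4, hlen4, ?_, he4⟩
      · simpa [slice, pack_nil P.d_pos] using hR4
      · intro u hu hc
        refine hK4 u hu ?_
        rw [covP_append, ← or_assoc] at hc
        simpa using hc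
  · rintro r1 β1 v e1 ok1 _ ⟨rfl, hk1, hlen1, hK1, hv⟩ hev hR1
    exact hQ r1 e1 ok1 hk1 hlen1 hK1 (by omega)

end

/-! Writing a segment to the output. -/

theorem pack_drop {d : ℕ} (hd : 1 ≤ d) (k : ℕ) (s : List ℕ) :
    (pack d s).drop k = pack d (s.drop (k * d)) := by
  induction k generalizing s with
  | zero => simp
  | succ k ih =>
    rcases eq_or_ne s [] with rfl | hs
    · simp [pack_nil hd]
    · rw [pack_of_ne_nil hd hs, List.drop_succ_cons, ih, List.drop_drop, add_mul, one_mul,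
        add_comm]

theorem pack_take {d : ℕ} (hd : 1 ≤ d) (k : ℕ) (s : List ℕ) :
    (pack d s).take k = pack d (s.take (k * d)) := by
  induction k generalizing s with
  | zero => simp [pack_nil hd]
  | succ k ih =>
    rcases eq_or_ne s [] with rfl | hs
    · simp [pack_nil hd]
    · have h0 : s.take ((k + 1) * d) ≠ [] := by
        have := List.length_pos_iff.2 hs
        have h1 : 0 < (k + 1) * d := by positivity
        rw [← List.length_pos_iff, List.length_take]; omega
      rw [pack_of_ne_nil hd hs, pack_of_ne_nil hd h0, List.take_succ_cons, ih, List.take_take,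
        List.drop_take]
      have h2 : d ≤ (k + 1) * d := Nat.le_mul_of_pos_left _ (by omega)
      have h3 : (k + 1) * d - d = k * d := by rw [add_mul, one_mul, Nat.add_sub_cancel]
      rw [Nat.min_eq_left h2, h3]

theorem blockOf_pack {d : ℕ} (hd : 1 ≤ d) (B k : ℕ) (s : List ℕ) :
    blockOf B (pack d s) k = pack d (slice s (k * B * d) (B * d)) := by
  rw [blockOf, pack_drop hd, pack_take hd]; rfl

theorem cellOK_of_mem_pack {P : Params} {s : List ℕ} (hs : ∀ x ∈ s, x < P.σ) {y : Cell}
    (hy : y ∈ pack P.d s) : CellOK P y := by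
  simp only [pack, List.mem_map] at hy
  obtain ⟨t, -, rfl⟩ := hy
  exact ⟨by simp, fun x hx => hs x (List.mem_of_mem_drop (List.mem_of_mem_take hx))⟩

/-- The first `k` blocks of the output. -/
def outBlocks (P : Params) (X : List ℕ) (k : ℕ) : List (List Cell) :=
  (List.range k).map (blockOf P.B (pack P.d X))

theorem outBlocks_succ (P : Params) (X : List ℕ) (k : ℕ) :
    outBlocks P X (k + 1) = outBlocks P X k ++ [blockOf P.B (pack P.d X) k] := by
  simp [outBlocks, List.range_succ]

/-- The first `k` blocks have been written when the first `j` segments are recovered. -/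
structure OutCnt (P : Params) (j k : ℕ) : Prop where
  eq : j * P.b < P.n → k = j * (P.m / P.B)
  lt : k * (P.B * P.d) < P.n + P.B * P.d
  le : P.n ≤ j * P.b → P.n ≤ k * (P.B * P.d)

/-- The last segment may be shorter than `b`; the truncation discards the stale symbols behind the
end of the string. -/
theorem Known.take_eq {P : Params} {X Y : List ℕ} {j : ℕ} (hX : X.length = P.n)
    (hlen : Y.length = P.b) (h : Known P X j (fun v => v < P.n) Y) :
    Y.take (P.n - j * P.b) = slice X (j * P.b) P.b := by
  refine List.ext_getElem ?_ fun u h1 h2 => ?_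
  · simp only [slice, List.length_take, List.length_drop]; omega
  · simp only [List.length_take] at h1
    have := h u (by omega) (by dsimp only; omega)
    rw [List.getD_eq_getElem _ _ (by omega), List.getD_eq_getElem _ _ (by omega)] at this
    simp only [slice, List.getElem_take, List.getElem_drop]
    exact this

/-- As `B` divides `m`, a full segment fills exactly `m / B` blocks. Hence no output block contains
symbols of two segments, and blocks of the segment are blocks of the packed string. -/
theorem wp_writeSegment {P : Params} {X : List ℕ} {β : Store} {r : Ram} {e : ℕ}
    {Q : Ram → Store → ℕ → Prop} (ctx : Ctx P X) (hlen : r.Y.length = P.b)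
    (hY : Known P X r.j (fun v => v < P.n) r.Y) (hj : r.j * P.b < P.n)
    (hβ : β File.output = outBlocks P X (r.j * (P.m / P.B)))
    (hQ : ∀ r' β' e' t k, RamOK P r' → r' = { r with t := t, io := [] } ∨ r' = { r with t := t } →
      β' File.output = outBlocks P X k → (∀ F, F ≠ File.output → β' F = β F) →
      OutCnt P (r.j + 1) k → e' + r.j * (P.m / P.B) = e + k → Q r' β' e') :
    WP P P.writeSegment r β e Q := by
  have hd := P.d_pos
  have hB := ctx.B_pos
  have hN' : P.N = 8 * P.n + 8 := rfl
  have hBd : 0 < P.B * P.d := Nat.mul_pos hB hd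
  have hm : P.m / P.B * P.B = P.m := Nat.div_mul_cancel ctx.adm.dvd
  have hb : P.m / P.B * (P.B * P.d) = P.b := by rw [← mul_assoc, hm, mul_comm]; rfl
  set mB := P.m / P.B with hmB
  refine wp_seq (wp_assign fun ok _ => ⟨{ ok with t := Nat.zero_le _ }, ?_⟩)
  let I : ℕ → Ram → Store → ℕ → Prop := fun u r' β' e' => ∃ t, u = mB - t ∧ t ≤ mB ∧
    (r' = { r with t := t, io := [] } ∨ r' = { r with t := t }) ∧
    β' File.output = outBlocks P X (r.j * mB + t) ∧ (∀ F, F ≠ File.output → β' F = β F) ∧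
    (r.j * mB + t) * (P.B * P.d) < P.n + P.B * P.d ∧ e' = e + t
  have hk : ∀ t, (r.j * mB + t) * (P.B * P.d) = r.j * P.b + t * (P.B * P.d) := by
    intro t; rw [add_mul, mul_assoc, hb]
  refine wp_loop I id mB ⟨0, rfl, Nat.zero_le _, Or.inr rfl, hβ, fun _ _ => rfl, ?_, rfl⟩ ?_ ?_
  · rw [hk]; omega
  · rintro _ r1 β1 e1 ok1 _ ⟨t, rfl, ht, h1, hβ1, hf1, hlt1, rfl⟩ hc
    have j1 : r1.j = r.j := by rcases h1 with h | h <;> rw [h]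
    have t1 : r1.t = t := by rcases h1 with h | h <;> rw [h]
    have Y1 : r1.Y = r.Y := by rcases h1 with h | h <;> rw [h]
    rw [decide_eq_true_eq, j1, t1] at hc
    obtain ⟨htm, htn⟩ := hc
    have hblk : blockOf P.B (pack P.d (r1.Y.take (P.n - r1.j * P.b))) r1.t =
        blockOf P.B (pack P.d X) (r.j * mB + t) := by
      rw [Y1, j1, t1, hY.take_eq ctx.len hlen, blockOf_pack hd, blockOf_pack hd]
      congr 1
      rw [mul_assoc, mul_assoc, hk]
      have h2 : (t + 1) * (P.B * P.d) ≤ P.b := by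
        rw [← hb]; exact Nat.mul_le_mul_right _ htm
      rw [add_mul, one_mul] at h2
      rw [slice, slice_drop, slice, slice, List.take_take, Nat.min_eq_left (by omega)]
    have hlenX : (slice X ((r.j * mB + t) * P.B * P.d) (P.B * P.d)) ≠ [] := by
      rw [← List.length_pos_iff, slice, List.length_take, List.length_drop, ctx.len, mul_assoc, hk]
      omega
    refine wp_seq (wp_assign fun _ _ => ?_)
    rw [hblk]
    refine ⟨{ ok1 with io := ⟨by simp [blockOf], fun y hy => ?_⟩ }, ?_⟩
    · exact cellOK_of_mem_pack ctx.lt (List.mem_of_mem_drop (List.mem_of_mem_take hy))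
    refine wp_seq (wp_writeOutput ?_ ?_ fun ok2 => wp_assign fun _ _ =>
      ⟨{ ok2 with io := ⟨by simp, by simp⟩, t := ?_ }, mB - (t + 1), by simp only [id]; omega,
        t + 1, rfl, htm, Or.inl ?_, ?_, fun F hF => ?_, ?_, by omega⟩)
    · dsimp only
      rw [hβ1, j1, t1]
      simp [outBlocks, ← hmB]
    · dsimp only
      rw [blockOf_pack hd, pack_of_ne_nil hd hlenX]
      simp
    · dsimp only
      have : t * 1 ≤ t * (P.B * P.d) := Nat.mul_le_mul_left _ hBd
      omega
    · rcases h1 with h | h <;> rw [h]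
    · rw [update_self, hβ1, ← outBlocks_succ, add_assoc]
    · rw [update_of_ne hF, hf1 F hF]
    · rw [hk, add_mul, one_mul]; omega
  · rintro _ r1 β1 e1 ok1 _ ⟨t, rfl, ht, h1, hβ1, hf1, hlt1, rfl⟩ hc
    have j1 : r1.j = r.j := by rcases h1 with h | h <;> rw [h]
    have t1 : r1.t = t := by rcases h1 with h | h <;> rw [h]
    rw [decide_eq_false_iff_not, j1, t1] at hc
    refine hQ r1 β1 _ t _ ok1 h1 hβ1 hf1 ⟨fun h => ?_, hlt1, fun h => ?_⟩ (by omega)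
    · rw [add_mul, one_mul] at h ⊢
      rcases Nat.lt_or_ge t mB with h2 | h2
      · have h3 : ¬ r.j * P.b + t * (P.B * P.d) < P.n := fun h3 => hc ⟨h2, h3⟩
        have h4 : t * (P.B * P.d) ≤ mB * (P.B * P.d) := Nat.mul_le_mul_right _ ht
        omega
      · change r.j * mB + t = r.j * mB + mB
        omega
    · rw [hk]
      rw [add_mul, one_mul] at h
      rcases Nat.lt_or_ge t mB with h2 | h2
      · have h3 : ¬ r.j * P.b + t * (P.B * P.d) < P.n := fun h3 => hc ⟨h2, h3⟩
        omega
      · have : t = mB := by omega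
        rw [this, hb]; omega

/-! Emission of the far parts with their source in the recovered segment. -/

theorem stable_R₀ : Stable fun r => File.R 0 r.j := by
  intro r r' h1 h2 h3 h4
  simp [h3]

/-- The parts in `T` whose segment meets segment `j` at level `lev`. -/
def meeting (P : Params) (lev j : ℕ) (T : List Part) : List Part :=
  T.filter fun x => P.meetAt lev j (x.q / P.b)

/-- The symbols are taken from the array at the source, but by the repetition they are the symbols
at the target. A queue entry can therefore be described without its source. -/
theorem Known.drop_take_eq {P : Params} {X Y : List ℕ} {x : Part} {t : ℕ} (ctx : Ctx P X)
    (hx : PartOK P X x) (hlen : Y.length = P.b)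
    (hY : Known P X (x.p / P.b) (fun v => v < P.n) Y) (ht : t ≤ x.l) :
    (Y.drop (x.p % P.b + t)).take (min P.d (x.l - t)) =
      (slice X (x.q + t) (x.l - t)).take P.d := by
  have h1 := hx.pseg
  have h2 := hx.le
  have h3 := hx.lt
  have hX := ctx.len
  have hp : x.p / P.b * P.b + x.p % P.b = x.p := by rw [mul_comm]; exact Nat.div_add_mod _ _
  rw [slice, List.take_take]
  refine List.ext_getElem ?_ fun u h4 h5 => ?_
  · simp only [List.length_take, List.length_drop]; omega
  · simp only [List.length_take, List.length_drop] at h4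
    have h6 := hY (x.p % P.b + (t + u)) (by omega) (by dsimp only; omega)
    rw [← add_assoc (_ * _), hp, hx.copy_getD (by omega), List.getD_eq_getElem _ _ (by omega),
      List.getD_eq_getElem _ _ (by omega)] at h6
    simp only [List.getElem_take, List.getElem_drop]
    simpa only [add_assoc] using h6

/-- A pass reads all parts with source in the segment and writes those that meet it at the current
level. The cost is charged as if all of them were written; summed over `L` passes this is still
within the claim. -/
theorem wp_emitScan {P : Params} {X : List ℕ} {β₀ : Store} {r : Ram} {e : ℕ}
    {Q : Ram → Store → ℕ → Prop} {T : List Part} (ctx : Ctx P X) (hf : P.f ≤ P.n)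
    (hTok : ∀ x ∈ T, PartOK P X x) (hTj : ∀ x ∈ T, x.p / P.b = r.j) (hT : wt P X T ≤ 3 * P.n)
    (h0 : ∀ c < P.f, (β₀ (File.Q (r.lev - 1) (r.i * P.f + c))).flatten.length ≤ 3 * P.n)
    (hR : Rd (β₀ (File.R 0 r.j)) Slot.scan 0 r (T.flatMap trip))
    (hN : (β₀ (File.R 0 r.j)).length + 1 ≤ P.N) (hout : r.out = fun _ => [])
    (hlen : r.Y.length = P.b) (hY : Known P X r.j (fun v => v < P.n) r.Y)
    (hQ : ∀ r' β' e', RamOK P r' → Keep r r' → r'.lev = r.lev → r'.i = r.i →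
      Wr P P.f (fun c => File.Q (r.lev - 1) (r.i * P.f + c)) β₀
        (distW (fun x => x.q / P.b / P.f ^ (r.lev - 1) % P.f) (qenc P X) (meeting P r.lev r.j T))
        r' β' →
      P.B * e' + 3 * tot P.f r' ≤
        P.B * (e + rem (β₀ (File.R 0 r.j)) Slot.scan r + 1) + 3 * wt P X T → Q r' β' e') :
    WP P (whileMore Slot.scan (fun r => File.R 0 r.j)
        (nextTriple Slot.scan (fun r => File.R 0 r.j) ;;
          Prog.cond (fun r => P.meetAt r.lev r.j (r.q / P.b))
            (Prog.assign (fun r =>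
                { r with c := r.q / P.b / P.f ^ (r.lev - 1) % P.f, t := 0 }) ;;
              P.put (fun r => File.Q (r.lev - 1) (r.i * P.f + r.c)) (fun r => Cell.int r.q) ;;
              P.put (fun r => File.Q (r.lev - 1) (r.i * P.f + r.c)) (fun r => Cell.int r.l) ;;
              Prog.loop (fun r => decide (r.t < r.l))
                (P.put (fun r => File.Q (r.lev - 1) (r.i * P.f + r.c))
                    (fun r => Cell.str ((r.Y.drop (r.p % P.b + r.t)).take (min P.d (r.l - r.t)))) ;;
                  Prog.assign (fun r => { r with t := r.t + P.d })))
            Prog.skip)) r β₀ e Q := by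
  set bl := β₀ (File.R 0 r.j) with hbl'
  set g : Part → ℕ := fun x => x.q / P.b / P.f ^ (r.lev - 1) % P.f with hg
  set G : ℕ → File := fun c => File.Q (r.lev - 1) (r.i * P.f + c) with hG
  have hN' : P.N = 8 * P.n + 8 := rfl
  have hf4 := ctx.adm.four_le
  have hdn := ctx.d_le
  have hGinj : ∀ c < P.f, ∀ c' < P.f, G c = G c' → c = c' := by
    intro c _ c' _ h
    simpa [hG] using h
  have hGR : ∀ j c, File.R 0 j ≠ G c := by simp [hG]
  let J : List Part → Ram → Store → ℕ → Prop := fun pre r' β' v =>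
    Keep r r' ∧ r'.lev = r.lev ∧ r'.i = r.i ∧
    Wr P P.f G β₀ (distW g (qenc P X) (meeting P r.lev r.j pre)) r' β' ∧
    P.B * v + 3 * tot P.f r' ≤ P.B * (e + rem bl Slot.scan r) + 3 * wt P X pre
  have hF : ∀ r' β', r'.j = r.j → ∀ W, Wr P P.f G β₀ W r' β' → β' (File.R 0 r'.j) = bl := by
    intro r' β' h1 W hW
    rw [h1]
    exact hW.frame _ fun c _ => hGR _ c
  refine wp_whileMore (bl := bl) (a := 0) trip T J (fun x _ => by simp [trip]) ?_ ?_ hR ?_ hN ?_ ?_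
  · rintro pre r' β v ⟨h1, _, _, h3, _⟩
    exact hF _ _ h1.j _ h3
  · rintro pre r' β v y k io ⟨h1, h2, h3, h4, h5⟩
    refine ⟨h1.trans ⟨rfl, rfl, fun s hs => ?_, fun s hs => ?_⟩, h2, h3, h4.congr rfl, h5⟩ <;> simp [hs]
  · refine ⟨Keep.refl _, rfl, rfl, wr_start ctx.B_pos hout, ?_⟩
    rw [tot_start hout]; simp
  · rintro pre x post r2 β2 e2 hpre ⟨hk2, hl2, hi2, hW2, hc2⟩ hR2 _ ok2 _
    have hxok := hTok x (by simp [hpre])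
    have hxj := hTj x (by simp [hpre])
    have hxle := hxok.le
    have hxlen : wt P X pre + (qenc P X x).length ≤ 3 * P.n := by
      rw [hpre] at hT
      simp only [wt, List.flatMap_append, List.flatMap_cons, List.length_append] at hT ⊢
      omega
    refine wp_seq (wp_nextTriple stable_R₀ (hF _ _ hk2.j _ hW2) hR2 (by omega) ?_)
    intro y k io e3 r3 hr3 R3 he3 ok3
    have l3 : r3.lev = r.lev := by rw [hr3]; exact hl2
    have i3 : r3.i = r.i := by rw [hr3]; exact hi2
    have j3 : r3.j = r.j := by rw [hr3]; exact hk2.j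
    have q3 : r3.q = x.q := by rw [hr3]
    have p3 : r3.p = x.p := by rw [hr3]
    have x3 : r3.l = x.l := by rw [hr3]
    have Y3 : r3.Y = r.Y := by rw [hr3]; exact hk2.Y
    have o3 : r3.out = r2.out := by rw [hr3]
    have k3 : Keep r r3 := hk2.trans ⟨by rw [hr3], by rw [hr3],
      fun s hs => by rw [hr3]; simp [hs], fun s hs => by rw [hr3]; simp [hs]⟩
    have hwx : wt P X (pre ++ [x]) = wt P X pre + (qenc P X x).length := by
      simp [wt]
    refine wp_cond (fun hb => ?_) (fun hb => ?_)
    · rw [l3, j3, q3] at hb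
      have hm : meeting P r.lev r.j (pre ++ [x]) = meeting P r.lev r.j pre ++ [x] := by
        simp [meeting, List.filter_append, hb]
      have hgf : g x < P.f := Nat.mod_lt _ (by omega)
      have hgx : r3.q / P.b / P.f ^ (r3.lev - 1) % P.f = g x := by rw [q3, l3]
      refine wp_seq (wp_assign fun _ _ => ?_)
      rw [hgx]
      refine ⟨{ ok3 with c := by dsimp only; omega, t := Nat.zero_le _ }, ?_⟩
      set r4 : Ram := { r3 with c := g x, t := 0 } with hr4
      have c4 : r4.c = g x := rfl
      have o4 : r4.out = r2.out := o3
      -- Unlike in the distributions the queues need not be empty here: up to `3 * n` old and `3 *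
      -- n` new words, which `Params.N` has to accommodate.
      have hdl : ∀ c, (β₀ (G (g x))).flatten.length +
          (distW g (qenc P X) (meeting P r.lev r.j pre) c).length + (qenc P X x).length
            ≤ 6 * P.n := by
        intro c
        have h1 := h0 _ hgf
        have h2 := distW_length_le g (qenc P X) (meeting P r.lev r.j pre) c
        have h3 : wt P X (meeting P r.lev r.j pre) ≤ wt P X pre := wt_filter_le _ _ _ _
        simp only [hG]
        unfold wt at h3 hxlen
        omega
      have hGc : ∀ c' < P.f, G (g x) = G c' → g x = c' := fun c h => hGinj _ hgf c h
      have hq2 : 2 ≤ (qenc P X x).length := by simp [qenc]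
      refine wp_seq (wp_put (hW2.congr o4) (stable_Q P) hgf le_rfl hGc
        (by simp only [hG, hr4, l3, i3]) (by simp) (by simp) ok3.q ?_ ?_)
      · have := hdl (g x); rw [c4]; omega
      intro o5 k5 io5 β5 e5 r5 hr5 W5 he5 ok5
      have l5 : r5.lev = r.lev := by rw [hr5]; exact l3
      have i5 : r5.i = r.i := by rw [hr5]; exact i3
      have c5 : r5.c = g x := by rw [hr5]
      rw [c4] at W5
      refine wp_seq (wp_put W5 (stable_Q P) (by rw [c5]; exact hgf) le_rfl (by rw [c5]; exact hGc)
        (by simp only [hG, c5, l5, i5]) (by simp) (by simp) ok5.l ?_ ?_)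
      · have := hdl (g x)
        rw [c5]
        simp only [addW, update_self, List.length_append, List.length_singleton]
        omega
      intro o6 k6 io6 β6 e6 r6 hr6 W6 he6 ok6
      rw [c5, addW_addW] at W6
      have hq5 : r4.q = x.q := q3
      have hl5 : r5.l = x.l := by rw [hr5]; exact x3
      rw [hq5, hl5] at W6
      have hrem : ∀ r' : Ram, r'.pos = r3.pos → rem bl Slot.scan r' = rem bl Slot.scan r3 :=
        fun r' h => rem_congr (by rw [h])
      let I : ℕ → Ram → Store → ℕ → Prop := fun t r' β' e' => r'.t = t ∧ t ≤ x.l + P.d ∧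
        (∃ o k io, r' = { r3 with c := g x, t := t, out := o, cnt := k, io := io }) ∧
        ∃ wr, wr ++ pack P.d (slice X (x.q + t) (x.l - t)) = qenc P X x ∧
          Wr P P.f G β₀ (addW (distW g (qenc P X) (meeting P r.lev r.j pre)) (g x) wr) r' β' ∧
          P.B * (e' + rem bl Slot.scan r3) + 3 * tot P.f r' ≤
            P.B * (e + rem bl Slot.scan r) + 3 * wt P X pre + 3 * wr.length
      refine wp_loop I (fun t => x.l - t) 0 ⟨by rw [hr6, hr5], Nat.zero_le _,
        ⟨o6, k6, io6, by rw [hr6, hr5]⟩, _, rfl, W6, ?_⟩ ?_ ?_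
      · have htot : tot P.f r4 = tot P.f r2 := tot_congr o4
        rw [htot] at he5
        have he8 := congrArg (P.B * ·) he3
        simp only [mul_add] at he8 hc2 ⊢
        simp only [List.length_append, List.length_singleton]
        omega
      · rintro t r7 β7 e7 ok7 _ ⟨ht7, htd, ⟨o7, k7, io7, hr7⟩, wr, hwr, W7, hc7⟩ hb7
        have x7 : r7.l = x.l := by rw [hr7]; exact x3
        have htl : t < x.l := by
          rw [decide_eq_true_eq, ht7, x7] at hb7; exact hb7
        have l7 : r7.lev = r.lev := by rw [hr7]; exact l3
        have i7 : r7.i = r.i := by rw [hr7]; exact i3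
        have c7 : r7.c = g x := by rw [hr7]
        have hsl : (slice X (x.q + t) (x.l - t)).length = x.l - t :=
          slice_length (by rw [ctx.len]; omega)
        rw [pack_of_ne_nil P.d_pos (by rw [← List.length_pos_iff]; omega), slice_drop] at hwr
        have hwlen := congrArg List.length hwr
        simp only [List.length_append, List.length_cons] at hwlen
        have hstr : (r7.Y.drop (r7.p % P.b + r7.t)).take (min P.d (r7.l - r7.t)) =
            (slice X (x.q + t) (x.l - t)).take P.d := by
          have Y7 : r7.Y = r.Y := by rw [hr7]; exact Y3
          have p7 : r7.p = x.p := by rw [hr7]; exact p3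
          rw [Y7, p7, ht7, x7]
          exact Known.drop_take_eq ctx hxok hlen (by rw [hxj]; exact hY) htl.le
        refine wp_seq (wp_put W7 (stable_Q P) (by rw [c7]; exact hgf) le_rfl
          (by rw [c7]; exact hGc) (by simp only [hG, c7, l7, i7]) (by simp) (by simp) ?_ ?_ ?_)
        · rw [hstr]
          exact ⟨by simp, fun z hz => ctx.lt z (mem_of_mem_slice (List.mem_of_mem_take hz))⟩
        · have := hdl (g x)
          rw [c7]
          simp only [addW, update_self, List.length_append]
          omega
        intro o9 k9 io9 β9 e9 r9 hr9 W9 he9 ok9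
        rw [c7, addW_addW, hstr] at W9
        have t9 : r9.t = t := by rw [hr9]; exact ht7
        refine wp_assign fun _ _ => ?_
        rw [t9]
        refine ⟨{ ok9 with t := by dsimp only; omega }, t + P.d, ?_, rfl, by omega,
          ⟨o9, k9, io9, by rw [hr9, hr7]⟩, wr ++ [Cell.str ((slice X (x.q + t) (x.l - t)).take P.d)],
          ?_, W9.congr rfl, ?_⟩
        · have := P.d_pos; omega
        · rw [← hwr, Nat.sub_add_eq]; simp [add_assoc]
        · have htot' : tot P.f { r9 with t := t + P.d } = tot P.f r9 := rfl
          rw [htot', mul_add]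
          simp only [mul_add] at hc7 ⊢
          simp only [List.length_append, List.length_singleton]
          omega
      · rintro t r7 β7 e7 ok7 _ ⟨ht7, htd, ⟨o7, k7, io7, hr7⟩, wr, hwr, W7, hc7⟩ hb7
        have x7 : r7.l = x.l := by rw [hr7]; exact x3
        have htl : x.l - t = 0 := by
          rw [decide_eq_false_iff_not, ht7, x7] at hb7; omega
        rw [htl] at hwr
        have hs0 : slice X (x.q + t) 0 = [] := by simp [slice]
        rw [hs0, pack_nil P.d_pos, List.append_nil] at hwr
        subst hwr
        rw [distW_append, ← hm] at W7
        refine ⟨R3.congr (by rw [hr7]) (by rw [hr7]), k3.trans ?_, by rw [hr7]; exact l3,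
          by rw [hr7]; exact i3, W7, ?_⟩
        · rw [hr7]; exact ⟨rfl, rfl, fun _ _ => rfl, fun _ _ => rfl⟩
        · rw [hrem r7 (by rw [hr7]), hwx]
          omega
    · rw [l3, j3, q3] at hb
      have hm : meeting P r.lev r.j (pre ++ [x]) = meeting P r.lev r.j pre := by
        simp [meeting, List.filter_append, hb]
      refine wp_skip fun _ _ => ⟨R3, k3, l3, i3, ?_, ?_⟩
      · rw [hm]; exact hW2.congr o3
      · rw [tot_congr o3, hwx]
        rw [he3]
        omega
  · rintro r2 β2 v e2 ok2 _ ⟨hk2, hl2, hi2, hW2, hc2⟩ hev _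
    refine hQ r2 β2 e2 ok2 hk2 hl2 hi2 hW2 ?_
    have h1 : P.B * e2 ≤ P.B * (v + 1) := Nat.mul_le_mul_left _ hev
    simp only [mul_add] at h1 hc2 ⊢
    omega

/-- If a child of the supersegment containing `j` begins after `j`, every target inside it separates
from `j` at exactly this level. So this one pass delivers all its parts. -/
theorem meeting_filter {P : Params} {T : List Part} {l j c : ℕ} (hf : 0 < P.f) (hc : c < P.f)
    (h : j < (j / P.f ^ (l + 1) * P.f + c) * P.f ^ l) :
    (meeting P (l + 1) j T).filter (fun x => x.q / P.b / P.f ^ l % P.f = c) =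
      T.filter fun x => x.q / P.b / P.f ^ l = j / P.f ^ (l + 1) * P.f + c := by
  rw [meeting, List.filter_filter]
  refine List.filter_congr fun x _ => ?_
  rw [Params.meetAt, Nat.add_sub_cancel, ← Bool.decide_and, decide_eq_decide, div_pow_succ,
    div_pow_succ] at *
  have hlt : j / P.f ^ l < j / P.f ^ l / P.f * P.f + c :=
    (Nat.div_lt_iff_lt_mul (pow_pos hf l)).2 h
  generalize x.q / P.b / P.f ^ l = s at *
  generalize j / P.f ^ l = u at *
  have := Nat.div_add_mod s P.f
  constructor
  · rintro ⟨h1, h2, -⟩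
    rw [h2, mul_comm, ← h1]; exact this.symm
  · rintro rfl
    refine ⟨?_, ?_, by omega⟩
    · rw [mul_comm, Nat.mul_add_mod, Nat.mod_eq_of_lt hc]
    · rw [mul_comm (u / P.f), Nat.mul_add_div hf, Nat.div_eq_of_lt hc, add_zero]

/-- Targets lie behind their sources, which rules out children before the one containing `j`; that
child itself is ruled out by `meetAt`. -/
theorem meeting_filter_eq_nil {P : Params} {T : List Part} {l j c : ℕ} (hf : 0 < P.f)
    (hT : ∀ x ∈ T, x.p / P.b = j ∧ x.p < x.q)
    (h : (j / P.f ^ (l + 1) * P.f + c) * P.f ^ l ≤ j) :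
    (meeting P (l + 1) j T).filter (fun x => x.q / P.b / P.f ^ l % P.f = c) = [] := by
  rw [List.filter_eq_nil_iff]
  intro x hx
  obtain ⟨hx, hm⟩ := List.mem_filter.1 hx
  obtain ⟨hp, hq⟩ := hT x hx
  rw [Params.meetAt, Nat.add_sub_cancel, decide_eq_true_eq, div_pow_succ, div_pow_succ] at hm
  rw [div_pow_succ] at h
  have hle : j / P.f ^ l / P.f * P.f + c ≤ j / P.f ^ l := (Nat.le_div_iff_mul_le (pow_pos hf l)).2 h
  have h1 : j / P.f ^ l ≤ x.q / P.b / P.f ^ l := by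
    rw [← hp]
    exact Nat.div_le_div_right (Nat.div_le_div_right hq.le)
  rw [decide_eq_true_eq]
  intro h2
  generalize x.q / P.b / P.f ^ l = s at *
  generalize j / P.f ^ l = u at *
  have h3 := Nat.div_add_mod s P.f
  rw [← hm.1, mul_comm] at h3
  exact hm.2 (by omega)

theorem filter_lt_succ_perm (T : List Part) (A : Part → Prop) [DecidablePred A] (g : Part → ℕ)
    (j : ℕ) : (T.filter (fun x => A x ∧ g x < j) ++
      (T.filter fun x => g x = j).filter fun x => A x).Perm
        (T.filter fun x => A x ∧ g x < j + 1) := by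
  refine List.Perm.trans (List.Perm.of_eq ?_)
    (List.filter_append_perm (fun x => decide (g x < j)) (T.filter fun x => A x ∧ g x < j + 1))
  rw [List.filter_filter, List.filter_filter, List.filter_filter]
  congr 1
  · refine List.filter_congr fun x _ => ?_
    rw [← Bool.decide_and, decide_eq_decide]
    by_cases hA : A x
    · simp only [hA, true_and]; omega
    · simp [hA]
  · refine List.filter_congr fun x _ => ?_
    rw [← Bool.decide_and, ← decide_not, ← Bool.decide_and, decide_eq_decide]
    by_cases hA : A x
    · simp only [hA, true_and]; omega
    · simp [hA]

/-- The pass for level `l + 1` changes only queues of level `l`, so the invariant moves from `j` to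
`j + 1` one level at a time. A pass leaves at most one partial block in a queue, which is what
increases the number of passes by one. -/
theorem wp_emit {P : Params} {X : List ℕ} {β₀ : Store} {r : Ram} {e : ℕ}
    {Q : Ram → Store → ℕ → Prop} {T : List Part} (ctx : Ctx P X)
    (hTok : ∀ x ∈ T, PartOK P X x) (hT : wt P X T ≤ 3 * P.n) (hTn : T.length ≤ P.n)
    (hj : r.j < P.segs)
    (hbl : (β₀ (File.R 0 r.j)).flatten = (srcIn P 0 r.j T).flatMap trip)
    (hnb : P.B * (β₀ (File.R 0 r.j)).length ≤ 3 * (srcIn P 0 r.j T).length + P.B)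
    (hq : Queues P X T 0 r.j β₀) (hout : r.out = fun _ => [])
    (hlen : r.Y.length = P.b) (hY : Known P X r.j (fun v => v < P.n) r.Y)
    (hQ : ∀ r' β' e', RamOK P r' → Keep r r' → r'.out = (fun _ => []) →
      Queues P X T P.L (r.j + 1) β' → (∀ F, (∀ l i, F ≠ File.Q l i) → β' F = β₀ F) →
      P.B * e' ≤ P.B * e + P.L * (3 * (srcIn P 0 r.j T).length + 3 * wt P X (srcIn P 0 r.j T) +
        P.B * (3 * P.f + 2)) → Q r' β' e') :
    WP P P.emit r β₀ e Q := by
  have hN' : P.N = 8 * P.n + 8 := rfl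
  have hf4 := ctx.adm.four_le
  have hLn := ctx.L_le
  have hsn := ctx.segs_le
  have hb := ctx.b_pos
  set j := r.j with hjd
  set Tj := srcIn P 0 j T with hTj
  have hTj' : Tj = T.filter fun x => x.p / P.b = j := by
    rw [hTj, srcIn]; simp
  have hTjok : ∀ x ∈ Tj, PartOK P X x := fun x hx => hTok x (List.mem_of_mem_filter hx)
  have hTjp : ∀ x ∈ Tj, x.p / P.b = j := by
    intro x hx
    rw [hTj'] at hx
    simpa using (List.mem_filter.1 hx).2
  have hTjw : wt P X Tj ≤ 3 * P.n := (wt_filter_le _ _ _ _).trans hT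
  have hTjn : Tj.length ≤ T.length := List.length_filter_le _ _
  refine WP.intro fun _ hβ0 => wp_seq (wp_assign fun hr _ => ⟨{ hr with lev := by dsimp only; omega }, ?_⟩)
  have hnb' : (β₀ (File.R 0 j)).length ≤ 3 * P.n := by
    have := length_le_flatten fun y hy => (hβ0 (File.R 0 j) y hy).1
    rw [hbl, flatMap_trip_length] at this
    omega
  -- Queues of levels below `l` already satisfy the invariant for `j + 1`; those of level `l` and
  -- above are as before the emission.
  let I : ℕ → Ram → Store → ℕ → Prop := fun u r' β' e' => ∃ l, u = P.L - l ∧ l ≤ P.L ∧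
    r'.lev = l + 1 ∧ Keep r r' ∧ r'.out = (fun _ => []) ∧
    (∀ l' i', l ≤ l' → β' (File.Q l' i') = β₀ (File.Q l' i')) ∧
    (∀ l' < l, ∀ i', j + 1 ≤ i' * P.f ^ l' → j + 1 ≤ i' / P.f * P.f ^ (l' + 1) →
      β' (File.Q l' i') = []) ∧
    (∀ l' < l, ∀ i', j + 1 ≤ i' * P.f ^ l' → i' / P.f * P.f ^ (l' + 1) < j + 1 →
      QSt P X T β' l' i' (fun x => x.q / P.b / P.f ^ l' = i' ∧ x.p / P.b < j + 1)
        (j + 1 - i' / P.f * P.f ^ (l' + 1) + 1)) ∧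
    (∀ l' i', (β' (File.Q l' i')).flatten.length ≤ 3 * P.n) ∧
    (∀ F, (∀ l i, F ≠ File.Q l i) → β' F = β₀ F) ∧
    P.B * e' ≤ P.B * e + l * (3 * Tj.length + 3 * wt P X Tj + P.B * (3 * P.f + 2))
  refine wp_loop I id P.L ⟨0, rfl, Nat.zero_le _, rfl, ⟨rfl, rfl, fun _ _ => rfl, fun _ _ => rfl⟩,
    hout, fun _ _ _ => rfl, fun _ h => absurd h (Nat.not_lt_zero _),
    fun _ h => absurd h (Nat.not_lt_zero _), hq.len, fun _ _ => rfl, by simp⟩ ?_ ?_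
  · rintro _ r1 β1 e1 ok1 _ ⟨l, rfl, hlL, hl1, hk1, hout1, hQ1, hc1, ho1, hn1, hf1, he1⟩ hb1
    have hlL' : l < P.L := by rw [hl1] at hb1; simpa using hb1
    have hfn := ctx.f_le (by omega)
    have j1 : r1.j = j := hk1.j
    set i := j / P.f ^ (l + 1) with hi
    have hi1 : r1.j / P.f ^ r1.lev = i := by rw [j1, hl1]
    have hin : i ≤ P.N := by
      have := Nat.div_le_self j (P.f ^ (l + 1))
      omega
    have hR1 : β1 (File.R 0 j) = β₀ (File.R 0 j) := hf1 _ (by simp)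
    have hchild : ∀ c < P.f, (i * P.f + c) / P.f = i := by
      intro c hc
      rw [mul_comm, Nat.mul_add_div (by omega), Nat.div_eq_of_lt hc, add_zero]
    refine wp_seq (wp_assign fun _ _ => ?_)
    rw [hi1]
    refine ⟨{ ok1 with i := hin }, wp_seq (wp_rewind ?_)⟩
    intro r2 hr2 ok2
    have l2 : r2.lev = l + 1 := by rw [hr2]; exact hl1
    have i2 : r2.i = i := by rw [hr2]
    have j2 : r2.j = j := by rw [hr2]; exact j1
    have Y2 : r2.Y = r.Y := by rw [hr2]; exact hk1.Y
    have k2 : Keep r r2 := hk1.trans ⟨by rw [hr2], by rw [hr2],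
      fun s hs => by rw [hr2]; simp [hs], fun s hs => by rw [hr2]; simp [hs]⟩
    refine wp_seq (wp_emitScan (T := Tj) ctx hfn hTjok (by rw [j2]; exact hTjp) hTjw
      (fun c _ => hn1 _ _) (by rw [j2, hR1, ← hbl]; exact rd_start (by rw [hr2]; simp) (by rw [hr2]; simp))
      (by rw [j2, hR1]; omega) (by rw [hr2]; exact hout1) (by rw [Y2]; exact hlen)
      (by rw [Y2, j2]; exact hY) ?_)
    rw [l2, i2, j2, hR1, Nat.add_sub_cancel]
    intro r3 β3 e3 ok3 hk3 l3 i3 W3 he3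
    have hrem : rem (β₀ (File.R 0 j)) Slot.scan r2 = (β₀ (File.R 0 j)).length := by
      rw [rem, hr2]; simp
    rw [hrem] at he3
    set g : Part → ℕ := fun x => x.q / P.b / P.f ^ l % P.f with hg
    have hWle : ∀ c, (distW g (qenc P X) (meeting P (l + 1) j Tj) c).length ≤ 3 * P.n := fun c =>
      (distW_length_le _ _ _ _).trans ((wt_filter_le P X Tj _).trans hTjw)
    refine wp_seq (wp_flushAll W3 (stable_Q P) le_rfl (by simp) ?_ (by simp) (by simp)
      ctx.B_pos ?_ (by omega) ?_)
    · rintro c _ r' h1 h2 _ rfl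
      rw [h1, h2, l3, i3, Nat.add_sub_cancel]
    · intro c hc
      have h1 := hn1 l (i * P.f + c)
      have h2 := hWle c
      omega
    intro c4 k4 io4 β4 e4 r4 hr4 ok4 _ hcont hframe hblocks he4
    have l4 : r4.lev = l + 1 := by rw [hr4]; exact l3
    refine wp_assign fun _ _ => ?_
    rw [l4]
    have hnew : ∀ c < P.f, j < (i * P.f + c) * P.f ^ l →
        QSt P X T β4 l (i * P.f + c)
          (fun x => x.q / P.b / P.f ^ l = i * P.f + c ∧ x.p / P.b < j + 1)
          (j + 1 - i * P.f ^ (l + 1) + 1) := by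
      intro c hc hjc
      have hij : i * P.f ^ (l + 1) ≤ j := Nat.div_mul_le_self _ _
      obtain ⟨ts, h1, h2, h3⟩ := hq.opened l hlL' (i * P.f + c) hjc.le (by
        rw [if_pos (Nat.zero_le _), hchild c hc]; omega)
      have h4 := hcont c hc
      have h5 := hblocks c hc
      rw [hQ1 l _ le_rfl, distW, meeting_filter (by omega) hc hjc, ← hi] at h4
      rw [hQ1 l _ le_rfl, distW, meeting_filter (by omega) hc hjc, ← hi] at h5
      rw [hchild c hc] at h3
      refine ⟨ts ++ Tj.filter fun x => x.q / P.b / P.f ^ l = i * P.f + c, ?_, ?_, ?_⟩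
      · rw [hTj']
        refine (h1.append_right _).trans ?_
        exact filter_lt_succ_perm T (fun x => x.q / P.b / P.f ^ l = i * P.f + c) _ j
      · rw [h4, h2, List.flatMap_append]
      · rw [List.flatMap_append, List.length_append]
        have h6 : j + 1 - i * P.f ^ (l + 1) + 1 = j - i * P.f ^ (l + 1) + 1 + 1 := by omega
        rw [h6, mul_add P.B _ 1, mul_one]
        omega
    refine ⟨{ ok4 with lev := by dsimp only; omega }, P.L - (l + 1), by simp only [id]; omega, l + 1, rfl,
      hlL', rfl, ?_, by rw [hr4], ?_, ?_, ?_, ?_, ?_, ?_⟩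
    · refine k2.trans (hk3.trans ?_)
      rw [hr4]; exact ⟨rfl, rfl, fun _ _ => rfl, fun _ _ => rfl⟩
    · intro l' i' hl'
      rw [hframe _ fun c _ h => ?_]
      · exact hQ1 l' i' (by omega)
      · simp only [File.Q.injEq] at h; omega
    · intro l' hl' i' h1 h2
      rw [hframe _ fun c hc h => ?_]
      · rcases Nat.lt_or_ge l' l with h | h
        · exact hc1 l' h i' h1 h2
        · rw [hQ1 l' i' h]
          exact hq.closed l' (by omega) i' (by omega) (by rw [if_pos (Nat.zero_le _)]; exact h2)
      · simp only [File.Q.injEq] at h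
        obtain ⟨rfl, rfl⟩ := h
        rw [hchild c hc] at h2
        have : i * P.f ^ (l' + 1) ≤ j := Nat.div_mul_le_self _ _
        omega
    · intro l' hl' i' h1 h2
      rcases Nat.lt_or_ge l' l with h | h
      · refine (ho1 l' h i' h1 h2).congr (hframe _ fun c hc h' => ?_)
        simp only [File.Q.injEq] at h'
        omega
      · obtain rfl : l' = l := by omega
        have hm := Nat.mod_lt i' (show 0 < P.f by omega)
        -- The parent begins no later than `j` and contains a supersegment that begins after `j`, so
        -- it contains segment `j` and is the one treated in this pass.
        have hii : i' / P.f = i := by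
          rw [hi]
          refine (Nat.div_eq_of_lt_le (by omega) ?_).symm
          have h3 : i' < (i' / P.f + 1) * P.f := by
            rw [mul_comm]; exact Nat.lt_mul_div_succ _ (by omega)
          calc j < i' * P.f ^ l' := h1
            _ ≤ (i' / P.f + 1) * P.f * P.f ^ l' := Nat.mul_le_mul_right _ h3.le
            _ = (i' / P.f + 1) * P.f ^ (l' + 1) := by rw [pow_succ']; ring
        have hie : i * P.f + i' % P.f = i' := by
          rw [← hii, mul_comm]; exact Nat.div_add_mod _ _
        have := hnew _ hm (by rw [hie]; exact h1)
        rw [hie] at this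
        rw [hii]
        exact this
    · intro l' i'
      by_cases hc : ∃ c < P.f, File.Q l' i' = File.Q l (i * P.f + c)
      · obtain ⟨c, hc, h'⟩ := hc
        rw [h']
        -- A child that begins after `j` has known contents; any other child receives nothing and
        -- keeps its length.
        rcases Nat.lt_or_ge j ((i * P.f + c) * P.f ^ l) with h | h
        · obtain ⟨ts, h1, h2, -⟩ := hnew c hc h
          rw [h2]
          have : wt P X ts ≤ wt P X T := by rw [wt_perm h1]; exact wt_filter_le _ _ _ _
          unfold wt at this hT
          omega
        · rw [hcont c hc, distW, meeting_filter_eq_nil (by omega)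
            (fun x hx => ⟨hTjp x hx, (hTjok x hx).lt⟩) h]
          simpa using hn1 l (i * P.f + c)
      · rw [hframe _ fun c h h' => hc ⟨c, h, h'⟩]
        exact hn1 l' i'
    · intro F hF
      rw [hframe _ fun c _ => hF _ _]
      exact hf1 F hF
    · have htot : P.B * e4 ≤ P.B * (e3 + 3 * P.f) := Nat.mul_le_mul_left _ he4
      have hw3 : P.B * e3 ≤ P.B * (e1 + (β₀ (File.R 0 j)).length + 1) + 3 * wt P X Tj := by omega
      have e0 : P.B * (3 * P.f + 2) = P.B * (3 * P.f) + 2 * P.B := by ring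
      rw [add_mul l, one_mul]
      generalize P.B * (3 * P.f + 2) = D at e0 he1 ⊢
      simp only [mul_add P.B, mul_one] at htot hw3
      omega
  · rintro _ r1 β1 e1 ok1 _ ⟨l, rfl, hlL, hl1, hk1, hout1, hQ1, hc1, ho1, hn1, hf1, he1⟩ hb1
    have hlL' : l = P.L := by rw [hl1, decide_eq_false_iff_not] at hb1; omega
    subst hlL'
    refine hQ r1 β1 e1 ok1 hk1 hout1 ⟨fun l hl i => ?_, fun l hl i h1 h2 => ?_,
      fun l hl i h1 h2 => ?_, hn1⟩ hf1 he1
    · rw [hQ1 l i hl]; exact hq.top l hl i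
    · rw [if_neg (by omega)] at h2
      exact hc1 l hl i h1 h2
    · rw [if_neg (by omega)] at h2
      exact ho1 l hl i h1 h2

/-! Recovery of a segment. -/

/-- Since the list is sorted, the elements of segment `j` form a prefix of what is unread; the
sequential reader meets them first. -/
theorem filter_le_eq_append {α : Type*} {g : α → ℕ} {T : List α}
    (h : T.Pairwise fun x y => g x ≤ g y) (j : ℕ) :
    T.filter (fun x => j ≤ g x) = T.filter (fun x => g x = j) ++ T.filter fun x => j + 1 ≤ g x := by
  induction T with
  | nil => rfl
  | cons x T ih =>
    rw [List.pairwise_cons] at h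
    simp only [List.filter_cons, decide_eq_true_eq]
    rcases Nat.lt_trichotomy (g x) j with h1 | h1 | h1
    · rw [if_neg (by omega), if_neg (by omega), if_neg (by omega)]
      exact ih h.2
    · rw [if_pos (by omega), if_pos h1, if_neg (by omega), ih h.2]
      rfl
    · have h2 : T.filter (fun x => g x = j) = [] :=
        filter_eq_nil_of fun y hy h3 => by have := h.1 y hy; omega
      rw [if_pos (by omega), if_neg (by omega), if_pos (by omega), ih h.2, h2]
      rfl

theorem mem_ofKind {P : Params} {k : ℕ} {ps : List Part} {x : Part} :
    x ∈ ofKind P k ps ↔ x ∈ ps ∧ x.kind P = k := by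
  simp [ofKind]

theorem Part.far_of_kind {P : Params} {x : Part} (h : x.kind P = 0) : x.p + P.b < x.q := by
  unfold Part.kind at h
  split_ifs at h
  assumption

theorem Part.same_of_kind {P : Params} {x : Part} (h : x.kind P = 3) : x.p / P.b = x.q / P.b := by
  unfold Part.kind at h
  split_ifs at h
  · assumption
  · omega

/-- A distance of at most `b` reaches back by at most one segment. -/
theorem Part.prev_of_kind {P : Params} {x : Part} (hb : 0 < P.b) (hpq : x.p < x.q)
    (h : x.kind P = 2) : x.p / P.b + 1 = x.q / P.b ∧ x.q ≤ x.p + P.b := by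
  unfold Part.kind at h
  have h1 : ¬ x.p + P.b < x.q := fun h1 => by simp [h1] at h
  have h2 : x.p / P.b ≠ x.q / P.b := fun h2 => by simp [h1, h2] at h
  have h3 : x.p / P.b ≤ x.q / P.b := Nat.div_le_div_right hpq.le
  have h4 : x.q / P.b ≤ (x.p + P.b) / P.b := Nat.div_le_div_right (by omega)
  rw [Nat.add_div_right _ hb] at h4
  omega

theorem Part.kind_cases (P : Params) (x : Part) : x.kind P = 0 ∨ x.kind P = 2 ∨ x.kind P = 3 := by
  unfold Part.kind
  split_ifs <;> simp

theorem Part.far_lt {P : Params} {x : Part} (hb : 0 < P.b) (h : x.kind P = 0) :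
    x.p / P.b < x.q / P.b := by
  have h1 := Part.far_of_kind h
  have h2 : (x.p + P.b) / P.b ≤ x.q / P.b := Nat.div_le_div_right h1.le
  rw [Nat.add_div_right _ hb] at h2
  omega

/-- What is still to be read of the near parts and the literals before segment `j`. -/
structure Feeds (P : Params) (X : List ℕ) (ps : List Part) (ls : List (ℕ × ℕ)) (β : Store) (j : ℕ)
    (r : Ram) : Prop where
  prev : Rd (β File.prev) Slot.prev j r
    (((ofKind P 2 ps).filter fun x => j ≤ x.q / P.b).flatMap trip)
  lits : Rd (β File.lits) Slot.lits j r ((ls.filter fun y => j ≤ y.1 / P.b).flatMap (litw X))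
  same : Rd (β File.same) Slot.same j r
    (((ofKind P 3 ps).filter fun x => j ≤ x.q / P.b).flatMap trip)

/-- Number of blocks of near parts and literals still to be read. -/
def rems (β : Store) (r : Ram) : ℕ :=
  rem (β File.prev) Slot.prev r + rem (β File.lits) Slot.lits r + rem (β File.same) Slot.same r

theorem Feeds.congr {P X ps ls β β' j r r'} (h : Feeds P X ps ls β j r)
    (h1 : ∀ s ≠ Slot.scan, r'.inp s = r.inp s) (h2 : ∀ s ≠ Slot.scan, r'.pos s = r.pos s)
    (hp : β' File.prev = β File.prev) (hl : β' File.lits = β File.lits)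
    (hs : β' File.same = β File.same) : Feeds P X ps ls β' j r' := by
  constructor
  · rw [hp]; exact h.prev.congr (h1 _ (by simp)) (h2 _ (by simp))
  · rw [hl]; exact h.lits.congr (h1 _ (by simp)) (h2 _ (by simp))
  · rw [hs]; exact h.same.congr (h1 _ (by simp)) (h2 _ (by simp))

theorem rems_congr {β β' : Store} {r r' : Ram}
    (h2 : ∀ s ≠ Slot.scan, r'.pos s = r.pos s)
    (hp : β' File.prev = β File.prev) (hl : β' File.lits = β File.lits)
    (hs : β' File.same = β File.same) : rems β' r' = rems β r := by
  unfold rems rem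
  rw [hp, hl, hs, h2 _ (by simp), h2 _ (by simp), h2 _ (by simp)]

/-- A far part has its source in an earlier segment than its target, so for targets in `j` the
condition on the source is void and the queue holds all of them. With `L = 0` there is one segment
and hence no far part. Otherwise at most `f` passes have reached the queue, and the bound `f * L`
serves both cases. -/
theorem Queues.at_zero {P : Params} {X : List ℕ} {T : List Part} {β : Store} {j : ℕ} (ctx : Ctx P X)
    (hq : Queues P X T 0 j β) (hT : ∀ x ∈ T, x.kind P = 0 ∧ x.q < P.n) (hj : j < P.segs) :
    ∃ ts : List Part, ts.Perm (T.filter fun x => x.q / P.b = j) ∧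
      (β (File.Q 0 j)).flatten = ts.flatMap (qenc P X) ∧
      P.B * (β (File.Q 0 j)).length ≤ wt P X ts + P.B * (P.f * P.L) := by
  have hf4 := ctx.adm.four_le
  have hb := ctx.b_pos
  rcases Nat.eq_zero_or_pos P.L with hL | hL
  · have hs := ctx.f_pow_L
    rw [hL, pow_zero] at hs
    refine ⟨[], ?_, ?_, ?_⟩
    · rw [filter_eq_nil_of fun x hx h => ?_]
      obtain ⟨h1, h2⟩ := hT x hx
      have h3 := ctx.lt_segs h2
      exact Nat.not_lt_zero _ ((Part.far_lt hb h1).trans_le (by omega))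
    · rw [hq.top 0 (by omega)]; rfl
    · rw [hq.top 0 (by omega)]; simp
  · have hdm := Nat.div_add_mod j P.f
    have hm := Nat.mod_lt j (show 0 < P.f by omega)
    rw [mul_comm] at hdm
    obtain ⟨ts, h1, h2, h3⟩ := hq.opened 0 hL j (by simp) (by
      rw [if_pos le_rfl, zero_add, pow_one]; omega)
    refine ⟨ts, ?_, h2, h3.trans (Nat.add_le_add_left (Nat.mul_le_mul_left _ ?_) _)⟩
    · refine h1.trans (List.Perm.of_eq (List.filter_congr fun x hx => ?_))
      have := Part.far_lt hb (hT x hx).1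
      rw [decide_eq_decide, pow_zero, Nat.div_one]
      omega
    · rw [zero_add, pow_one]
      exact le_trans (by omega) (Nat.le_mul_of_pos_right P.f hL)

/-- Near parts and literals are read from sequences that all segments share, paid by `rems`. The
constant four is one read past the end for each of the four sequences, and `f * L` bounds the
partial blocks in the queue. -/
theorem wp_recoverSegment {P : Params} {X : List ℕ} {β : Store} {r : Ram} {e : ℕ} {S : Prog}
    {Q : Ram → Store → ℕ → Prop} {ps : List Part} {ls : List (ℕ × ℕ)} (ctx : Ctx P X)
    (hsp : Splitting P X P.n ps ls) (hj : r.j < P.segs)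
    (hF : Feeds P X ps ls β r.j r) (hq : Queues P X (ofKind P 0 ps) 0 r.j β)
    (hp : (β File.prev).length ≤ 4 * P.n) (hl : (β File.lits).length ≤ 4 * P.n)
    (hs : (β File.same).length ≤ 4 * P.n) (hlen : r.Y.length = P.b)
    (hY : 0 < r.j → Known P X (r.j - 1) (fun v => v < P.n) r.Y)
    (hQ : ∀ r' e', r'.j = r.j → r'.out = r.out → r'.Y.length = P.b →
      Known P X r.j (fun v => v < P.n) r'.Y → Feeds P X ps ls β (r.j + 1) r' →
      P.B * (e' + rems β r') ≤ P.B * (e + rems β r + 4 + P.f * P.L) +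
        wt P X ((ofKind P 0 ps).filter fun x => x.q / P.b = r.j) → WP P S r' β e' Q) :
    WP P (P.recoverPrev ;; P.recoverLits ;; P.recoverFar ;; P.recoverSame ;; S) r β e Q := by
  have hN' : P.N = 8 * P.n + 8 := rfl
  have hb := ctx.b_pos
  have hsn := ctx.segs_le
  set j := r.j with hjd
  have hjn : j * P.b < P.n := by
    have h1 := ctx.segs_mul_lt
    have h2 : (j + 1) * P.b ≤ P.segs * P.b := Nat.mul_le_mul_right _ hj
    rw [add_mul, one_mul] at h2
    omega
  have hsort : ∀ k, (ofKind P k ps).Pairwise fun x y => x.q + x.l ≤ y.q :=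
    fun k => hsp.parts_sorted.sublist List.filter_sublist
  have hsplit : ∀ k, (ofKind P k ps).filter (fun x => j ≤ x.q / P.b) =
      (ofKind P k ps).filter (fun x => x.q / P.b = j) ++
        (ofKind P k ps).filter fun x => j + 1 ≤ x.q / P.b := fun k =>
    filter_le_eq_append (g := fun x : Part => x.q / P.b) ((hsort k).imp fun h => Nat.div_le_div_right (by omega)) j
  have hsplitL : ls.filter (fun y => j ≤ y.1 / P.b) =
      ls.filter (fun y => y.1 / P.b = j) ++ ls.filter fun y => j + 1 ≤ y.1 / P.b :=
    filter_le_eq_append (g := fun y : ℕ × ℕ => y.1 / P.b) (hsp.lits_sorted.imp fun h => Nat.div_le_div_right (by omega)) j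
  have hok : ∀ k, ∀ x ∈ ofKind P k ps, PartOK P X x := fun k x hx => hsp.parts x (mem_ofKind.1 hx).1
  have hokf : ∀ k (A : Part → Bool), ∀ x ∈ (ofKind P k ps).filter A, PartOK P X x ∧ x.kind P = k :=
    fun k A x hx => ⟨hok k x (List.mem_of_mem_filter hx), (mem_ofKind.1 (List.mem_of_mem_filter hx)).2⟩
  have hat : ∀ k, ∀ x ∈ (ofKind P k ps).filter (fun x => x.q / P.b = j), x.q / P.b = j := by
    intro k x hx; simpa using (List.mem_filter.1 hx).2
  have hafter : ∀ k, ∀ x ∈ (ofKind P k ps).filter (fun x => j + 1 ≤ x.q / P.b), j + 1 ≤ x.q / P.b := by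
    intro k x hx; simpa using (List.mem_filter.1 hx).2
  obtain ⟨ts, hts, htsc, htsb⟩ := hq.at_zero ctx (fun x hx => ⟨(mem_ofKind.1 hx).2, by
    have := (hok 0 x hx).le; have := (hok 0 x hx).pos; omega⟩) hj
  set A := (ofKind P 2 ps).filter (fun x => x.q / P.b = j) with hA
  set L := ls.filter (fun y => y.1 / P.b = j) with hL
  set C := (ofKind P 3 ps).filter (fun x => x.q / P.b = j) with hC
  -- No part crosses a segment boundary, so a part that covers a position of segment `j` also begins
  -- in it.
  have hcovP : ∀ u < P.b, ∀ x ∈ ps, x.q ≤ j * P.b + u → j * P.b + u < x.q + x.l →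
      x.q / P.b = j := by
    intro u hu x hx h1 h2
    have h3 := (hsp.parts x hx).qseg
    have h4 := Nat.div_add_mod x.q P.b
    rw [mul_comm] at h4
    refine Nat.div_eq_of_lt_le ?_ ?_
    · by_contra h5
      have h6 : x.q / P.b + 1 ≤ j := (Nat.div_lt_iff_lt_mul hb).2 (by omega)
      have h7 : (x.q / P.b + 1) * P.b ≤ j * P.b := Nat.mul_le_mul_right _ h6
      rw [add_mul, one_mul] at h7
      omega
    · rw [add_mul, one_mul]; omega
  have hcovL : ∀ u < P.b, ∀ y ∈ ls, y.1 ≤ j * P.b + u → j * P.b + u < y.1 + y.2 →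
      y.1 / P.b = j := by
    intro u hu x hx h1 h2
    have h3 := (hsp.lits x hx).seg
    have h4 := Nat.div_add_mod x.1 P.b
    rw [mul_comm] at h4
    refine Nat.div_eq_of_lt_le ?_ ?_
    · by_contra h5
      have h6 : x.1 / P.b + 1 ≤ j := (Nat.div_lt_iff_lt_mul hb).2 (by omega)
      have h7 : (x.1 / P.b + 1) * P.b ≤ j * P.b := Nat.mul_le_mul_right _ h6
      rw [add_mul, one_mul] at h7
      omega
    · rw [add_mul, one_mul]; omega
  have hcover : ∀ u < P.b, j * P.b + u < P.n →
      ((CovP A (j * P.b + u) ∨ CovL L (j * P.b + u)) ∨ CovP ts (j * P.b + u)) ∨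
        ∃ x ∈ C, x.q ≤ j * P.b + u ∧ j * P.b + u < x.q + x.l := by
    intro u hu hun
    rcases hsp.cover _ hun with ⟨x, hx, h1, h2⟩ | ⟨y, hy, h1, h2⟩
    · have hxq := hcovP u hu x hx h1 h2
      rcases Part.kind_cases P x with h | h | h
      · refine Or.inl (Or.inr ⟨x, hts.mem_iff.2 ?_, h1, h2⟩)
        rw [List.mem_filter, mem_ofKind]
        exact ⟨⟨hx, h⟩, by simpa using hxq⟩
      · refine Or.inl (Or.inl (Or.inl ⟨x, ?_, h1, h2⟩))
        rw [hA, List.mem_filter, mem_ofKind]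
        exact ⟨⟨hx, h⟩, by simpa using hxq⟩
      · refine Or.inr ⟨x, ?_, h1, h2⟩
        rw [hC, List.mem_filter, mem_ofKind]
        exact ⟨⟨hx, h⟩, by simpa using hxq⟩
    · refine Or.inl (Or.inl (Or.inr ⟨y, ?_, h1, h2⟩))
      rw [hL, List.mem_filter]
      exact ⟨hy, by simpa using hcovL u hu y hy h1 h2⟩
  refine WP.intro fun _ hβ => ?_
  have hQlen : (β (File.Q 0 j)).length ≤ 3 * P.n :=
    (length_le_flatten fun y hy => (hβ (File.Q 0 j) y hy).1).trans (hq.len 0 j)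
  have hFp := hF.prev
  have hFl := hF.lits
  have hFs := hF.same
  rw [hsplit] at hFp hFs
  rw [hsplitL] at hFl
  refine wp_seq (wp_recoverPrev (T₁ := A) (a := j) ctx (fun x hx => (hokf _ _ x hx).1) ?_ ?_
    ((hsort 2).sublist List.filter_sublist) hFp (by omega) hlen ?_ ?_)
  · intro x hx
    obtain ⟨h1, h2⟩ := hokf _ _ x hx
    obtain ⟨h3, h4⟩ := Part.prev_of_kind hb h1.lt h2
    have := hat 2 x hx
    exact ⟨this, by omega, h4⟩
  · intro x hx
    obtain ⟨h1, h2⟩ := hokf _ _ x hx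
    obtain ⟨h3, h4⟩ := Part.prev_of_kind hb h1.lt h2
    have := hafter 2 x hx
    exact (Nat.le_div_iff_mul_le hb).1 (by omega)
  · intro hne u hu _
    obtain ⟨x, hx⟩ := List.exists_mem_of_ne_nil _ hne
    obtain ⟨h1, h2⟩ := hokf _ _ x hx
    have h3 := (Part.prev_of_kind hb h1.lt h2).1
    have h4 := hat 2 x hx
    have hj0 : 0 < j := by rw [← h4, ← h3]; exact Nat.succ_pos _
    refine hY hj0 u hu ?_
    have h5 : (j - 1) * P.b + P.b = j * P.b := by
      rw [← Nat.succ_mul]; congr 1; omega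
    dsimp only
    omega
  intro r1 e1 ok1 k1 hlen1 hK1 hR1 he1
  have j1 : r1.j = j := k1.j
  refine wp_seq (wp_recoverLits (T₁ := L) (a := j) ctx
    (fun y hy => hsp.lits y (List.mem_of_mem_filter hy)) ?_ ?_
    (hFl.congr (k1.inp _ (by simp)) (k1.pos _ (by simp))) (by omega) hlen1 (by rw [j1]; exact hK1) ?_)
  · intro y hy
    rw [j1]; simpa using (List.mem_filter.1 hy).2
  · intro y hy
    rw [j1, ← Nat.le_div_iff_mul_le hb]; simpa using (List.mem_filter.1 hy).2
  rw [j1]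
  intro r2 e2 ok2 k2 hlen2 hK2 hR2 he2
  have j2 : r2.j = j := k2.j.trans j1
  refine wp_seq (wp_recoverFar (T := ts) (S := fun v => CovP A v ∨ CovL L v) ctx ?_ ?_ ?_ ?_ hlen2 (by rw [j2]; exact hK2) ?_)
  · intro x hx
    exact (hokf _ _ x (hts.subset hx)).1
  · intro x hx
    rw [j2]; exact hat 0 x (hts.subset hx)
  · rw [j2]; exact htsc
  · rw [j2]; omega
  rw [j2]
  intro r3 e3 ok3 k3 hlen3 hK3 he3
  have j3 : r3.j = j := k3.j.trans j2
  refine wp_seq (wp_recoverSame (T₁ := C) (a := j)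
    (S := fun v => (CovP A v ∨ CovL L v) ∨ CovP ts v) ctx (fun x hx => (hokf _ _ x hx).1)
    ?_ ?_ ?_ (hFs.congr ?_ ?_) (by omega) hlen3 (by rw [j3]; exact hK3) ?_)
  · intro x hx
    rw [j3]
    have := hat 3 x hx
    exact ⟨this, (Part.same_of_kind (hokf _ _ x hx).2).trans this⟩
  · intro x hx
    rw [j3, ← Nat.le_div_iff_mul_le hb, Part.same_of_kind (hokf _ _ x hx).2]
    exact hafter 3 x hx
  · intro pre x post hpre v h1 h2
    rw [j3] at h1
    have hx : x ∈ C := by simp [hpre]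
    have hxq := hat 3 x hx
    have hxm := Nat.lt_div_mul_add (a := x.q) hb
    rw [hxq] at hxm
    have hxle := (hokf _ _ x hx).1.le
    -- At this stage only parts with source in the same segment can be missing. One that covers a
    -- position to the left of `x.q` precedes `x` by sortedness, so it has been copied already.
    rcases hcover (v - j * P.b) (by omega) (by omega) with h | ⟨y, hy, h3, h4⟩
    · rw [Nat.add_sub_of_le h1] at h
      exact Or.inl h
    · rw [Nat.add_sub_of_le h1] at h3 h4
      refine Or.inr ⟨y, ?_, h3, h4⟩
      have hsC : C.Pairwise fun x y => x.q + x.l ≤ y.q := (hsort 3).sublist List.filter_sublist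
      rw [hpre, List.pairwise_append, List.pairwise_cons] at hsC
      rw [hpre, List.mem_append, List.mem_cons] at hy
      rcases hy with hy | rfl | hy
      · exact hy
      · omega
      · have := hsC.2.1.1 y hy
        omega
  · rw [k3.inp _ (by simp), k2.inp _ (by simp), k1.inp _ (by simp)]
  · rw [k3.pos _ (by simp), k2.pos _ (by simp), k1.pos _ (by simp)]
  rw [j3]
  intro r4 e4 ok4 k4 hlen4 hK4 hR4 he4
  have hp4 : r4.pos Slot.prev = r1.pos Slot.prev := by
    rw [k4.pos _ (by simp), k3.pos _ (by simp), k2.pos _ (by simp)]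
  have hi4 : r4.inp Slot.prev = r1.inp Slot.prev := by
    rw [k4.inp _ (by simp), k3.inp _ (by simp), k2.inp _ (by simp)]
  have hp4' : r4.pos Slot.lits = r2.pos Slot.lits := by
    rw [k4.pos _ (by simp), k3.pos _ (by simp)]
  have hi4' : r4.inp Slot.lits = r2.inp Slot.lits := by
    rw [k4.inp _ (by simp), k3.inp _ (by simp)]
  refine hQ r4 e4 (k4.j.trans j3) ?_ hlen4 ?_ ⟨hR1.congr hi4 hp4, hR2.congr hi4' hp4', hR4⟩ ?_
  · rw [k4.out, k3.out, k2.out, k1.out]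
  · intro u hu hun
    exact hK4 u hu (hcover u hu hun)
  · have g1 : rem (β File.prev) Slot.prev r4 = rem (β File.prev) Slot.prev r1 := rem_congr hp4
    have g2 : rem (β File.lits) Slot.lits r4 = rem (β File.lits) Slot.lits r2 := rem_congr hp4'
    have g3 : rem (β File.lits) Slot.lits r1 = rem (β File.lits) Slot.lits r :=
      rem_congr (k1.pos _ (by simp))
    have g4 : rem (β File.same) Slot.same r3 = rem (β File.same) Slot.same r := rem_congr (by
      rw [k3.pos _ (by simp), k2.pos _ (by simp), k1.pos _ (by simp)])
    have h1 : e4 + rems β r4 ≤ e + rems β r + 4 + (β (File.Q 0 j)).length := by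
      unfold rems
      omega
    have h2 := Nat.mul_le_mul_left P.B h1
    rw [← wt_perm hts]
    simp only [mul_add] at h2 ⊢
    omega

/-! The recovery of all segments. -/

/-- A bound for the cost, times `B`, of the recovery of the first `j` segments without the
input and output of single symbols. -/
def recCost (P : Params) (X : List ℕ) (T : List Part) (j : ℕ) : ℕ :=
  ∑ v ∈ Finset.Ioc 0 P.L, openCost P X T v j + wt P X (T.filter fun x => x.q / P.b < j) +
    j * (P.B * (4 + P.f * P.L)) +
    P.L * (3 * (T.filter fun x => x.p / P.b < j).length +
      3 * wt P X (T.filter fun x => x.p / P.b < j) + j * (P.B * (3 * P.f + 2)))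

theorem recCost_zero (P : Params) (X : List ℕ) (T : List Part) (hf : 0 < P.f) :
    recCost P X T 0 = 0 := by
  unfold recCost
  rw [filter_eq_nil_of fun x _ => Nat.not_lt_zero _, filter_eq_nil_of fun x _ => Nat.not_lt_zero _,
    Finset.sum_eq_zero fun v _ => openCost_zero P X T v hf]
  simp [wt]

/-- The increment caused by one segment. The opening costs appear on both sides so that no
subtraction of naturals is needed, in the form in which `wp_openQueues` states its bound. -/
theorem recCost_succ (P : Params) (X : List ℕ) (T : List Part) (j : ℕ) :
    recCost P X T (j + 1) + ∑ v ∈ Finset.Ioc 0 P.L, openCost P X T v j =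
      recCost P X T j + ∑ v ∈ Finset.Ioc 0 P.L, openCost P X T v (j + 1) +
      wt P X (T.filter fun x => x.q / P.b = j) + P.B * (4 + P.f * P.L) +
      P.L * (3 * (srcIn P 0 j T).length + 3 * wt P X (srcIn P 0 j T) + P.B * (3 * P.f + 2)) := by
  have h : srcIn P 0 j T = T.filter fun x => x.p / P.b = j := by simp [srcIn]
  unfold recCost
  rw [h, wt_filter_lt_succ P X T (fun x => x.q / P.b), wt_filter_lt_succ P X T (fun x => x.p / P.b),
    length_filter_lt_succ]
  ring

/-- At each level a queued word is charged four units for opening and three for emission; the single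
extra unit is the final read from the queue of its segment. Scanning the sequences of far parts once
per level gives the term with `T.length`. -/
theorem recCost_segs_le {P : Params} {X : List ℕ} (ctx : Ctx P X) (T : List Part) :
    recCost P X T P.segs ≤ (7 * P.L + 1) * wt P X T + 3 * P.L * T.length +
      P.segs * (P.B * (4 + P.f * P.L)) + P.L * (P.segs * (P.B * (8 * P.f + 3))) := by
  have h1 : ∑ v ∈ Finset.Ioc 0 P.L, openCost P X T v P.segs ≤
      P.L * (4 * wt P X T + P.segs * (P.B * (5 * P.f + 1))) := by
    refine (Finset.sum_le_card_nsmul _ _ _ fun v _ => openCost_segs_le ctx T v).trans ?_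
    simp
  have h2 := wt_filter_le P X T fun x => x.q / P.b < P.segs
  have h3 := wt_filter_le P X T fun x => x.p / P.b < P.segs
  have h4 := List.length_filter_le (fun x : Part => decide (x.p / P.b < P.segs)) T
  unfold recCost
  calc _ ≤ P.L * (4 * wt P X T + P.segs * (P.B * (5 * P.f + 1))) + wt P X T +
      P.segs * (P.B * (4 + P.f * P.L)) +
      P.L * (3 * T.length + 3 * wt P X T + P.segs * (P.B * (3 * P.f + 2))) := by gcongr
    _ = _ := by ring

/-- Three accounts are kept apart: `rems` for the near parts and literals, `recCost` for queues and
far parts, and `B * k` for the output blocks. -/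
theorem wp_recoverAll {P : Params} {X : List ℕ} {β₀ : Store} {r : Ram} {e : ℕ}
    {Q : Ram → Store → ℕ → Prop} {ps : List Part} {ls : List (ℕ × ℕ)} (ctx : Ctx P X)
    (hsp : Splitting P X P.n ps ls) (hT : wt P X (ofKind P 0 ps) ≤ 3 * P.n) (hj : r.j = 0)
    (hF : Feeds P X ps ls β₀ 0 r) (hQ0 : ∀ l i, β₀ (File.Q l i) = [])
    (hR0 : ∀ i, (β₀ (File.R 0 i)).flatten = (srcIn P 0 i (ofKind P 0 ps)).flatMap trip)
    (hnb : ∀ i, P.B * (β₀ (File.R 0 i)).length ≤ 3 * (srcIn P 0 i (ofKind P 0 ps)).length + P.B)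
    (hp : (β₀ File.prev).length ≤ 4 * P.n) (hl : (β₀ File.lits).length ≤ 4 * P.n)
    (hs : (β₀ File.same).length ≤ 4 * P.n) (hlen : r.Y.length = P.b)
    (hout : r.out = fun _ => []) (hout0 : β₀ File.output = [])
    (hQ : ∀ r' β' e' k, β' File.output = outBlocks P X k → OutCnt P P.segs k →
      P.B * e' ≤ P.B * (e + rems β₀ r) + recCost P X (ofKind P 0 ps) P.segs + P.B * k →
      Q r' β' e') :
    WP P (Prog.loop (fun r => decide (r.j < P.segs))
      (P.openQueues ;; P.recoverPrev ;; P.recoverLits ;; P.recoverFar ;; P.recoverSame ;;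
        P.writeSegment ;; P.emit ;; Prog.assign (fun r => { r with j := r.j + 1 }))) r β₀ e Q := by
  have hN' : P.N = 8 * P.n + 8 := rfl
  have hf4 := ctx.adm.four_le
  have hsn := ctx.segs_le
  have hn2 := ctx.two_le
  set T := ofKind P 0 ps with hTd
  have hTok : ∀ x ∈ T, PartOK P X x := fun x hx => hsp.parts x (mem_ofKind.1 hx).1
  have hTn : T.length ≤ P.n := by
    have h1 : T.length ≤ ps.length := List.length_filter_le _ _
    have h2 := hsp.length_le
    omega
  have hjn : ∀ j, j < P.segs → j * P.b < P.n := by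
    intro j hj
    have h1 := ctx.segs_mul_lt
    have h2 : (j + 1) * P.b ≤ P.segs * P.b := Nat.mul_le_mul_right _ hj
    rw [add_mul, one_mul] at h2
    omega
  let I : ℕ → Ram → Store → ℕ → Prop := fun u r' β' e' => ∃ j k, u = P.segs - j ∧ j ≤ P.segs ∧
    r'.j = j ∧ r'.out = (fun _ => []) ∧ r'.Y.length = P.b ∧
    (0 < j → Known P X (j - 1) (fun v => v < P.n) r'.Y) ∧ Feeds P X ps ls β' j r' ∧
    Queues P X T P.L j β' ∧ OutCnt P j k ∧ β' File.output = outBlocks P X k ∧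
    (∀ F, (∀ l i, F ≠ File.Q l i) → F ≠ File.output → β' F = β₀ F) ∧
    P.B * (e' + rems β' r') ≤ P.B * (e + rems β₀ r) + recCost P X T j + P.B * k
  refine wp_loop I id P.segs ⟨0, 0, rfl, Nat.zero_le _, hj, hout, hlen, fun h => absurd h (by simp), hF,
    ⟨fun _ _ _ => hQ0 _ _, fun _ _ _ _ _ => hQ0 _ _, fun l _ i _ _ => ⟨[], ?_, ?_, ?_⟩, ?_⟩,
    ⟨?_, ?_, ?_⟩, ?_, fun _ _ _ => rfl, ?_⟩ ?_ ?_
  · rw [filter_eq_nil_of fun x _ h => Nat.not_lt_zero _ h.2]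
  · rw [hQ0]; rfl
  · rw [hQ0]; simp
  · intro l i; rw [hQ0]; simp
  · intro _; simp
  · have := Nat.mul_pos ctx.B_pos P.d_pos; omega
  · intro h; omega
  · rw [hout0]; rfl
  · rw [recCost_zero P X T (by omega)]; simp
  · rintro _ r1 β1 e1 ok1 _ ⟨j, k, rfl, hjs, j1, out1, len1, K1, F1, Q1, O1, B1, fr1, he1⟩ hb1
    have hjlt : j < P.segs := by rw [decide_eq_true_eq, j1] at hb1; exact hb1
    have hjb := hjn j hjlt
    subst j1
    refine wp_seq (wp_openQueues ctx hTok hT hjlt Q1 out1 ?_)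
    intro r2 β2 e2 ok2 k2 out2 Q2 fr2 he2
    have j2 : r2.j = r1.j := k2.j
    have hcp : ∀ F, (∀ l i, F ≠ File.Q l i) → F ≠ File.output → β2 F = β₀ F := fun F h1 h2 =>
      (fr2 F h1).trans (fr1 F h1 h2)
    have hp2 := fr2 File.prev (by simp)
    have hl2 := fr2 File.lits (by simp)
    have hs2 := fr2 File.same (by simp)
    have rems2 : rems β2 r2 = rems β1 r1 := rems_congr k2.pos hp2 hl2 hs2
    refine wp_recoverSegment (ps := ps) (ls := ls) ctx hsp (by rw [j2]; exact hjlt)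
      (by rw [j2]; exact F1.congr k2.inp k2.pos hp2 hl2 hs2) (by rw [j2]; exact Q2)
      (by rw [hcp _ (by simp) (by simp)]; exact hp) (by rw [hcp _ (by simp) (by simp)]; exact hl)
      (by rw [hcp _ (by simp) (by simp)]; exact hs) (by rw [k2.Y]; exact len1)
      (by rw [j2, k2.Y]; exact K1) ?_
    rw [j2]
    intro r3 e3 j3 out3 len3 K3 F3 he3
    -- The string has not ended before this segment, so all earlier segments were full and the
    -- number of output blocks is exact.
    have hk : k = r1.j * (P.m / P.B) := O1.eq hjb
    refine wp_seq (wp_writeSegment ctx len3 (by rw [j3]; exact K3) (by rw [j3]; exact hjb)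
      (by rw [fr2 _ (by simp), B1, j3, hk]) ?_)
    rw [j3, ← hk]
    intro r4 β4 e4 t k' ok4 hr4 B4 fr4 O4 he4
    have inp4 : r4.inp = r3.inp := by rcases hr4 with h | h <;> rw [h]
    have pos4 : r4.pos = r3.pos := by rcases hr4 with h | h <;> rw [h]
    have j4 : r4.j = r1.j := by rcases hr4 with h | h <;> rw [h, ← j3]
    have Y4 : r4.Y = r3.Y := by rcases hr4 with h | h <;> rw [h]
    have out4 : r4.out = fun _ => [] := by
      rcases hr4 with h | h <;> rw [h] <;> exact out3.trans out2
    have hR4 : β4 (File.R 0 r1.j) = β₀ (File.R 0 r1.j) := by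
      rw [fr4 _ (by simp), hcp _ (by simp) (by simp)]
    have Q4 : Queues P X T 0 r1.j β4 := by
      have h : ∀ l i, β4 (File.Q l i) = β2 (File.Q l i) := fun l i => fr4 _ (by simp)
      refine ⟨fun l hl i => ?_, fun l hl i h1 h2 => ?_, fun l hl i h1 h2 => ?_, fun l i => ?_⟩
      · rw [h]; exact Q2.top l hl i
      · rw [h]; exact Q2.closed l hl i h1 h2
      · exact (Q2.opened l hl i h1 h2).congr (h l i)
      · rw [h]; exact Q2.len l i
    refine wp_seq (wp_emit (T := T) ctx hTok hT hTn (by rw [j4]; exact hjlt)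
      (by rw [j4, hR4]; exact hR0 _) (by rw [j4, hR4]; exact hnb _) (by rw [j4]; exact Q4) out4
      (by rw [Y4]; exact len3) (by rw [j4, Y4]; exact K3) ?_)
    rw [j4]
    intro r5 β5 e5 ok5 k5 out5 Q5 fr5 he5
    have j5 : r5.j = r1.j := k5.j.trans j4
    have hfr5 : ∀ F, (∀ l i, F ≠ File.Q l i) → F ≠ File.output → β5 F = β2 F := fun F h1 h2 =>
      (fr5 F h1).trans (fr4 F h2)
    have hrem5 : rems β5 { r5 with j := r5.j + 1 } = rems β2 r3 :=
      rems_congr (fun s hs => (k5.pos s hs).trans (congrFun pos4 s)) (hfr5 _ (by simp) (by simp))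
        (hfr5 _ (by simp) (by simp)) (hfr5 _ (by simp) (by simp))
    refine wp_assign fun _ _ => ⟨{ ok5 with j := by dsimp only; omega }, P.segs - (r1.j + 1),
      by simp only [id]; omega, r1.j + 1, k', rfl, hjlt, by rw [← j5], out5, ?_, ?_, ?_, Q5, O4, ?_, ?_, ?_⟩
    · exact (congrArg List.length (k5.Y.trans Y4)).trans len3
    · intro _
      have hY5 : r5.Y = r3.Y := k5.Y.trans Y4
      dsimp only
      rw [hY5, Nat.add_sub_cancel]
      exact K3
    · exact F3.congr (fun s hs => (k5.inp s hs).trans (congrFun inp4 s))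
        (fun s hs => (k5.pos s hs).trans (congrFun pos4 s)) (hfr5 _ (by simp) (by simp))
        (hfr5 _ (by simp) (by simp)) (hfr5 _ (by simp) (by simp))
    · rw [fr5 _ (by simp), B4]
    · intro F h1 h2
      rw [hfr5 F h1 h2, hcp F h1 h2]
    · rw [hrem5]
      rw [rems2, ← hTd] at he3
      have hs := recCost_succ P X T r1.j
      have h4 := congrArg (P.B * ·) he4
      simp only [mul_add P.B] at h4 he3 he1 hs he5 ⊢
      omega
  · rintro _ r1 β1 e1 ok1 _ ⟨j, k, rfl, hjs, j1, out1, len1, K1, F1, Q1, O1, B1, fr1, he1⟩ hb1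
    obtain rfl : j = P.segs := by rw [decide_eq_false_iff_not, j1] at hb1; omega
    refine hQ r1 β1 e1 k B1 O1 ?_
    rw [mul_add P.B e1] at he1
    omega

/-! The whole decoder. -/

/-- The blocks of a sequence of words. -/
def blocks (B : ℕ) (ws : List Cell) : List (List Cell) :=
  (List.range ((ws.length + B - 1) / B)).map (blockOf B ws)

theorem flatten_map_blockOf (B : ℕ) (ws : List Cell) (k : ℕ) :
    ((List.range k).map (blockOf B ws)).flatten = ws.take (k * B) := by
  induction k with
  | zero => simp
  | succ k ih =>
    rw [List.range_succ, List.map_append, List.flatten_append, ih, add_mul, one_mul, List.take_add]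
    simp [blockOf]

theorem le_ceil_mul {B : ℕ} (hB : 1 ≤ B) (n : ℕ) : n ≤ (n + B - 1) / B * B := by
  have h1 := Nat.div_add_mod (n + B - 1) B
  have h2 := Nat.mod_lt (n + B - 1) hB
  rw [mul_comm]
  omega

theorem flatten_blocks {B : ℕ} (hB : 1 ≤ B) (ws : List Cell) : (blocks B ws).flatten = ws := by
  rw [blocks, flatten_map_blockOf, List.take_of_length_le (le_ceil_mul hB _)]

theorem mul_length_blocks_le {B : ℕ} (hB : 1 ≤ B) (ws : List Cell) :
    B * (blocks B ws).length ≤ ws.length + B := by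
  have := Nat.mul_div_le (ws.length + B - 1) B
  simp only [blocks, List.length_map, List.length_range]
  omega

theorem length_blocks_le {B : ℕ} (hB : 1 ≤ B) (ws : List Cell) :
    (blocks B ws).length ≤ ws.length := by
  simpa [blocks] using ceil_le hB ws.length

theorem getD_blocks {B : ℕ} (hB : 1 ≤ B) (ws : List Cell) (k : ℕ) :
    (blocks B ws).getD k [] = blockOf B ws k := by
  have hl : (blocks B ws).length = (ws.length + B - 1) / B := by simp [blocks]
  rcases Nat.lt_or_ge k (blocks B ws).length with h | h
  · rw [List.getD_eq_getElem _ _ h]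
    simp [blocks]
  · rw [List.getD_eq_default _ _ h, blockOf, List.drop_eq_nil_of_le, List.take_nil]
    rw [hl] at h
    exact (le_ceil_mul hB _).trans (Nat.mul_le_mul_right _ h)

theorem ne_nil_of_mem_blocks {B : ℕ} (hB : 1 ≤ B) {ws y : List Cell} (hy : y ∈ blocks B ws) :
    y ≠ [] := by
  simp only [blocks, List.mem_map, List.mem_range] at hy
  obtain ⟨k, hk, rfl⟩ := hy
  have h1 : k * B + B ≤ ws.length + B - 1 := by
    rw [← Nat.succ_mul]
    exact (Nat.mul_le_mul_right _ hk).trans (Nat.div_mul_le_self _ _)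
  rw [← List.length_pos_iff, blockOf, List.length_take, List.length_drop]
  omega

/-! ### Bounds on the number of input words and of queue words. -/

theorem itemsFrom_le {d : ℕ} {X : List ℕ} {T : List Item} {i : ℕ} (h : ItemsFrom d X i T) :
    i ≤ X.length ∧ runs T + 2 * reps T ≤ 2 * (X.length - i) := by
  induction T generalizing i with
  | nil =>
    have h : i = X.length := h
    simp [runs, reps, h]
  | cons x T ih =>
    cases x with
    | run s =>
      obtain ⟨h1, h2, h3, h4, h5⟩ := h
      have := ih h5
      have := List.length_pos_iff.2 h1
      simp only [runs, reps]
      omega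
    | rep p l =>
      obtain ⟨h1, h2, h3, h4, h5⟩ := h
      have := ih h5
      simp only [runs, reps]
      omega

theorem cellOK_of_itemsFrom {P : Params} {X : List ℕ} (ctx : Ctx P X) {T : List Item} {i : ℕ}
    (h : ItemsFrom P.d X i T) {x : Cell} (hx : x ∈ T.flatMap Item.words) : CellOK P x := by
  have hX := ctx.len
  induction T generalizing i with
  | nil => simp at hx
  | cons y T ih =>
    rw [List.flatMap_cons, List.mem_append] at hx
    cases y with
    | run s =>
      obtain ⟨h1, h2, h3, h4, h5⟩ := h
      rcases hx with hx | hx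
      · obtain rfl : x = Cell.str s := by simpa [Item.words] using hx
        refine ⟨h2, fun z hz => ctx.lt z ?_⟩
        rw [h4] at hz
        exact mem_of_mem_slice hz
      · exact ih h5 hx
    | rep p l =>
      obtain ⟨h1, h2, h3, h4, h5⟩ := h
      rcases hx with hx | hx
      · have : x = Cell.int p ∨ x = Cell.int l := by simpa [Item.words] using hx
        rcases this with rfl | rfl <;> simp only [CellOK, Params.N] <;> omega
      · exact ih h5 hx

/-- Crude, but independent of `d`: it keeps queue lengths and block numbers within `Params.N`. The
cost estimate relies on `d_mul_wt_le` instead. -/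
theorem wt_le {P : Params} {X : List ℕ} (ctx : Ctx P X) {T : List Part}
    (hT : ∀ x ∈ T, PartOK P X x) : wt P X T ≤ 3 * (T.map Part.l).sum := by
  induction T with
  | nil => simp [wt]
  | cons x T ih =>
    have h1 := qenc_length_le ctx (hT x List.mem_cons_self)
    have h2 := ih fun y hy => hT y (List.mem_cons_of_mem _ hy)
    rw [wt_cons, List.map_cons, List.sum_cons]
    omega

theorem d_mul_wt_le {P : Params} {X : List ℕ} (ctx : Ctx P X) {T : List Part}
    (hT : ∀ x ∈ T, PartOK P X x) : P.d * wt P X T ≤ 3 * (P.d * T.length) + (T.map Part.l).sum := by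
  induction T with
  | nil => simp [wt]
  | cons x T ih =>
    have h1 := d_mul_qenc_length_le ctx (hT x List.mem_cons_self)
    have h2 := ih fun y hy => hT y (List.mem_cons_of_mem _ hy)
    rw [wt_cons, List.map_cons, List.sum_cons, mul_add, List.length_cons, mul_add]
    omega

theorem sum_map_filter_le {α : Type*} (T : List α) (g : α → ℕ) (A : α → Bool) :
    ((T.filter A).map g).sum ≤ (T.map g).sum := by
  induction T with
  | nil => simp
  | cons x T ih =>
    rw [List.filter_cons]
    split <;> simp only [List.map_cons, List.sum_cons] <;> omega

theorem getD_outBlocks {P : Params} {X : List ℕ} (ctx : Ctx P X) {k : ℕ}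
    (h : P.n ≤ k * (P.B * P.d)) (i : ℕ) :
    (outBlocks P X k).getD i [] = blockOf P.B (pack P.d X) i := by
  rcases Nat.lt_or_ge i k with hi | hi
  · rw [List.getD_eq_getElem _ _ (by simpa [outBlocks] using hi)]
    simp [outBlocks]
  · have h1 : k * (P.B * P.d) ≤ i * (P.B * P.d) := Nat.mul_le_mul_right _ hi
    rw [List.getD_eq_default _ _ (by simpa [outBlocks] using hi), blockOf_pack P.d_pos, slice,
      List.drop_eq_nil_of_le (by rw [ctx.len, mul_assoc]; omega), List.take_nil,
      pack_nil P.d_pos]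

/-! ### The initial state and the total cost of the decoder. -/

theorem initRam_ok {P : Params} : RamOK P initRam := by
  constructor <;> simp [initRam, Params.N]
  · exact ⟨by simp, by simp⟩
  · intro _; exact ⟨by simp, by simp⟩
  · exact ⟨by simp, by simp⟩

/-- The sequences at the start. -/
def initStore (B : ℕ) (ws : List Cell) : Store := fun F => if F = File.input then blocks B ws else []

theorem holds_init {B : ℕ} (hB : 1 ≤ B) (ws : List Cell) :
    Holds (initDisk B ws) (initStore B ws) := by
  refine ⟨fun F k => ?_, fun F h1 h2 => Or.inl ⟨?_, ?_⟩⟩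
  · by_cases hF : F = File.input
    · subst hF
      rw [initStore, if_pos rfl, getD_blocks hB]; rfl
    · rw [initStore, if_neg hF]
      cases F <;> simp_all [initDisk]
  · cases F <;> simp_all [initDisk]
  · rw [initStore, if_neg h1]

theorem initStore_ok {P : Params} (hB : 1 ≤ P.B) {ws : List Cell} (h : ∀ x ∈ ws, CellOK P x) :
    StoreOK P (initStore P.B ws) := by
  intro F y hy
  unfold initStore at hy
  split at hy
  · refine ⟨ne_nil_of_mem_blocks hB hy, ?_⟩
    simp only [blocks, List.mem_map] at hy
    obtain ⟨k, -, rfl⟩ := hy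
    exact ⟨by simp [blockOf], fun x hx => h x (List.mem_of_mem_drop (List.mem_of_mem_take hx))⟩
  · simp at hy

/-- The array takes at least half of the RAM, so the buffers are not larger than the array, and
`O(f)` blocks per segment amount to at most `8 * m` words. With at least two segments, all segments
together have less than `2 * n` places for symbols. -/
theorem Ctx.segs_B_le {P : Params} {X : List ℕ} (ctx : Ctx P X) (hL : 0 < P.L) :
    P.d * (P.segs * (P.B * (8 * P.f + 3))) ≤ 16 * P.n := by
  have h1 := ctx.segs_mul_lt
  have h2 := ctx.b_lt hL
  have h3 := ctx.adm.f_mul_B_le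
  have h4 : P.B * (8 * P.f + 3) ≤ 8 * P.m := by nlinarith
  calc P.d * (P.segs * (P.B * (8 * P.f + 3))) ≤ P.d * (P.segs * (8 * P.m)) := by gcongr
    _ = 8 * (P.segs * P.b) := by rw [Params.b]; ring
    _ ≤ 16 * P.n := by omega

/-- Also covers the case of a single segment, where `b` may be far larger than `n`: one segment is
charged `d * B` directly, and the other segments are full. -/
theorem Ctx.segs_B_le' {P : Params} {X : List ℕ} (ctx : Ctx P X) :
    P.d * (P.segs * (P.B * 4)) ≤ 4 * (P.d * P.B) + 4 * P.n := by
  have h1 := ctx.segs_mul_lt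
  have h2 := ctx.m_ge
  obtain ⟨s, hs⟩ : ∃ s, P.segs = s + 1 := ⟨P.segs - 1, by have := ctx.segs_pos; omega⟩
  rw [hs] at h1 ⊢
  have h3 : P.d * (s * P.B) ≤ s * P.b := by
    calc P.d * (s * P.B) ≤ P.d * (s * P.m) := by gcongr; omega
      _ = s * P.b := by rw [Params.b]; ring
  nlinarith

/-- Divisions by `d` and `B` are cleared beforehand. After multiplication by `d`, and by `L` where a
bound enters every round, the hypotheses are linear in the occurring monomials. -/
theorem cost_arith {d B L n z f s p l r t w k ib R e1 e2 e3 rec : ℕ}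
    (h1 : B * e1 ≤ B * (ib + 13) + 9 * p + 6 * l)
    (h2 : B * e2 ≤ B * e1 + L * (12 * t + s * (B * (3 * f + 2))))
    (h3 : B * e3 ≤ B * (e2 + R) + rec + B * k)
    (hrec : rec ≤ (7 * L + 1) * w + 3 * L * t + s * (B * (4 + f * L)) +
      L * (s * (B * (8 * f + 3))))
    (hib : B * ib ≤ r + 2 * z + B) (hR : B * R ≤ 6 * p + 2 * l + 3 * B) (hl : l ≤ 2 * r)
    (hr : d * r ≤ n + d * z + d) (hB : 1 ≤ B) (hp : d * p ≤ 2 * n + 3 * (d * z)) (ht : t ≤ p)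
    (hw : d * w ≤ 3 * (d * p) + n) (hk : k * (B * d) ≤ n + B * d)
    (hs : d * (s * (B * 4)) ≤ 4 * (d * B) + 4 * n)
    (hL : L * (d * (s * (B * (8 * f + 3)))) ≤ L * (16 * n)) :
    d * (B * e3) ≤ 300 * ((L + 1) * (n + d * z + d * B)) := by
  have g1 := Nat.mul_le_mul_left d h1
  have g2 := Nat.mul_le_mul_left d h2
  have g3 := Nat.mul_le_mul_left d h3
  have grec := Nat.mul_le_mul_left d hrec
  have gib := Nat.mul_le_mul_left d hib
  have gR := Nat.mul_le_mul_left d hR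
  have gl := Nat.mul_le_mul_left d hl
  have gB := Nat.mul_le_mul_left d hB
  have gt := Nat.mul_le_mul_left d ht
  have Lt := Nat.mul_le_mul_left L gt
  have Lp := Nat.mul_le_mul_left L hp
  have Lw := Nat.mul_le_mul_left L hw
  -- Products are atoms for `linarith`, so their nonnegativity is supplied explicitly.
  have q1 : 0 ≤ d * (s * (B * f * L)) := Nat.zero_le _
  have q2 : 0 ≤ L * (d * (s * B)) := Nat.zero_le _
  have q3 : 0 ≤ L * (d * B) := Nat.zero_le _
  have q4 : 0 ≤ L * n := Nat.zero_le _
  have q5 : 0 ≤ L * (d * z) := Nat.zero_le _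
  have q6 : 0 ≤ d * z := Nat.zero_le _
  have q7 : 0 ≤ d * B := Nat.zero_le _
  zify at *
  linarith

theorem wp_decoder {P : Params} {X : List ℕ} {zs : List Phrase} (ctx : Ctx P X)
    (hz : Factorizes X zs) :
    WP P P.decoder initRam (initStore P.B (encode P.d zs)) 0 fun _ β e => ∃ k,
      β File.output = outBlocks P X k ∧ P.n ≤ k * (P.B * P.d) ∧
      P.d * (P.B * e) ≤ 300 * ((P.L + 1) * (P.n + P.d * repCount zs + P.d * P.B)) := by
  have hN' : P.N = 8 * P.n + 8 := rfl
  have hB := ctx.B_pos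
  have hd := P.d_pos
  have hf4 := ctx.adm.four_le
  set β₀ := initStore P.B (encode P.d zs) with hβ₀
  have hit : ItemsFrom P.d X 0 (items P.d zs) := itemsFrom_items hd hz
  have hin : β₀ File.input = blocks P.B (encode P.d zs) := if_pos rfl
  have hnil : ∀ F, F ≠ File.input → β₀ F = [] := fun F hF => if_neg hF
  have henc : (encode P.d zs).length = runs (items P.d zs) + 2 * reps (items P.d zs) := by
    rw [encode_eq_items, words_length]
  have henc2 : (encode P.d zs).length ≤ 2 * P.n := by
    rw [henc, ← ctx.len]
    exact (itemsFrom_le hit).2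
  have hbl := length_blocks_le hB (encode P.d zs)
  refine wp_seq (wp_assign fun ok _ => ⟨{ ok with Y_len := by simp, Y_lt := fun x hx => ?_ }, ?_⟩)
  · rw [List.eq_of_mem_replicate hx]
    have := ctx.two_le_sigma; omega
  refine wp_seq (wp_split ctx (T := items P.d zs) (fun c => hnil _ (splitG_ne_input P c)) hit
    (by rw [hin, flatten_blocks hB, encode_eq_items]) (by rw [hin]; omega) rfl rfl
    (fun _ _ => ⟨rfl, rfl⟩) ?_)
  intro ps ls r1 β1 e1 hsp hps hls out1 Y1 slots1 cont1 fr1 nb1 he1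
  refine WP.intro fun _ hβ1 => ?_
  have hb := ctx.b_pos
  set T := ofKind P 0 ps with hT
  have hlen := hsp.length_le
  have hk : ∀ k, (ofKind P k ps).length ≤ ps.length := fun k => List.length_filter_le _ _
  have hTok : ∀ x ∈ T, PartOK P X x := fun x hx => hsp.parts x (mem_ofKind.1 hx).1
  have hsum : (T.map Part.l).sum ≤ P.n := by
    have h1 : (T.map Part.l).sum ≤ (ps.map Part.l).sum := sum_map_filter_le _ _ _
    have h2 := hsp.sum
    omega
  have hwt := wt_le ctx hTok
  have c0 := cont1 0 (by omega)
  have c1 := cont1 1 (by omega)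
  have c2 := cont1 2 (by omega)
  have c3 := cont1 3 (by omega)
  have n0 := nb1 0 (by omega)
  have n1 := nb1 1 (by omega)
  have n2 := nb1 2 (by omega)
  have n3 := nb1 3 (by omega)
  have hk0 : T.length ≤ ps.length := hk 0
  have hk2 := hk 2
  have hk3 := hk 3
  have w0 : splitW P X ps ls 0 = T.flatMap trip := rfl
  have w1 : splitW P X ps ls 1 = ls.flatMap (litw X) := rfl
  have w2 : splitW P X ps ls 2 = (ofKind P 2 ps).flatMap trip := rfl
  have w3 : splitW P X ps ls 3 = (ofKind P 3 ps).flatMap trip := rfl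
  have s0 : splitG P 0 = File.R P.L 0 := rfl
  have s1 : splitG P 1 = File.lits := rfl
  have s2 : splitG P 2 = File.prev := rfl
  have s3 : splitG P 3 = File.same := rfl
  rw [s0, w0] at c0 n0
  rw [s1, w1] at c1 n1
  rw [s2, w2] at c2 n2
  rw [s3, w3] at c3 n3
  have hfr1 : ∀ F, F ≠ File.R P.L 0 → F ≠ File.lits → F ≠ File.prev → F ≠ File.same →
      β1 F = β₀ F := by
    intro F h0 h1 h2 h3
    refine fr1 F fun c hc => ?_
    interval_cases c <;> assumption
  have hlt : (β1 File.lits).length ≤ 2 * P.n := by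
    refine (length_le_flatten fun y hy => (hβ1 File.lits y hy).1).trans ?_
    rw [c1, flatMap_litw_length]; omega
  have hpv : (β1 File.prev).length ≤ 3 * P.n := by
    refine (length_le_flatten fun y hy => (hβ1 File.prev y hy).1).trans ?_
    rw [c2, flatMap_trip_length]; omega
  have hsm : (β1 File.same).length ≤ 3 * P.n := by
    refine (length_le_flatten fun y hy => (hβ1 File.same y hy).1).trans ?_
    rw [c3, flatMap_trip_length]; omega
  rw [flatMap_trip_length] at n0 n2 n3
  rw [flatMap_litw_length] at n1
  refine wp_seq (wp_distributeAllR ctx (T := T) (by omega)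
    (fun x hx => by have := (hTok x hx).le; have := (hTok x hx).lt; omega) c0 n0 ?_ out1 ?_)
  · intro l i h
    rw [hfr1 _ (by simpa using h) (by simp) (by simp) (by simp)]
    exact hnil _ (by simp)
  intro r2 β2 e2 ok2 k2 out2 cont2 nb2 fr2 he2
  have p2 : β2 File.prev = β1 File.prev := fr2 _ (by simp)
  have l2 : β2 File.lits = β1 File.lits := fr2 _ (by simp)
  have m2 : β2 File.same = β1 File.same := fr2 _ (by simp)
  have slots2 : ∀ s ≠ Slot.scan, r2.inp s = [] ∧ r2.pos s = 0 := fun s hs => by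
    rw [k2.inp s hs, k2.pos s hs]; exact slots1 s hs
  refine wp_seq (wp_assign fun _ _ => ⟨{ ok2 with j := Nat.zero_le _ }, ?_⟩)
  refine wp_recoverAll (ps := ps) (ls := ls) ctx hsp (show wt P X T ≤ 3 * P.n by omega) rfl ⟨?_, ?_, ?_⟩ ?_ cont2 nb2
    (by rw [p2]; omega) (by rw [l2]; omega) (by rw [m2]; omega) ?_ out2 ?_ ?_
  · have h := slots2 Slot.prev (by simp)
    have := rd_start (bl := β2 File.prev) h.1 h.2
    rw [p2, c2] at this
    rw [p2]
    refine Rd.congr (r := r2) ?_ rfl rfl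
    simpa using this
  · have h := slots2 Slot.lits (by simp)
    have := rd_start (bl := β2 File.lits) h.1 h.2
    rw [l2, c1] at this
    rw [l2]
    refine Rd.congr (r := r2) ?_ rfl rfl
    simpa using this
  · have h := slots2 Slot.same (by simp)
    have := rd_start (bl := β2 File.same) h.1 h.2
    rw [m2, c3] at this
    rw [m2]
    refine Rd.congr (r := r2) ?_ rfl rfl
    simpa using this
  · intro l i
    rw [fr2 _ (by simp), hfr1 _ (by simp) (by simp) (by simp) (by simp)]
    exact hnil _ (by simp)
  · dsimp only
    rw [k2.Y, Y1]; simp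
  · rw [fr2 _ (by simp), hfr1 _ (by simp) (by simp) (by simp) (by simp)]
    exact hnil _ (by simp)
  intro r3 β3 e3 k hout hcnt he3
  refine ⟨k, hout, hcnt.le ctx.n_le, ?_⟩
  have hz0 : reps (items P.d zs) = repCount zs := reps_items _ _
  have hruns := runs_items hd hz
  have hslack : slack P.d (items P.d zs) ≤ P.d := by
    rcases items P.d zs with _ | ⟨x, ws⟩
    · simp [slack]
    · cases x <;> simp [slack]
  rw [hz0] at hps henc
  rw [hin] at he1
  refine cost_arith (p := ps.length) (l := ls.length) (t := T.length)
    (w := wt P X T) (s := P.segs) (f := P.f) (r := runs (items P.d zs)) (by simpa using he1) he2 he3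
    (recCost_segs_le ctx T) ?_ ?_ hls ?_ hB ?_ hk0 ?_ hcnt.lt.le ctx.segs_B_le' ?_
  · rw [← henc]; exact mul_length_blocks_le hB _
  · unfold rems rem
    rw [p2, l2, m2, mul_add, mul_add]
    have g : ∀ a c : ℕ, P.B * (a - c) ≤ P.B * a := fun a c => Nat.mul_le_mul_left _ (Nat.sub_le _ _)
    have g1 := g (β1 File.prev).length (r2.pos Slot.prev)
    have g2 := g (β1 File.lits).length (r2.pos Slot.lits)
    have g3 := g (β1 File.same).length (r2.pos Slot.same)
    dsimp only
    omega
  · rw [ctx.len, Nat.sub_zero] at hruns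
    omega
  · have hbd : P.b = P.d * P.m := rfl
    have hm := ctx.m_pos
    -- The bound on `b * ps.length` becomes one on `d * ps.length` by cancelling `m`; the summand `2
    -- * n` is first inflated by a factor `m`, which the final estimate can afford.
    refine Nat.le_of_mul_le_mul_left ?_ hm
    calc P.m * (P.d * ps.length) = P.b * ps.length := by rw [hbd]; ring
      _ ≤ 2 * P.n + 3 * P.b * repCount zs := hps
      _ ≤ P.m * (2 * P.n) + 3 * P.b * repCount zs :=
          Nat.add_le_add_right (Nat.le_mul_of_pos_left _ hm) _
      _ = P.m * (2 * P.n + 3 * (P.d * repCount zs)) := by rw [hbd]; ring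
  · have h1 := d_mul_wt_le ctx hTok
    have h2 : P.d * T.length ≤ P.d * ps.length := Nat.mul_le_mul_left _ hk0
    omega
  · rcases Nat.eq_zero_or_pos P.L with h | h
    · simp [h]
    · exact Nat.mul_le_mul_left _ (ctx.segs_B_le h)

/-! Word size, choice of the parameters, and the number of rounds. -/

theorem Exec.mono {ok ok' : Ram → Prop} (h : ∀ r, ok r → ok' r) {S : Prog} {r r' : Ram} {D D' : Disk}
    {k : ℕ} (hE : Exec ok S r D k r' D') : Exec ok' S r D k r' D' := by
  induction hE with
  | skip r D => exact Exec.skip r D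
  | assign g r D h1 => exact Exec.assign g r D (h _ h1)
  | read a r D h1 => exact Exec.read a r D (h _ h1)
  | write a r D => exact Exec.write a r D
  | seq _ _ h1 h2 => exact Exec.seq h1 h2
  | cond_true hb _ h1 => exact Exec.cond_true hb h1
  | cond_false hb _ h1 => exact Exec.cond_false hb h1
  | loop_false hb => exact Exec.loop_false hb
  | loop_true hb _ _ h1 h2 => exact Exec.loop_true hb h1 h2

theorem size_le_clog {n v c : ℕ} (h : v < 2 ^ c * n) : Nat.size v ≤ Nat.clog 2 n + c := by
  rw [Nat.size_le, pow_add, mul_comm]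
  exact h.trans_le (Nat.mul_le_mul_left _ (Nat.le_pow_clog (by omega) n))

/-- If `d = 1`, a single symbol takes at most `k * ⌈log₂ n⌉` bits by `σ ≤ n ^ k`. Otherwise `σ ^ d ≤
n` gives `d * ⌊log₂ σ⌋ ≤ ⌈log₂ n⌉`, and rounding `log₂ σ` up instead of down at most doubles it
because `2 ≤ σ`. The first case is why the word size depends on `k`. -/
theorem Params.d_mul_clog_le (P : Params) {k : ℕ} (hn : 2 ≤ P.n) (hσ : 2 ≤ P.σ)
    (hk : P.σ ≤ P.n ^ k) : P.d * Nat.clog 2 P.σ ≤ (k + 2) * Nat.clog 2 P.n := by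
  have h1 : Nat.clog 2 P.σ ≤ k * Nat.clog 2 P.n := by
    refine Nat.clog_le_of_le_pow (hk.trans ?_)
    rw [mul_comm, pow_mul]
    exact Nat.pow_le_pow_left (Nat.le_pow_clog (by omega) _) _
  rcases max_choice 1 (Nat.log P.σ P.n) with h | h
  · have : P.d = 1 := h
    rw [this, one_mul, add_mul]
    omega
  · have hd : P.d = Nat.log P.σ P.n := h
    have h2 : Nat.clog 2 P.σ ≤ 2 * Nat.log 2 P.σ := by
      have h3 : 0 < Nat.log 2 P.σ := Nat.log_pos (by omega) hσ
      have h4 : Nat.clog 2 P.σ ≤ Nat.log 2 P.σ + 1 :=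
        Nat.clog_le_of_le_pow (Nat.lt_pow_succ_log_self (by omega) _).le
      omega
    have h5 : P.d * Nat.log 2 P.σ ≤ Nat.clog 2 P.n := by
      rw [← Nat.pow_le_pow_iff_right (a := 2) (by omega), mul_comm, pow_mul]
      calc (2 ^ Nat.log 2 P.σ) ^ P.d ≤ P.σ ^ P.d :=
            Nat.pow_le_pow_left (Nat.pow_log_le_self 2 (by omega)) _
        _ ≤ P.n := by rw [hd]; exact Nat.pow_log_le_self _ (by omega)
        _ ≤ 2 ^ Nat.clog 2 P.n := Nat.le_pow_clog (by omega) _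
    calc P.d * Nat.clog 2 P.σ ≤ P.d * (2 * Nat.log 2 P.σ) := Nat.mul_le_mul_left _ h2
      _ = 2 * (P.d * Nat.log 2 P.σ) := by ring
      _ ≤ 2 * Nat.clog 2 P.n := Nat.mul_le_mul_left _ h5
      _ ≤ (k + 2) * Nat.clog 2 P.n := Nat.mul_le_mul_right _ (by omega)

/-- Integers stay below `16 * n`, which is four bits more than `⌈log₂ n⌉`, plus the bit for the
kind. A string needs `(k + 2) * ⌈log₂ n⌉` bits for its symbols and little more than `⌈log₂ n⌉` for
length and kind. As `⌈log₂ n⌉` is at least one, `k + 10` covers both. -/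
theorem CellOK.fits {P : Params} {k : ℕ} (hn : 2 ≤ P.n) (hσ : 2 ≤ P.σ) (hk : P.σ ≤ P.n ^ k)
    {x : Cell} (h : CellOK P x) : x.Fits P.σ ((k + 10) * Nat.clog 2 P.n) := by
  have hc : 0 < Nat.clog 2 P.n := Nat.clog_pos (by omega) hn
  cases x with
  | int v =>
    have hv : v ≤ 8 * P.n + 8 := h
    have h1 : Nat.size v ≤ Nat.clog 2 P.n + 4 := size_le_clog (by omega)
    simp only [Cell.Fits, Cell.bits]
    rw [add_mul]
    omega
  | str s =>
    obtain ⟨h1, h2⟩ := h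
    refine ⟨h2, ?_⟩
    have hd : P.d ≤ P.n := max_le (by omega) (Nat.log_le_self _ _)
    have h3 : Nat.size s.length ≤ Nat.clog 2 P.n + 1 := size_le_clog (by omega)
    have h4 : s.length * Nat.clog 2 P.σ ≤ P.d * Nat.clog 2 P.σ := Nat.mul_le_mul_right _ h1
    have h5 := P.d_mul_clog_le hn hσ hk
    simp only [Cell.bits]
    rw [add_mul] at h5 ⊢
    omega

theorem RamOK.fits {P : Params} {k : ℕ} (hn : 2 ≤ P.n) (hσ : 2 ≤ P.σ) (hk : P.σ ≤ P.n ^ k)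
    (hadm : P.Admissible) {r : Ram} (h : RamOK P r) :
    P.RamFits ((k + 10) * Nat.clog 2 P.n) r where
  words := hadm.fits
  io_len := h.io.len
  inp_len s := (h.inp s).len
  out_len c := (h.out c).len
  out_nil := h.out_nil
  Y_len := by
    rw [pack_length]
    have hd := P.d_pos
    have h1 : r.Y.length ≤ P.d * P.m := h.Y_len
    refine Nat.le_of_lt_succ ((Nat.div_lt_iff_lt_mul hd).2 ?_)
    rw [Nat.succ_mul, mul_comm P.m]
    omega
  io_fits x hx := (h.io.cells x hx).fits hn hσ hk
  inp_fits s x hx := ((h.inp s).cells x hx).fits hn hσ hk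
  out_fits c x hx := ((h.out c).cells x hx).fits hn hσ hk
  Y_fits x hx := (cellOK_of_mem_pack h.Y_lt hx).fits hn hσ hk
  w_fits := CellOK.fits (x := Cell.str r.w) hn hσ hk ⟨h.w_len, h.w_lt⟩
  pos_fits s := CellOK.fits (x := Cell.int _) hn hσ hk (h.pos s)
  reg_fits v hv := by
    refine CellOK.fits (x := Cell.int v) hn hσ hk ?_
    simp only [List.mem_cons, List.not_mem_nil, or_false] at hv
    rcases hv with rfl | rfl | rfl | rfl | rfl | rfl | rfl | rfl | rfl
    exacts [h.p, h.q, h.l, h.t, h.j, h.lev, h.i, h.c, h.cnt]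

/-! ### Existence of admissible parameters. -/

theorem exists_admissible (n σ : ℕ) {M B : ℕ} (hB : 1 ≤ B) (hM : 64 * B ≤ M) :
    ∃ m f : ℕ, (Params.mk n σ M B m f).Admissible := by
  -- The array gets half of the RAM rounded up to whole blocks, and `f` is `M / (16 * B)` rounded
  -- up. Then `64 * B ≤ M` leaves room for the rounding, the five further buffers and the registers,
  -- and makes `f` at least four.
  refine ⟨B * ((M + 2 * B - 1) / (2 * B)), (M - 1) / (16 * B) + 1, Nat.dvd_mul_right _ _, ?_, ?_,
    Or.inl ?_, ?_⟩
  · have h1 := le_ceil_mul (B := 2 * B) (by omega) M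
    calc M ≤ (M + 2 * B - 1) / (2 * B) * (2 * B) := h1
      _ = 2 * (B * ((M + 2 * B - 1) / (2 * B))) := by ring
  · have : 3 ≤ (M - 1) / (16 * B) := (Nat.le_div_iff_mul_le (by omega)).2 (by omega)
    dsimp only
    omega
  · have h1 := Nat.lt_div_mul_add (a := M - 1) (b := 16 * B) (by omega)
    dsimp only
    calc M ≤ (M - 1) / (16 * B) * (16 * B) + 16 * B := by omega
      _ = _ := by ring
  · have h1 := Nat.div_mul_le_self (M - 1) (16 * B)
    have h2 := Nat.div_mul_le_self (M + 2 * B - 1) (2 * B)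
    unfold Params.ramWords
    dsimp only
    generalize (M - 1) / (16 * B) = u at *
    generalize (M + 2 * B - 1) / (2 * B) = v at *
    have e1 : u * (16 * B) = 16 * (u * B) := by ring
    have e2 : v * (2 * B) = 2 * (B * v) := by ring
    have e3 : (u + 1 + 5) * B = u * B + 6 * B := by ring
    rw [e1] at h1
    rw [e2] at h2
    rw [e3]
    omega

/-! ### The number of rounds and the final estimate in real numbers. -/

section

variable {P : Params} {X : List ℕ} (ctx : Ctx P X)
include ctx

theorem Ctx.logb_pos : 0 < Real.logb P.σ P.n := by
  have h1 := ctx.two_le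
  have h2 := ctx.two_le_sigma
  exact Real.logb_pos (by exact_mod_cast (by omega : 1 < P.σ)) (by exact_mod_cast (by omega : 1 < P.n))

/-- Rounding `log_σ n` down loses less than one, which is at most `d`. -/
theorem Ctx.logb_le : Real.logb P.σ P.n ≤ 2 * P.d := by
  have h1 := ctx.two_le
  have h2 := ctx.two_le_sigma
  have h3 : P.n ≤ P.σ ^ (P.d + 1) :=
    (Nat.lt_pow_succ_log_self (by omega) _).le.trans
      (Nat.pow_le_pow_right (by omega) (Nat.succ_le_succ (le_max_right _ _)))
  have h4 : Real.logb P.σ P.n ≤ (P.d + 1 : ℕ) := by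
    rw [Real.logb_le_iff_le_rpow (by exact_mod_cast (by omega : 1 < P.σ))
      (by exact_mod_cast (by omega : 0 < P.n)), Real.rpow_natCast]
    exact_mod_cast h3
  have h5 : (1 : ℝ) ≤ P.d := by exact_mod_cast P.d_pos
  push_cast at h4
  linarith

theorem Ctx.div_le : (P.n : ℝ) / (P.d * P.B) ≤ 2 * (P.n / (P.B * Real.logb P.σ P.n)) := by
  have h1 := ctx.logb_pos
  have h2 := ctx.logb_le
  have h3 : (1 : ℝ) ≤ P.B := by exact_mod_cast ctx.B_pos
  have h4 : (1 : ℝ) ≤ P.d := by exact_mod_cast P.d_pos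
  rw [← mul_div_assoc, div_le_div_iff₀ (by positivity) (by positivity)]
  have h5 : (0 : ℝ) ≤ P.n * P.B := by positivity
  nlinarith [mul_le_mul_of_nonneg_left h2 h5]

/-- A segment has at least `32 * d * B` symbols, and two or more segments satisfy `segs * b < 2 *
n`. This outweighs the factor two lost between `d` and `log_σ n`. -/
theorem Ctx.segs_le_div (hs : 2 ≤ P.segs) :
    (P.segs : ℝ) ≤ P.n / (P.B * Real.logb P.σ P.n) := by
  have h1 := ctx.div_le
  have h2 := ctx.segs_mul_lt
  have h3 : 2 * P.b ≤ P.segs * P.b := Nat.mul_le_mul_right _ hs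
  have h4 : P.d * (32 * P.B) ≤ P.b := Nat.mul_le_mul_left _ ctx.m_ge
  have h5 : P.segs * (P.d * (32 * P.B)) ≤ P.segs * P.b := Nat.mul_le_mul_left _ h4
  have h6 : P.segs * (2 * (P.d * P.B)) ≤ P.n := by
    have : P.segs * (P.d * (32 * P.B)) = 16 * (P.segs * (2 * (P.d * P.B))) := by ring
    omega
  have h7 : (0 : ℝ) < P.d * P.B := by
    have := Nat.mul_pos P.d_pos ctx.B_pos
    exact_mod_cast this
  have h8 : 2 * (P.segs : ℝ) ≤ P.n / (P.d * P.B) := by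
    rw [le_div_iff₀ h7]
    have : ((P.segs * (2 * (P.d * P.B)) : ℕ) : ℝ) ≤ P.n := by exact_mod_cast h6
    push_cast at this
    linarith
  linarith

/-- For `L ≥ 2`, minimality of `L` gives `f ^ (L - 1) < segs`, which is at most the quantity under
the logarithm. Moreover `f < segs`, so the exceptional case of the fan-out condition is excluded and
`f` is of order `M / B`. -/
theorem Ctx.L_le_logb : (P.L : ℝ) ≤
    1 + 3 * max 1 (Real.logb ((P.M : ℝ) / P.B) (P.n / (P.B * Real.logb P.σ P.n))) := by
  set x : ℝ := P.n / (P.B * Real.logb P.σ P.n) with hx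
  have hmax := le_max_left 1 (Real.logb ((P.M : ℝ) / P.B) x)
  have hf4 := ctx.adm.four_le
  rcases Nat.lt_or_ge P.L 2 with hL | hL
  · have : (P.L : ℝ) ≤ 1 := by exact_mod_cast (by omega : P.L ≤ 1)
    linarith
  have hlt : P.f ^ (P.L - 1) < P.segs := by
    rw [← Nat.lt_clog_iff_pow_lt (by omega)]
    change P.L - 1 < P.L
    omega
  have hfs : P.f < P.segs := by
    refine lt_of_le_of_lt ?_ hlt
    exact Nat.le_self_pow (by omega) _
  have hfan : P.M ≤ 16 * (P.f * P.B) := by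
    rcases ctx.adm.fanout with h | h
    · exact h
    · omega
  have hsx := ctx.segs_le_div (by omega)
  rw [← hx] at hsx
  have hB : (0 : ℝ) < P.B := by exact_mod_cast ctx.B_pos
  have hf : (4 : ℝ) ≤ P.f := by exact_mod_cast hf4
  have hMB : (64 : ℝ) ≤ P.M / P.B := by
    rw [le_div_iff₀ hB]
    exact_mod_cast ctx.le_M
  -- The fan-out falls short of `M / B` by a factor of at most 16, and `16 ≤ f ^ 2` since `4 ≤ f`.
  -- This exponent is the factor three in the bound.
  have hMf : (P.M : ℝ) / P.B ≤ (P.f : ℝ) ^ 3 := by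
    have h1 : (P.M : ℝ) ≤ 16 * (P.f * P.B) := by exact_mod_cast hfan
    rw [div_le_iff₀ hB]
    have h2 : 16 * (P.f : ℝ) ≤ (P.f : ℝ) ^ 3 := by nlinarith [mul_self_nonneg ((P.f : ℝ) - 4)]
    nlinarith
  have hlf : 0 < Real.log P.f := Real.log_pos (by linarith)
  have hlM : 0 < Real.log ((P.M : ℝ) / P.B) := Real.log_pos (by linarith)
  have h1 : Real.log ((P.M : ℝ) / P.B) ≤ 3 * Real.log P.f := by
    have := Real.log_le_log (by linarith) hMf
    rwa [Real.log_pow] at this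
  have h2 : ((P.L - 1 : ℕ) : ℝ) * Real.log P.f ≤ Real.log x := by
    rw [← Real.log_pow]
    refine Real.log_le_log (by positivity) (le_trans ?_ hsx)
    exact_mod_cast hlt.le
  rw [Nat.cast_sub (by omega), Nat.cast_one] at h2
  have h3 : ((P.L : ℝ) - 1) / 3 ≤ Real.logb ((P.M : ℝ) / P.B) x := by
    rw [Real.logb, le_div_iff₀ hlM]
    have h4 : (0 : ℝ) ≤ (P.L : ℝ) - 1 := by
      have : (2 : ℝ) ≤ P.L := by exact_mod_cast hL
      linarith
    nlinarith
  have h5 := le_max_right 1 (Real.logb ((P.M : ℝ) / P.B) x)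
  linarith

/-- With `x` the argument of the logarithm, `n / (d * B) ≤ 2 * x`, `z / B ≤ |K| * x` and a single
extra block give `3 + |K|`. The number of rounds gives `L + 1 ≤ 5 * y` with `y` the second maximum,
and `1500 = 300 * 5`. The absolute value spares a distinction by the sign of `K`. -/
theorem Ctx.ios_le {e z : ℕ} {K : ℝ}
    (he : P.d * (P.B * e) ≤ 300 * ((P.L + 1) * (P.n + P.d * z + P.d * P.B)))
    (hz : (z : ℝ) ≤ K * (P.n / Real.logb P.σ P.n)) :
    (e : ℝ) ≤ 1500 * (3 + |K|) * max 1 (P.n / (P.B * Real.logb P.σ P.n)) *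
      max 1 (Real.logb ((P.M : ℝ) / P.B) (P.n / (P.B * Real.logb P.σ P.n))) := by
  have hL := ctx.L_le_logb
  have hdiv := ctx.div_le
  have hlam := ctx.logb_pos
  have hB : (0 : ℝ) < P.B := by exact_mod_cast ctx.B_pos
  have hd : (0 : ℝ) < P.d := by exact_mod_cast P.d_pos
  set lam := Real.logb P.σ P.n with hlamd
  set x : ℝ := P.n / (P.B * lam) with hx
  set y := max 1 (Real.logb ((P.M : ℝ) / P.B) x) with hy
  have hy1 : 1 ≤ y := le_max_left _ _
  have hx0 : 0 ≤ x := by positivity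
  have hm1 : 1 ≤ max 1 x := le_max_left _ _
  have hmx : x ≤ max 1 x := le_max_right _ _
  have hzB : (z : ℝ) / P.B ≤ |K| * x := by
    have h1 : K * (P.n / lam) ≤ |K| * (P.n / lam) :=
      mul_le_mul_of_nonneg_right (le_abs_self K) (by positivity)
    rw [div_le_iff₀ hB]
    have h2 : |K| * x * P.B = |K| * (P.n / lam) := by
      rw [hx]; field_simp
    linarith
  have he' : (e : ℝ) ≤ 300 * ((P.L + 1) * (P.n / (P.d * P.B) + z / P.B + 1)) := by
    have h1 : (P.d : ℝ) * (P.B * e) ≤ 300 * ((P.L + 1) * (P.n + P.d * z + P.d * P.B)) := by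
      exact_mod_cast he
    have h2 : 300 * (((P.L : ℝ) + 1) * (P.n + P.d * z + P.d * P.B)) =
        (300 * ((P.L + 1) * (P.n / (P.d * P.B) + z / P.B + 1))) * (P.d * P.B) := by
      field_simp
    rw [h2] at h1
    refine le_of_mul_le_mul_right ?_ (mul_pos hd hB)
    linarith
  have h1 : (P.n : ℝ) / (P.d * P.B) + z / P.B + 1 ≤ (3 + |K|) * max 1 x := by
    have h2 : |K| * x ≤ |K| * max 1 x := mul_le_mul_of_nonneg_left hmx (abs_nonneg K)
    nlinarith
  have h3 : (P.L : ℝ) + 1 ≤ 5 * y := by linarith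
  calc (e : ℝ) ≤ 300 * ((P.L + 1) * (P.n / (P.d * P.B) + z / P.B + 1)) := he'
    _ ≤ 300 * (5 * y * ((3 + |K|) * max 1 x)) := by gcongr
    _ = _ := by ring

end

end EMLZ

/-! ### The main theorem. -/

theorem mainTheorem3 (k : ℕ) :
    ∃ κ : ℕ, ∀ K : ℝ, ∃ C : ℝ, ∀ n σ M B : ℕ,
      2 ≤ n → 2 ≤ σ → σ ≤ n ^ k → 1 ≤ B → 64 * B ≤ M →
      (∃ m f : ℕ, (EMLZ.Params.mk n σ M B m f).Admissible) ∧
      ∀ P : EMLZ.Params, P.n = n → P.σ = σ → P.M = M → P.B = B → P.Admissible →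
      ∀ (X : List ℕ) (zs : List EMLZ.Phrase),
        X.length = n → (∀ x ∈ X, x < σ) → EMLZ.Factorizes X zs →
        (EMLZ.repCount zs : ℝ) ≤ K * (n / Real.logb σ n) →
        ∃ (ios : ℕ) (r : EMLZ.Ram) (D : EMLZ.Disk),
          EMLZ.Exec (P.RamFits (κ * Nat.clog 2 n)) P.decoder
            EMLZ.initRam (EMLZ.initDisk B (EMLZ.encode P.d zs)) ios r D ∧
          (∀ i, D (EMLZ.Addr.block EMLZ.File.output i) =
            EMLZ.blockOf B (EMLZ.pack P.d X) i) ∧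
          (ios : ℝ) ≤ C * max 1 (n / (B * Real.logb σ n)) *
            max 1 (Real.logb ((M : ℝ) / B) (n / (B * Real.logb σ n))) := by
  refine ⟨k + 10, fun K => ⟨1500 * (3 + |K|), fun n σ M B hn hσ hk hB hM =>
    ⟨EMLZ.exists_admissible n σ hB hM, ?_⟩⟩⟩
  rintro P rfl rfl rfl rfl hadm X zs hX hlt hzs hz
  have ctx : EMLZ.Ctx P X := ⟨hX, hlt, hn, hσ, hB, hM, hadm⟩
  have hit := EMLZ.itemsFrom_items P.d_pos hzs
  obtain ⟨ios, r, D, β, hE, -, -, hD, j, hout, hj, hcost⟩ := EMLZ.wp_decoder ctx hzs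
    EMLZ.initRam_ok
    (EMLZ.initStore_ok hB fun x hx => EMLZ.cellOK_of_itemsFrom ctx hit
      (by rwa [← EMLZ.encode_eq_items]))
    _ (EMLZ.holds_init hB _)
  rw [zero_add] at hcost
  refine ⟨ios, r, D, hE.mono fun r hr => hr.fits hn hσ hk hadm, fun i => ?_, ctx.ios_le hcost hz⟩
  rw [hD.block, hout]
  exact EMLZ.getD_outBlocks ctx hj i
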